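/- **Notation.** Let $\mathbb{T}^2=(\mathbb{R}/2\pi\mathbb{Z})^2$, $\Box=\partial_{x_1}^2-\partial_{x_2}^2$, $S(t)=e^{it\Box}$, $\langle x\rangle=(1+|x|^2)^{1/2}$, and $|n|_-^2=j^2-k^2$ for $n=(j,k)\in\mathbb{Z}^2$. Consider the cubic hyperbolic nonlinear Schrödinger equation (HNLS) $i\partial_tu+\Box u+|u|^2u=0$ on $\mathbb{T}^2$. For $s,b\in\mathbb{R}$ and $1<p<\infty$ let $\|f\|_{\mathcal{F}L^{s,p}}=\|\langle n\rangle^s\widehat f(n)\|_{\ell^p(\mathbb{Z}^2)}$, $\|u\|_{X^{s,b}_p}=\|\langle n\rangle^s\langle\tau+|n|_-^2\rangle^b\,\widehat u(\tau,n)\|_{\ell^p_nL^p_\tau(\mathbb{Z}^2\times\mathbb{R})}$, and $\|u\|_{X^{s,b}_p(T)}=\inf\{\|v\|_{X^{s,b}_p}: v|_{[0,T]}=u\}$. If $b>1-\frac1p$, then $X^{s,b}_p\subset C(\mathbb{R};\mathcal{F}L^{s,p}(\mathbb{T}^2))$. A solution on $[0,T]$ with $u(0)=f$ is a $u$ with $u(t)=S(t)f+i\int_0^tS(t-t')\big(|u|^2u\big)(t')\,dt'$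 for $0\le t\le T$, where the integral is understood as the limit, in each Fourier coefficient, as $N\to\infty$, of the integrals with $|\mathbf{P}_Nu|^2\mathbf{P}_Nu$ in place of $|u|^2u$; here $\mathbf{P}_N$ is the projection onto the frequencies $|n|\le N$. **Theorem 1.1.** Let $1<p<\infty$ and $s\in\mathbb{R}$. (i) Let $s>1-\frac1p$. Then HNLS is semilinearly locally well-posed in $\mathcal{F}L^{s,p}(\mathbb{T}^2)$. That is, there is $b>1-\frac1p$ such that the following holds. For every $R>0$ there is $T>0$ such that every $f\in\mathcal{F}L^{s,p}(\mathbb{T}^2)$ with $\|f\|_{\mathcal{F}L^{s,p}}<R$ is the initial datum of a solution $u\in C([0,T];\mathcal{F}L^{s,p}(\mathbb{T}^2))\cap X^{s,b}_p(T)$ on $[0,T]$, and the solution map $f\mapsto u$ is $C^\infty$ (over $\mathbb{R}$) from the open ball of radius $R$ to $C([0,T];\mathcal{F}L^{s,p}(\mathbb{T}^2))$ and to $X^{s,b}_p(T)$. Moreover, for every $T>0$, two solutions on $[0,T]$ in $C([0,T];\mathcal{F}L^{s,p}(\mathbb{T}^2))\cap X^{s,b}_p(T)$ with the same initial datum are equal.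 (ii) Let $s<1-\frac1p$. Then HNLS is semilinearly ill-posed in $\mathcal{F}L^{s,p}(\mathbb{T}^2)$: the solution map fails to be $C^3$, already on data that are Fourier-supported on the diagonal $\{(k,k):k\in\mathbb{Z}\}$. That is, let $t>0$ and let $\Phi$ be any map from $\mathcal{F}L^{s,p}(\mathbb{T}^2)$ to itself such that, for all trigonometric polynomials $f$ in some neighbourhood of $0$ in $\mathcal{F}L^{s,p}(\mathbb{T}^2)$ with frequencies on the diagonal, $\Phi(f)=u(t)$ whenever $u\in C([0,t];C^\infty(\mathbb{T}^2))$ is a solution on $[0,t]$ with $u(0)=f$. Then $\Phi$ is not $C^3$ (over $\mathbb{R}$) at $0$. -/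

import Mathlib

open Filter Topology MeasureTheory Set
open scoped ENNReal

noncomputable section

namespace HNLS

/-! ### Frequencies, weights, and the linear propagator

A periodic distribution on `𝕋² = (ℝ/2πℤ)²` is represented by its Fourier coefficients
`n ↦ f̂(n)`, `n ∈ ℤ²`. -/

/-- The frequency lattice `ℤ²`. -/
abbrev Freq : Type := ℤ × ℤ

/-- The Japanese bracket `⟨n⟩ = (1 + |n|²)^{1/2}` of a frequency. -/
def bracket (n : Freq) : ℝ := √(1 + ((n.1 : ℝ) ^ 2 + (n.2 : ℝ) ^ 2))

/-- The hyperbolic modulus `|n|₋² = j² - k²` of `n = (j, k)`; the symbol of `-□`. -/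
def hypSq (n : Freq) : ℝ := (n.1 : ℝ) ^ 2 - (n.2 : ℝ) ^ 2

/-- The hyperbolic Schrödinger propagator `S(t) = e^{it□}`, on the Fourier side. -/
def propagator (t : ℝ) (a : Freq → ℂ) : Freq → ℂ :=
  fun n => Complex.exp (-(Complex.I * t * hypSq n)) * a n

/-- The frequencies with `|n| ≤ N`. -/
def freqBall (N : ℕ) : Finset Freq :=
  (Finset.Icc (-(N : ℤ)) N ×ˢ Finset.Icc (-(N : ℤ)) N).filter
    fun n => n.1 ^ 2 + n.2 ^ 2 ≤ (N : ℤ) ^ 2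

/-- The Fourier coefficients of `|P_N f|² P_N f`, where `a` are those of `f` and `P_N` is the
projection to the frequencies `|n| ≤ N`: the sum of `â(n₁) conj(â(n₂)) â(n₃)` over
`n₁ - n₂ + n₃ = n`, `|n₁|, |n₂|, |n₃| ≤ N`. -/
def cubic (N : ℕ) (a : Freq → ℂ) (n : Freq) : ℂ :=
  ∑ n₁ ∈ freqBall N, ∑ n₂ ∈ freqBall N, ∑ n₃ ∈ freqBall N,
    if n₁ - n₂ + n₃ = n then a n₁ * (starRingEnd ℂ) (a n₂) * a n₃ else 0

/-- `u` solves `i ∂ₜu + □u + |u|²u = 0`, `u(0) = f`, on `[0, T]`, in the Duhamel formulation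
`u(t) = S(t) f + i ∫₀ᵗ S(t - t') (|u|²u)(t') dt'`, for every Fourier coefficient. The values of
`u` may fail to be in `L³(𝕋²)`; the nonlinearity `|u|²u` is the limit of `|P_N u|² P_N u`, in the
sense that the Duhamel integrals converge. -/
def IsSolution (T : ℝ) (f : Freq → ℂ) (u : ℝ → Freq → ℂ) : Prop :=
  ∀ t ∈ Icc (0 : ℝ) T, ∀ n : Freq,
    Tendsto
      (fun N : ℕ => propagator t f n +
        Complex.I * ∫ t' in (0 : ℝ)..t, propagator (t - t') (cubic N (u t')) n)
      atTop (𝓝 (u t n))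

/-! ### Fourier–Lebesgue spaces -/

theorem bracket_pos (n : Freq) : 0 < bracket n := by
  unfold bracket; positivity

/-- The underlying vector space of `FL^{s,p}(𝕋²)`: coefficients with `⟨n⟩^s f̂(n) ∈ ℓ^p(ℤ²)`. -/
def FLSubmodule (s : ℝ) (p : ℝ≥0∞) : Submodule ℂ (Freq → ℂ) where
  carrier := {a | Memℓp (fun n => ((bracket n ^ s : ℝ) : ℂ) * a n) p}
  zero_mem' := by
    refine (congrArg (fun x : Freq → ℂ => Memℓp x p) ?_).mp zero_memℓp
    funext n; simp
  add_mem' := by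
    intro a c ha hc
    have := Memℓp.add ha hc
    refine (congrArg (fun x : Freq → ℂ => Memℓp x p) ?_).mp this
    funext n; simp [mul_add]
  smul_mem' := by
    intro k a ha
    have := Memℓp.const_smul ha k
    refine (congrArg (fun x : Freq → ℂ => Memℓp x p) ?_).mp this
    funext n; simp [mul_left_comm]

/-- The Fourier–Lebesgue space `FL^{s,p}(𝕋²)`. -/
def FL (s : ℝ) (p : ℝ≥0∞) : Type := ↥(FLSubmodule s p)

instance (s : ℝ) (p : ℝ≥0∞) : AddCommGroup (FL s p) :=
  inferInstanceAs (AddCommGroup ↥(FLSubmodule s p))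

instance (s : ℝ) (p : ℝ≥0∞) : Module ℂ (FL s p) :=
  inferInstanceAs (Module ℂ ↥(FLSubmodule s p))

/-- The Fourier coefficients of `f ∈ FL^{s,p}(𝕋²)`. -/
def FL.coeff {s : ℝ} {p : ℝ≥0∞} (f : FL s p) : Freq → ℂ := Subtype.val f

/-- The map `f ↦ ⟨n⟩^s f̂(n)` into `ℓ^p(ℤ²)`. -/
def FL.weighted (s : ℝ) (p : ℝ≥0∞) : FL s p →ₗ[ℂ] lp (fun _ : Freq => ℂ) p where
  toFun f := ⟨fun n => ((bracket n ^ s : ℝ) : ℂ) * f.coeff n, f.2⟩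
  map_add' f g := by
    ext n; exact mul_add _ _ _
  map_smul' k f := by
    ext n; exact mul_left_comm _ _ _

theorem FL.weighted_injective (s : ℝ) (p : ℝ≥0∞) :
    Function.Injective (FL.weighted s p) := by
  intro f g h
  refine Subtype.ext (funext fun n => ?_)
  have h1 := congrArg (fun x : lp (fun _ : Freq => ℂ) p => x n) h
  have h2 : ((bracket n ^ s : ℝ) : ℂ) ≠ 0 :=
    Complex.ofReal_ne_zero.mpr (Real.rpow_pos_of_pos (bracket_pos n) s).ne'
  exact mul_left_cancel₀ h2 h1

/-- The norm `‖f‖_{FL^{s,p}} = ‖⟨n⟩^s f̂(n)‖_{ℓ^p}`. -/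
instance (s : ℝ) (p : ℝ≥0∞) [Fact (1 ≤ p)] : NormedAddCommGroup (FL s p) :=
  NormedAddCommGroup.induced (FL s p) (lp (fun _ : Freq => ℂ) p) (FL.weighted s p)
    (FL.weighted_injective s p)

instance (s : ℝ) (p : ℝ≥0∞) [Fact (1 ≤ p)] : NormedSpace ℂ (FL s p) :=
  NormedSpace.induced ℂ (FL s p) (lp (fun _ : Freq => ℂ) p) (FL.weighted s p)

/-! ### Fourier restriction norm spaces -/

/-- Counting measure in `n` times Lebesgue measure in `τ`, on `ℤ² × ℝ`. -/
abbrev freqMeasure : Measure (Freq × ℝ) := (Measure.count : Measure Freq).prod volume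

/-- The weight `⟨n⟩^s ⟨τ + |n|₋²⟩^b`. -/
def xWeight (s b : ℝ) (z : Freq × ℝ) : ℝ :=
  bracket z.1 ^ s * √(1 + (z.2 + hypSq z.1) ^ 2) ^ b

theorem xWeight_pos (s b : ℝ) (z : Freq × ℝ) : 0 < xWeight s b z := by
  have := bracket_pos z.1
  unfold xWeight; positivity

theorem measurable_xWeight (s b : ℝ) :
    Measurable (fun z : Freq × ℝ => ((xWeight s b z : ℝ) : ℂ)) := by
  have h1 : Measurable (fun z : Freq × ℝ => bracket z.1) :=
    (measurable_of_countable bracket).comp measurable_fst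
  have h2 : Measurable (fun z : Freq × ℝ => hypSq z.1) :=
    (measurable_of_countable hypSq).comp measurable_fst
  unfold xWeight
  fun_prop

/-- Multiplication by the weight, on (classes of) measurable functions on `ℤ² × ℝ`. -/
def xMul (s b : ℝ) : (Freq × ℝ →ₘ[freqMeasure] ℂ) →ₗ[ℂ] (Freq × ℝ →ₘ[freqMeasure] ℂ) where
  toFun g := AEEqFun.mk _ (measurable_xWeight s b).aestronglyMeasurable * g
  map_add' g h := by
    induction g, h using AEEqFun.induction_on₂ with
    | _ g hg h hh => simp only [AEEqFun.mk_add_mk, AEEqFun.mk_mul_mk, mul_add]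
  map_smul' k g := by
    induction g using AEEqFun.induction_on with
    | _ g hg => simp only [AEEqFun.smul_mk, AEEqFun.mk_mul_mk, mul_smul_comm, RingHom.id_apply]

/-- The underlying vector space of `X^{s,b}_p`: space-time Fourier transforms `û(n, τ)` with
`⟨n⟩^s ⟨τ + |n|₋²⟩^b û ∈ ℓ^p_n L^p_τ`. -/
def XSubmodule (s b : ℝ) (p : ℝ≥0∞) : Submodule ℂ (Freq × ℝ →ₘ[freqMeasure] ℂ) :=
  (Lp.LpSubmodule ℂ ℂ p freqMeasure).comap (xMul s b)

/-- The space `X^{s,b}_p` of space-time distributions on `ℝ × 𝕋²`. -/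
def X (s b : ℝ) (p : ℝ≥0∞) : Type := ↥(XSubmodule s b p)

instance (s b : ℝ) (p : ℝ≥0∞) : AddCommGroup (X s b p) :=
  inferInstanceAs (AddCommGroup ↥(XSubmodule s b p))

instance (s b : ℝ) (p : ℝ≥0∞) : Module ℂ (X s b p) :=
  inferInstanceAs (Module ℂ ↥(XSubmodule s b p))

/-- The space-time Fourier transform `û(n, τ)` of `u ∈ X^{s,b}_p`. -/
def X.hat {s b : ℝ} {p : ℝ≥0∞} (u : X s b p) : Freq × ℝ →ₘ[freqMeasure] ℂ := Subtype.val u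

/-- The map `u ↦ ⟨n⟩^s ⟨τ + |n|₋²⟩^b û` into `L^p(ℤ² × ℝ) = ℓ^p_n L^p_τ`. -/
def X.weighted (s b : ℝ) (p : ℝ≥0∞) : X s b p →ₗ[ℂ] Lp ℂ p freqMeasure where
  toFun u := ⟨xMul s b u.hat, u.2⟩
  map_add' u v := Subtype.ext ((xMul s b).map_add u.hat v.hat)
  map_smul' k u := Subtype.ext ((xMul s b).map_smul k u.hat)

theorem X.coeFn_weighted {s b : ℝ} {p : ℝ≥0∞} (u : X s b p) :
    ∀ᵐ z ∂freqMeasure, X.weighted s b p u z = (xWeight s b z : ℂ) * u.hat z := by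
  have h1 := AEEqFun.coeFn_mul
    (AEEqFun.mk _ (measurable_xWeight s b).aestronglyMeasurable) u.hat
  have h2 := AEEqFun.coeFn_mk (μ := freqMeasure) _
    (measurable_xWeight s b).aestronglyMeasurable
  filter_upwards [h1, h2] with z h1 h2
  exact h1.trans (by rw [Pi.mul_apply, h2])

theorem X.weighted_injective (s b : ℝ) (p : ℝ≥0∞) :
    Function.Injective (X.weighted s b p) := by
  intro u v h
  refine Subtype.ext (AEEqFun.ext ?_)
  have h2 := X.coeFn_weighted v
  rw [← h] at h2
  filter_upwards [X.coeFn_weighted u, h2] with z h1 h2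
  exact mul_left_cancel₀ (Complex.ofReal_ne_zero.mpr (xWeight_pos s b z).ne') (h1.symm.trans h2)

/-- The norm `‖u‖_{X^{s,b}_p} = ‖⟨n⟩^s ⟨τ + |n|₋²⟩^b û(n, τ)‖_{ℓ^p_n L^p_τ}`. -/
instance (s b : ℝ) (p : ℝ≥0∞) [Fact (1 ≤ p)] : NormedAddCommGroup (X s b p) :=
  NormedAddCommGroup.induced (X s b p) (Lp ℂ p freqMeasure) (X.weighted s b p)
    (X.weighted_injective s b p)

instance (s b : ℝ) (p : ℝ≥0∞) [Fact (1 ≤ p)] : NormedSpace ℂ (X s b p) :=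
  NormedSpace.induced ℂ (X s b p) (Lp ℂ p freqMeasure) (X.weighted s b p)

/-- The `n`-th Fourier coefficient of `u(t)`, by Fourier inversion in time (up to the
normalization of the Fourier transform). For `1 < p < ∞` and `b > 1 - 1/p` the integral converges
absolutely for all `u ∈ X^{s,b}_p`. -/
def X.coeff {s b : ℝ} {p : ℝ≥0∞} (u : X s b p) (t : ℝ) (n : Freq) : ℂ :=
  ∫ τ : ℝ, Complex.exp (Complex.I * t * τ) * u.hat (n, τ)

/-- The exponents for which `X^{s,b}_p` embeds into `C(ℝ; FL^{s,p})`. -/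
def Admissible (b : ℝ) (p : ℝ≥0∞) : Prop := 1 < p ∧ p ≠ ⊤ ∧ 1 - 1 / p.toReal < b

theorem map_slice_le (n : Freq) :
    Measure.map (Prod.mk n) (volume : Measure ℝ) ≤ freqMeasure := by
  refine Measure.le_intro fun A hA _ => ?_
  rw [Measure.map_apply measurable_prodMk_left hA, Measure.prod_apply hA, lintegral_count]
  exact ENNReal.le_tsum (f := fun m : Freq => volume (Prod.mk m ⁻¹' A)) n

theorem ae_slice {P : Freq × ℝ → Prop} (h : ∀ᵐ z ∂freqMeasure, P z) (n : Freq) :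
    ∀ᵐ τ : ℝ, P (n, τ) :=
  ae_of_ae_map measurable_prodMk_left.aemeasurable
    ((Measure.absolutelyContinuous_of_le (map_slice_le n)).ae_le h)

/-- The function `e^{itτ} / (⟨n⟩^s ⟨τ + |n|₋²⟩^b)` of `τ`, which represents evaluation at `(t, n)`. -/
def evalKernel (s b t : ℝ) (n : Freq) (τ : ℝ) : ℂ :=
  Complex.exp (Complex.I * t * τ) * ((xWeight s b (n, τ) : ℝ) : ℂ)⁻¹

theorem Admissible.holderConjugate {b : ℝ} {p : ℝ≥0∞} (h : Admissible b p) :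
    ENNReal.HolderConjugate p (ENNReal.conjExponent p) :=
  ENNReal.HolderConjugate.conjExponent h.1.le

theorem memLp_evalKernel {b : ℝ} {p : ℝ≥0∞} (h : Admissible b p) (s t : ℝ) (n : Freq) :
    MemLp (evalKernel s b t n) (ENNReal.conjExponent p) := by
  have hq := h.holderConjugate
  set q := ENNReal.conjExponent p
  have hqtop : q ≠ ⊤ := (ENNReal.HolderConjugate.lt_top_iff_one_lt q p).mpr h.1 |>.ne
  have hq0 : q ≠ 0 := (ENNReal.HolderConjugate.symm (p := p) (q := q)).ne_zero
  have hqr : 0 < q.toReal := ENNReal.toReal_pos hq0 hqtop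
  have hsum : 1 / p.toReal + 1 / q.toReal = 1 := by
    have h1 := congrArg ENNReal.toReal (ENNReal.HolderConjugate.inv_add_inv_eq_one p q)
    rw [ENNReal.toReal_add (ENNReal.inv_ne_top.mpr (zero_lt_one.trans h.1).ne')
      (ENNReal.inv_ne_top.mpr hq0)] at h1
    simpa using h1
  have hbq : 1 < b * q.toReal := by
    have h1 : 1 / q.toReal < b := by linarith [h.2.2]
    rwa [div_lt_iff₀ hqr] at h1
  have hm : AEStronglyMeasurable (evalKernel s b t n) (volume : Measure ℝ) := by
    have h1 : Measurable (fun τ : ℝ => ((xWeight s b (n, τ) : ℝ) : ℂ)) :=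
      (measurable_xWeight s b).comp measurable_prodMk_left
    refine Measurable.aestronglyMeasurable ?_
    unfold evalKernel
    exact (by fun_prop : Measurable fun τ : ℝ => Complex.exp (Complex.I * t * τ)).mul h1.inv
  rw [← integrable_norm_rpow_iff hm hq0 hqtop]
  have h2 : Integrable (fun τ : ℝ => (1 + ‖τ‖ ^ 2) ^ (-(b * q.toReal) / 2)) :=
    integrable_rpow_neg_one_add_norm_sq (by simpa using hbq)
  refine ((h2.comp_add_right (hypSq n)).const_mul ((bracket n ^ s) ^ (-q.toReal))).congr
    (Eventually.of_forall fun τ => ?_)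
  have h3 : 0 < 1 + (τ + hypSq n) ^ 2 := by positivity
  have h4 : ‖evalKernel s b t n τ‖ = (xWeight s b (n, τ))⁻¹ := by
    rw [evalKernel, norm_mul, norm_inv, Complex.norm_real,
      Real.norm_of_nonneg (xWeight_pos s b _).le]
    have : Complex.I * t * τ = ((t * τ : ℝ) : ℂ) * Complex.I := by push_cast; ring
    rw [this, Complex.norm_exp_ofReal_mul_I, one_mul]
  have h5 := bracket_pos n
  simp only [h4, xWeight, Real.norm_eq_abs, sq_abs]
  rw [Real.inv_rpow (by positivity), ← Real.rpow_neg (by positivity),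
    Real.mul_rpow (by positivity) (by positivity), Real.sqrt_eq_rpow,
    ← Real.rpow_mul h3.le, ← Real.rpow_mul h3.le]
  congr 2
  ring

theorem X.coeff_eq {s b : ℝ} {p : ℝ≥0∞} (u : X s b p) (t : ℝ) (n : Freq) :
    u.coeff t n = ∫ τ : ℝ, evalKernel s b t n τ * X.weighted s b p u (n, τ) := by
  refine integral_congr_ae ?_
  filter_upwards [ae_slice (X.coeFn_weighted u) n] with τ hτ
  have : ((xWeight s b (n, τ) : ℝ) : ℂ) ≠ 0 :=
    Complex.ofReal_ne_zero.mpr (xWeight_pos s b _).ne'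
  simp only [hτ, evalKernel]
  field_simp

theorem memLp_slice {p : ℝ≥0∞} (g : Lp ℂ p freqMeasure) (n : Freq) :
    MemLp (fun τ : ℝ => g (n, τ)) p ∧
      eLpNorm (fun τ : ℝ => g (n, τ)) p volume ≤ eLpNorm g p freqMeasure := by
  have h1 : MemLp g p (Measure.map (Prod.mk n) (volume : Measure ℝ)) :=
    (Lp.memLp g).mono_measure (map_slice_le n)
  refine ⟨(memLp_map_measure_iff h1.1 measurable_prodMk_left.aemeasurable).mp h1, ?_⟩
  have h2 := eLpNorm_map_measure (p := p) h1.1 measurable_prodMk_left.aemeasurable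
  rw [Function.comp_def] at h2
  rw [← h2]
  exact eLpNorm_mono_measure _ (map_slice_le n)

theorem integrable_eval {s b : ℝ} {p : ℝ≥0∞} (h : Admissible b p) (t : ℝ) (n : Freq)
    (g : Lp ℂ p freqMeasure) :
    Integrable (fun τ : ℝ => evalKernel s b t n τ * g (n, τ)) := by
  have := h.holderConjugate
  have := ENNReal.HolderConjugate.symm (p := p) (q := ENNReal.conjExponent p)
  exact (memLp_evalKernel h s t n).integrable_mul (memLp_slice g n).1

/-- Evaluation of the `n`-th Fourier coefficient at time `t`, as a continuous functional. -/
def X.eval {s b : ℝ} {p : ℝ≥0∞} [Fact (1 ≤ p)] (h : Admissible b p) (t : ℝ) (n : Freq) :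
    X s b p →L[ℂ] ℂ :=
  LinearMap.mkContinuous
    { toFun := fun u => u.coeff t n
      map_add' := fun u v => by
        rw [X.coeff_eq, X.coeff_eq, X.coeff_eq,
          ← integral_add (integrable_eval h t n _) (integrable_eval h t n _)]
        refine integral_congr_ae ?_
        filter_upwards [ae_slice (Lp.coeFn_add (X.weighted s b p u) (X.weighted s b p v)) n]
          with τ hτ
        rw [map_add, hτ, Pi.add_apply, mul_add]
      map_smul' := fun k u => by
        rw [X.coeff_eq, X.coeff_eq, RingHom.id_apply, ← integral_smul]
        refine integral_congr_ae ?_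
        filter_upwards [ae_slice (Lp.coeFn_smul k (X.weighted s b p u)) n] with τ hτ
        simp only [map_smul, hτ, Pi.smul_apply, smul_eq_mul]
        ring }
    (eLpNorm (evalKernel s b t n) (ENNReal.conjExponent p) volume).toReal
    (fun u => by
      have := h.holderConjugate
      have := ENNReal.HolderConjugate.symm (p := p) (q := ENNReal.conjExponent p)
      have hk := memLp_evalKernel h s t n
      have hg := memLp_slice (X.weighted s b p u) n
      have h1 : eLpNorm (fun τ : ℝ => evalKernel s b t n τ * X.weighted s b p u (n, τ)) 1 volume
          ≤ eLpNorm (evalKernel s b t n) (ENNReal.conjExponent p) volume *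
            eLpNorm (X.weighted s b p u) p freqMeasure :=
        (eLpNorm_smul_le_mul_eLpNorm (p := ENNReal.conjExponent p) (q := p) (r := 1)
          hg.1.1 hk.1).trans (mul_le_mul_right hg.2 _)
      change ‖u.coeff t n‖ ≤ _ * ‖X.weighted s b p u‖
      rw [X.coeff_eq, Lp.norm_def, ← ENNReal.toReal_mul]
      rw [← toReal_enorm]
      refine ENNReal.toReal_mono (ENNReal.mul_ne_top hk.2.ne (Lp.eLpNorm_ne_top _)) ?_
      refine (enorm_integral_le_lintegral_enorm _).trans ?_
      rw [← eLpNorm_one_eq_lintegral_enorm]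
      exact h1)

/-- The `u ∈ X^{s,b}_p` that vanish on the time interval `[0, T]`. -/
def X.vanishing (s : ℝ) {b : ℝ} {p : ℝ≥0∞} [Fact (1 ≤ p)] (h : Admissible b p) (T : ℝ) :
    Submodule ℂ (X s b p) where
  carrier := {u | ∀ t ∈ Icc (0 : ℝ) T, ∀ n, u.coeff t n = 0}
  zero_mem' := fun t _ n => (X.eval h t n).map_zero
  add_mem' := fun {u v} hu hv t ht n => by
    have := (X.eval h t n).map_add u v
    simp only [X.eval, LinearMap.mkContinuous_apply, LinearMap.coe_mk, AddHom.coe_mk] at this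
    rw [this, hu t ht n, hv t ht n, add_zero]
  smul_mem' := fun k u hu t ht n => by
    have := (X.eval h t n).map_smul k u
    simp only [X.eval, LinearMap.mkContinuous_apply, LinearMap.coe_mk, AddHom.coe_mk] at this
    rw [this, hu t ht n, smul_zero]

instance X.isClosed_vanishing (s : ℝ) {b : ℝ} {p : ℝ≥0∞} [Fact (1 ≤ p)] (h : Admissible b p)
    (T : ℝ) : IsClosed (X.vanishing s h T : Set (X s b p)) := by
  have : (X.vanishing s h T : Set (X s b p)) =
      ⋂ t ∈ Icc (0 : ℝ) T, ⋂ n : Freq, (X.eval h t n : X s b p → ℂ) ⁻¹' {0} := by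
    ext u
    simp only [mem_iInter]
    rfl
  rw [this]
  exact isClosed_biInter fun t _ => isClosed_iInter fun n =>
    isClosed_singleton.preimage (X.eval h t n).continuous

/-- The local-in-time space `X^{s,b}_p(T)`: restrictions of elements of `X^{s,b}_p` to `[0, T]`,
that is, `X^{s,b}_p` modulo the elements that vanish on `[0, T]`. The quotient norm is
`‖u‖_{X^{s,b}_p(T)} = inf {‖v‖_{X^{s,b}_p} : v|_{[0,T]} = u}`. -/
abbrev XLoc (s : ℝ) {b : ℝ} {p : ℝ≥0∞} [Fact (1 ≤ p)] (h : Admissible b p) (T : ℝ) : Type :=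
  X s b p ⧸ X.vanishing s h T

/-- `w ∈ X^{s,b}_p(T)` and `u ∈ C([0, T]; FL^{s,p})` are the same space-time distribution. -/
def XLoc.Represents {s b : ℝ} {p : ℝ≥0∞} [Fact (1 ≤ p)] {h : Admissible b p} {T : ℝ}
    (w : XLoc s h T) (u : C(Icc (0 : ℝ) T, FL s p)) : Prop :=
  ∃ v : X s b p, Submodule.Quotient.mk v = w ∧
    ∀ (t : Icc (0 : ℝ) T) (n : Freq), v.coeff t n = (u t).coeff n

/-- A path `[0, T] → FL^{s,p}` as a function of `t ∈ ℝ`; only its values on `[0, T]` matter. -/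
def toPath {s T : ℝ} {p : ℝ≥0∞} [Fact (1 ≤ p)] (hT : 0 ≤ T) (u : C(Icc (0 : ℝ) T, FL s p)) :
    ℝ → Freq → ℂ :=
  fun t => (IccExtend hT u t).coeff

/-- `u ∈ C([0, T]; C^∞(𝕋²))`: `u` is continuous on `[0, T]` with values in `FL^{σ,p}`,
for every `σ`. -/
def IsSmoothPath (p : ℝ≥0∞) [Fact (1 ≤ p)] (T : ℝ) (u : ℝ → Freq → ℂ) : Prop :=
  ∀ σ : ℝ, ∃ U : C(Icc (0 : ℝ) T, FL σ p), ∀ t : Icc (0 : ℝ) T, (U t).coeff = u t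

/-- `a` are the Fourier coefficients of a trigonometric polynomial with frequencies on the
diagonal `{(k, k) : k ∈ ℤ}`. -/
def IsDiagonalPolynomial (a : Freq → ℂ) : Prop :=
  (Function.support a).Finite ∧ ∀ n : Freq, a n ≠ 0 → n.1 = n.2

end HNLS

end

noncomputable section

namespace HNLS

/-! ### Brackets and lattice sums -/

/-! Well-posedness is a contraction argument in $X^{s,b}_p$ with $b=1-\frac1{2p}$, just below $1$.
Everything rests on one trilinear estimate for the time-localised Duhamel integral,
`exists_duhamel_operator`, with constant $CT^{1-b}$. In weighted Fourier variables the Duhamel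
integral is a linear integral operator applied to $g_1\otimes\overline{g_2}\otimes g_3$, and the
$L^p$ norm of this tensor is the product of the three norms. So it suffices to bound a linear
operator from $L^p$ of triples of space-time frequencies to $L^p(\mathbb Z^2\times\mathbb R)$. This
is a Schur test: a kernel bounded by $a^{1/p}\beta^{1/p'}$ is harmless if $a$ is integrable in the
output and $\beta$ in the input.

The output integral is elementary. In the input integral each time frequency is recentred at its own
characteristic. The output modulation then becomes $\sigma_1-\sigma_2+\sigma_3$ minus the resonance
function $|n_1|_-^2-|n_2|_-^2+|n_3|_-^2-|n|_-^2$, an integer. Grouping the triples by the value of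
this integer leaves a convergent sum over $\mathbb Z$ times the counting bound
`exists_counting_bound`: for $r=sp'>1$, the sum of $(\langle n\rangle/\langle n_1\rangle\langle
n_2\rangle\langle n_3\rangle)^r$ over a level set of the resonance function is bounded uniformly in
$n$ and the level. The condition $s>1-\frac1p$ is exactly $r>1$.

For the counting bound the largest of the three inputs cancels $\langle n\rangle$, and two weights
remain. With the smaller of the two remaining frequencies fixed, the other runs over a lattice line
if the fixed one is $n_1$ or $n_3$, and over a hyperbola if it is $n_2$. Lines are sparse unless
their primitive direction is short, and short directions are rare (`tsum_lines_lt_top`). A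
nondegenerate hyperbola has $O(R^\varepsilon)$ lattice points in a disc of radius $R$, uniformly in
its level, by the divisor bound: three such points already force the level to be $O(R^6)$
(`ncard_hyperbolaPoints_le`). Degenerate hyperbolas occur only for base points that themselves lie
on a conic, and there $r>1$ suffices (`tsum_conics_lt_top`).

Smooth dependence comes from the inverse function theorem for $u\mapsto u-iD(u,u,u)$, where $D$ is
the Duhamel operator. Uniqueness is a contraction in the restriction space $X^{s,b}_p(\delta)$,
iterated over short time steps.

For ill-posedness, $|n|_-^2$ vanishes on the diagonal, so diagonal data evolve by the ODE
$i\partial_tu+|u|^2u=0$, with solution $ge^{it|g|^2}$. If the time-$t$ map were $C^3$ at $0$, its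
third derivative along $g$ would be $6it|g|^2g$ on the diagonal, hence $\||g|^2g\|\lesssim\|g\|^3$.
For $g=\sum_{k=2M}^{4M}e^{ik(x_1+x_2)}$ the cubic term has coefficients at least $M^2$ on the same
block, while $\|g\|\lesssim M^{s+1/p}$. Letting $M\to\infty$ gives $s+\frac1p\ge1$. -/

theorem one_le_bracket (n : Freq) : 1 ≤ bracket n := by
  unfold bracket
  rw [Real.one_le_sqrt]
  nlinarith [sq_nonneg (n.1 : ℝ), sq_nonneg (n.2 : ℝ)]

theorem bracket_sq (n : Freq) : bracket n ^ 2 = 1 + ((n.1 : ℝ) ^ 2 + (n.2 : ℝ) ^ 2) := by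
  unfold bracket
  rw [Real.sq_sqrt (by positivity)]

theorem abs_fst_le_bracket (n : Freq) : |(n.1 : ℝ)| ≤ bracket n := by
  refine abs_le_of_sq_le_sq ?_ (bracket_pos n).le
  rw [bracket_sq]; nlinarith [sq_nonneg (n.2 : ℝ)]

theorem abs_snd_le_bracket (n : Freq) : |(n.2 : ℝ)| ≤ bracket n := by
  refine abs_le_of_sq_le_sq ?_ (bracket_pos n).le
  rw [bracket_sq]; nlinarith [sq_nonneg (n.1 : ℝ)]

theorem bracket_le_of_abs_le {n : Freq} {A : ℝ} (hA : 1 ≤ A) (h1 : |(n.1 : ℝ)| ≤ A)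
    (h2 : |(n.2 : ℝ)| ≤ A) : bracket n ≤ 2 * A := by
  refine le_of_sq_le_sq ?_ (by linarith)
  rw [bracket_sq]
  nlinarith [sq_abs (n.1 : ℝ), sq_abs (n.2 : ℝ), abs_nonneg (n.1 : ℝ), abs_nonneg (n.2 : ℝ)]

theorem bracket_neg (n : Freq) : bracket (-n) = bracket n := by
  simp [bracket]

theorem bracket_add_le (m n : Freq) : bracket (m + n) ≤ bracket m + bracket n := by
  have hm := bracket_pos m
  have hn := bracket_pos n
  have h : (m.1 : ℝ) * n.1 + m.2 * n.2 ≤ bracket m * bracket n := by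
    refine le_of_sq_le_sq ?_ (by positivity)
    rw [mul_pow, bracket_sq, bracket_sq]
    nlinarith [sq_nonneg ((m.1 : ℝ) * n.2 - m.2 * n.1), sq_nonneg (m.1 : ℝ),
      sq_nonneg (m.2 : ℝ), sq_nonneg (n.1 : ℝ), sq_nonneg (n.2 : ℝ)]
  refine le_of_sq_le_sq ?_ (by positivity)
  rw [bracket_sq, add_sq, bracket_sq, bracket_sq]
  push_cast [Prod.fst_add, Prod.snd_add]
  nlinarith

/-- The weight `⟨n⟩^{-r}`. -/
def wt (r : ℝ) (n : Freq) : ℝ≥0∞ := ENNReal.ofReal (bracket n ^ (-r))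

theorem wt_mul_wt (a c : ℝ) (n : Freq) : wt a n * wt c n = wt (a + c) n := by
  rw [wt, wt, wt, ← ENNReal.ofReal_mul (Real.rpow_nonneg (bracket_pos n).le _),
    ← Real.rpow_add (bracket_pos n), neg_add]

/-- The summable weight `(1 + |k|)^{-a}` on `ℤ`. -/
def wtZ (a : ℝ) (k : ℤ) : ℝ≥0∞ := ENNReal.ofReal ((1 + |(k : ℝ)|) ^ (-a))

theorem tsum_wtZ_lt_top {a : ℝ} (ha : 1 < a) : ∑' k : ℤ, wtZ a k < ⊤ := by
  have h1 : Summable (fun k : ℤ => (1 + |(k : ℝ)|) ^ (-a)) := by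
    have h0 := (Real.summable_one_div_int_add_rpow 0 a).mpr ha
    refine Summable.of_norm_bounded_eventually (g := fun k : ℤ => 1 / |(k : ℝ) + 0| ^ a) h0 ?_
    refine (Set.finite_singleton (0 : ℤ)).subset ?_
    intro k hk
    by_contra hk0
    refine hk ?_
    have hk1 : 0 < |(k : ℝ)| := abs_pos.mpr (by exact_mod_cast hk0)
    change ‖(1 + |(k : ℝ)|) ^ (-a)‖ ≤ 1 / |(k : ℝ) + 0| ^ a
    rw [Real.norm_of_nonneg (by positivity), add_zero, Real.rpow_neg (by positivity), one_div]
    gcongr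
    linarith
  have h2 := h1.tsum_ofReal_ne_top
  exact h2.lt_top

/-- Since $(1+|x|)(1+|y|)\le2\langle n\rangle^2$, a planar weight splits into two one-dimensional
ones of half the exponent; hence the threshold $a>2$ on $\mathbb Z^2$. -/
theorem wt_le_wtZ_mul {a : ℝ} (ha : 0 ≤ a) (n : Freq) :
    wt a n ≤ ENNReal.ofReal (2 ^ (a / 2)) * (wtZ (a / 2) n.1 * wtZ (a / 2) n.2) := by
  have hb := bracket_pos n
  set x := |(n.1 : ℝ)|
  set y := |(n.2 : ℝ)|
  have hx : 0 ≤ x := abs_nonneg _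
  have hy : 0 ≤ y := abs_nonneg _
  rw [wt, wtZ, wtZ, ← ENNReal.ofReal_mul (by positivity), ← ENNReal.ofReal_mul (by positivity)]
  refine ENNReal.ofReal_le_ofReal ?_
  have h1 : (1 + x) * (1 + y) ≤ 2 * bracket n ^ 2 := by
    rw [bracket_sq, ← sq_abs (n.1 : ℝ), ← sq_abs (n.2 : ℝ)]
    nlinarith [sq_nonneg (x - 1), sq_nonneg (y - 1), sq_nonneg (x - y)]
  have h2 : bracket n ^ (-a) = 2 ^ (a / 2) * (2 * bracket n ^ 2) ^ (-(a / 2)) := by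
    rw [Real.mul_rpow (by norm_num) (by positivity), ← mul_assoc, ← Real.rpow_add (by norm_num),
      ← Real.rpow_natCast (bracket n) 2, ← Real.rpow_mul hb.le, add_neg_cancel, Real.rpow_zero,
      one_mul]
    congr 1; push_cast; ring
  rw [h2, ← Real.mul_rpow (by positivity) (by positivity)]
  gcongr ?_ * ?_
  rw [Real.rpow_neg (by positivity), Real.rpow_neg (by positivity)]
  gcongr

theorem tsum_wt_lt_top {a : ℝ} (ha : 2 < a) : ∑' n : Freq, wt a n < ⊤ := by
  refine (ENNReal.tsum_le_tsum fun n => wt_le_wtZ_mul (by linarith) n).trans_lt ?_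
  rw [ENNReal.tsum_mul_left, ENNReal.tsum_prod (f := fun k l => wtZ (a / 2) k * wtZ (a / 2) l)]
  simp_rw [ENNReal.tsum_mul_left, ENNReal.tsum_mul_right]
  have := tsum_wtZ_lt_top (a := a / 2) (by linarith)
  exact ENNReal.mul_lt_top ENNReal.ofReal_lt_top (ENNReal.mul_lt_top this this)

/-- The form in which lattice sums are reparametrised: injectivity is needed only where the summand
lives. -/
theorem tsum_le_tsum_of_injOn {α β : Type*} (φ : α → β) (S : Set α) (hφ : InjOn φ S)
    (F : α → ℝ≥0∞) (G : β → ℝ≥0∞) (hFG : ∀ a ∈ S, F a ≤ G (φ a)) (hF : ∀ a ∉ S, F a = 0) :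
    ∑' a, F a ≤ ∑' b, G b := by
  have h1 : Function.support F ⊆ S := fun a ha => by
    by_contra h; exact ha (hF a h)
  rw [← tsum_subtype_eq_of_support_subset h1]
  refine (ENNReal.tsum_le_tsum fun a : S => hFG a a.2).trans ?_
  exact ENNReal.tsum_comp_le_tsum_of_injective (injOn_iff_injective.mp hφ) G

/-! ### Sums over lattice lines -/

/-- The sup norm of a lattice vector. -/
def supNorm (v : Freq) : ℝ := max |(v.1 : ℝ)| |(v.2 : ℝ)|

theorem one_le_supNorm {v : Freq} (hv : v ≠ 0) : 1 ≤ supNorm v := by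
  have : v.1 ≠ 0 ∨ v.2 ≠ 0 := by
    by_contra! h
    exact hv (Prod.ext h.1 h.2)
  rcases this with h | h
  · exact le_max_of_le_left (by exact_mod_cast Int.one_le_abs h)
  · exact le_max_of_le_right (by exact_mod_cast Int.one_le_abs h)

theorem bracket_le_supNorm {v : Freq} (hv : v ≠ 0) : bracket v ≤ 2 * supNorm v :=
  bracket_le_of_abs_le (one_le_supNorm hv) (le_max_left _ _) (le_max_right _ _)

/-- Sum over an arithmetic progression. -/
theorem tsum_progression_le {q r : ℝ} (hq : 1 < q) (hqr : q ≤ r) (c d : ℤ) (hd : d ≠ 0) (N : ℝ)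
    (hN : 1 ≤ N) (B : ℤ → ℝ) (hB0 : ∀ k, 0 < B k) (hB : ∀ k, |((c + k * d : ℤ) : ℝ)| ≤ B k) :
    ∑' k : ℤ, (if N ≤ B k then ENNReal.ofReal (B k ^ (-r)) else 0) ≤
      ENNReal.ofReal (3 ^ q) * (∑' k : ℤ, wtZ q k) *
        ENNReal.ofReal (N ^ (-r) + N ^ (q - r) * |(d : ℝ)| ^ (-q)) := by
  have hd1 : (1 : ℝ) ≤ |(d : ℝ)| := by exact_mod_cast Int.one_le_abs hd
  have hN0 : 0 < N := by linarith
  -- Recentre the progression so that its term of index $k$ is $c\bmod d+kd$, with remainder at most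
  -- $|d|$.
  rw [← (Equiv.addRight (-(c / d))).tsum_eq, mul_right_comm, ← ENNReal.tsum_mul_left]
  refine ENNReal.tsum_le_tsum fun k => ?_
  obtain ⟨j, hj⟩ : ∃ j, j = Equiv.addRight (-(c / d)) k := ⟨_, rfl⟩
  rw [← hj]
  replace hj : j = k + -(c / d) := hj
  by_cases h : N ≤ B j
  swap
  · rw [if_neg h]; exact bot_le
  rw [if_pos h, wtZ, ← ENNReal.ofReal_mul (by positivity), ← ENNReal.ofReal_mul (by positivity)]
  refine ENNReal.ofReal_le_ofReal ?_
  have hk0 : 0 ≤ |(k : ℝ)| := abs_nonneg _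
  have hsplit : B j ^ (-r) ≤ N ^ (-r) := by
    rw [Real.rpow_neg (hB0 j).le, Real.rpow_neg hN0.le]
    have : 0 ≤ r := by linarith
    gcongr
  -- Only these three terms can be near the origin, and for them the threshold $N$ is the only
  -- bound. All others have size at least $(1+|k|)|d|/3$.
  by_cases hk : |k| ≤ 1
  · have hk' : |(k : ℝ)| ≤ 1 := by exact_mod_cast hk
    have h3 : 1 ≤ (3 : ℝ) ^ q * (1 + |(k : ℝ)|) ^ (-q) := by
      rw [Real.rpow_neg (by positivity), ← div_eq_mul_inv, one_le_div (by positivity)]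
      gcongr
      linarith
    calc B j ^ (-r) ≤ 1 * (N ^ (-r) + 0) := by linarith
      _ ≤ (3 ^ q * (1 + |(k : ℝ)|) ^ (-q)) * (N ^ (-r) + N ^ (q - r) * |(d : ℝ)| ^ (-q)) := by
          gcongr; positivity
      _ = _ := by ring
  · have hk2 : 2 ≤ |k| := by omega
    have hk' : (2 : ℝ) ≤ |(k : ℝ)| := by exact_mod_cast hk2
    have h1 : c + j * d = c % d + k * d := by
      rw [hj]
      have := Int.emod_add_mul_ediv c d
      linear_combination -this
    have h2 : |((c % d : ℤ) : ℝ)| ≤ |(d : ℝ)| := by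
      have h3 := Int.emod_nonneg c hd
      have h4 := Int.emod_lt_abs c hd
      rw [abs_of_nonneg (by exact_mod_cast h3)]
      exact_mod_cast h4.le
    have h3 : (1 + |(k : ℝ)|) * |(d : ℝ)| / 3 ≤ B j := by
      have h4 := hB j
      rw [h1] at h4
      push_cast at h4
      have h5 : |(k : ℝ) * d| - |((c % d : ℤ) : ℝ)| ≤ |((c % d : ℤ) : ℝ) + k * d| := by
        have := abs_sub_abs_le_abs_sub ((k : ℝ) * d) (-((c % d : ℤ) : ℝ))
        rwa [abs_neg, sub_neg_eq_add, add_comm ((k : ℝ) * d)] at this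
      rw [abs_mul] at h5
      nlinarith
    -- The power $r-q$ is spent on the threshold $N$, the power $q>1$ on summability in $k$.
    have h6 : B j ^ (-r) = B j ^ (q - r) * B j ^ (-q) := by
      rw [← Real.rpow_add (hB0 j)]; congr 1; ring
    have h7 : B j ^ (q - r) ≤ N ^ (q - r) :=
      Real.rpow_le_rpow_of_nonpos hN0 h (by linarith)
    have h8 : B j ^ (-q) ≤ ((1 + |(k : ℝ)|) * |(d : ℝ)| / 3) ^ (-q) :=
      Real.rpow_le_rpow_of_nonpos (by positivity) h3 (by linarith)
    have h9 : ((1 + |(k : ℝ)|) * |(d : ℝ)| / 3) ^ (-q) =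
        3 ^ q * ((1 + |(k : ℝ)|) ^ (-q) * |(d : ℝ)| ^ (-q)) := by
      rw [Real.div_rpow (by positivity) (by norm_num), Real.mul_rpow (by positivity)
        (by positivity), Real.rpow_neg (by norm_num : (0 : ℝ) ≤ 3), div_inv_eq_mul, mul_comm]
    have hB1 := hB0 j
    calc B j ^ (-r) ≤ N ^ (q - r) * (3 ^ q * ((1 + |(k : ℝ)|) ^ (-q) * |(d : ℝ)| ^ (-q))) := by
          rw [h6, ← h9]; gcongr
      _ = 3 ^ q * (0 + N ^ (q - r) * |(d : ℝ)| ^ (-q)) * (1 + |(k : ℝ)|) ^ (-q) := by ring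
      _ ≤ _ := by gcongr; positivity

/-- Project to the coordinate in which $v$ is longer; there the line is a progression with step
$\pm|v|_\infty$. -/
theorem tsum_line_le {q r : ℝ} (hq : 1 < q) (hqr : q ≤ r) (z v : Freq) (hv : v ≠ 0) (N : ℝ)
    (hN : 1 ≤ N) :
    ∑' k : ℤ, (if N ≤ bracket (z + k • v) then wt r (z + k • v) else 0) ≤
      ENNReal.ofReal (3 ^ q) * (∑' k : ℤ, wtZ q k) *
        ENNReal.ofReal (N ^ (-r) + N ^ (q - r) * supNorm v ^ (-q)) := by
  have h1 := one_le_supNorm hv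
  rcases le_total |(v.2 : ℝ)| |(v.1 : ℝ)| with h | h
  · have h2 : supNorm v = |(v.1 : ℝ)| := max_eq_left h
    rw [h2]
    refine tsum_progression_le hq hqr z.1 v.1 ?_ N hN _ (fun k => bracket_pos _) fun k => ?_
    · intro h0; rw [h2, h0] at h1; norm_num at h1
    · simpa using abs_fst_le_bracket (z + k • v)
  · have h2 : supNorm v = |(v.2 : ℝ)| := max_eq_right h
    rw [h2]
    refine tsum_progression_le hq hqr z.2 v.2 ?_ N hN _ (fun k => bracket_pos _) fun k => ?_
    · intro h0; rw [h2, h0] at h1; norm_num at h1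
    · simpa using abs_snd_le_bracket (z + k • v)

/-- The bilinear form of `hypSq`. -/
def hypForm (x y : Freq) : ℤ := x.1 * y.1 - x.2 * y.2

/-- The primitive vector in the direction of `x`. -/
def primitive (x : Freq) : Freq := (x.1 / Int.gcd x.1 x.2, x.2 / Int.gcd x.1 x.2)

theorem gcd_smul_primitive (x : Freq) : ((Int.gcd x.1 x.2 : ℕ) : ℤ) • primitive x = x := by
  refine Prod.ext ?_ ?_
  · exact Int.mul_ediv_cancel' (Int.gcd_dvd_left ..)
  · exact Int.mul_ediv_cancel' (Int.gcd_dvd_right ..)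

theorem gcd_ne_zero_of_ne_zero {x : Freq} (hx : x ≠ 0) : ((Int.gcd x.1 x.2 : ℕ) : ℤ) ≠ 0 := by
  intro h
  have := Int.gcd_eq_zero_iff.mp (by exact_mod_cast h)
  exact hx (Prod.ext this.1 this.2)

theorem primitive_ne_zero {x : Freq} (hx : x ≠ 0) : primitive x ≠ 0 := by
  intro h
  have := gcd_smul_primitive x
  rw [h, smul_zero] at this
  exact hx this.symm

theorem isCoprime_primitive {x : Freq} (hx : x ≠ 0) :
    IsCoprime (primitive x).1 (primitive x).2 := by
  rw [Int.isCoprime_iff_gcd_eq_one]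
  exact Int.gcd_ediv_gcd_ediv_gcd (Nat.pos_of_ne_zero (by exact_mod_cast gcd_ne_zero_of_ne_zero hx))

/-- The equation says that $y$ is parallel to $x$ with its coordinates swapped. Bézout for the
primitive vector makes the ratio an integer. -/
theorem exists_smul_of_hypForm_eq_zero {x y : Freq} (hx : x ≠ 0) (h : hypForm y x = 0) :
    ∃ k : ℤ, y = k • (primitive x).swap := by
  have hc := isCoprime_primitive hx
  have hg := gcd_smul_primitive x
  set g : ℤ := ((Int.gcd x.1 x.2 : ℕ) : ℤ)
  set v := primitive x
  have h1 : g * (y.1 * v.1 - y.2 * v.2) = 0 := by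
    rw [← hg] at h
    simp only [hypForm, Prod.smul_fst, Prod.smul_snd, smul_eq_mul] at h
    linear_combination h
  have h2 : y.1 * v.1 = y.2 * v.2 := by
    rcases mul_eq_zero.mp h1 with h | h
    · exact absurd h (gcd_ne_zero_of_ne_zero hx)
    · linarith
  obtain ⟨a, c, hac⟩ := hc
  refine ⟨a * y.2 + c * y.1, Prod.ext ?_ ?_⟩
  · simp only [Prod.smul_fst, Prod.fst_swap, smul_eq_mul]
    linear_combination (-y.1) * hac + a * h2
  · simp only [Prod.smul_snd, Prod.snd_swap, smul_eq_mul]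
    linear_combination (-y.2) * hac - c * h2

theorem supNorm_swap (v : Freq) : supNorm v.swap = supNorm v := max_comm _ _

/-- Sum over the lattice points `z` on the line `hypForm z x = c`. -/
theorem tsum_hypForm_eq_le {q r : ℝ} (hq : 1 < q) (hqr : q ≤ r) {x : Freq} (hx : x ≠ 0) (c : ℤ)
    (N : ℝ) (hN : 1 ≤ N) :
    ∑' z : Freq, (if hypForm z x = c ∧ N ≤ bracket z then wt r z else 0) ≤
      ENNReal.ofReal (3 ^ q) * (∑' k : ℤ, wtZ q k) *
        ENNReal.ofReal (N ^ (-r) + N ^ (q - r) * supNorm (primitive x) ^ (-q)) := by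
  by_cases h0 : ∃ z₀, hypForm z₀ x = c
  swap
  · push Not at h0
    simp [h0]
  obtain ⟨z₀, hz₀⟩ := h0
  have hv := primitive_ne_zero hx
  have hv' : (primitive x).swap ≠ 0 := fun h => hv (by
    have := congrArg Prod.swap h; simpa using this)
  have h1 : ∀ z, hypForm z x = c → ∃ k : ℤ, z = z₀ + k • (primitive x).swap := by
    intro z hz
    obtain ⟨k, hk⟩ := exists_smul_of_hypForm_eq_zero hx (y := z - z₀) (by
      simp only [hypForm, Prod.fst_sub, Prod.snd_sub] at *
      linear_combination hz - hz₀)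
    exact ⟨k, by rw [← hk]; abel⟩
  choose! φ hφ using h1
  rw [← supNorm_swap]
  refine le_trans ?_ (tsum_line_le hq hqr z₀ _ hv' N hN)
  refine tsum_le_tsum_of_injOn φ {z | hypForm z x = c} ?_ _ _ ?_ ?_
  · intro a ha b hb hab
    rw [hφ a ha, hφ b hb, hab]
  · intro a ha
    rw [← hφ a ha]
    have ha' : hypForm a x = c := ha
    simp only [ha', true_and, le_refl]
  · intro a ha
    have ha' : ¬ hypForm a x = c := ha
    simp [ha']

/-- Summation over a family of lattice lines. -/
theorem tsum_lines_lt_top {r : ℝ} (hr : 1 < r) :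
    ∃ C : ℝ≥0∞, C < ⊤ ∧ ∀ (n : Freq) (c : Freq → ℤ),
      ∑' w : Freq, ∑' z : Freq, (if w ≠ n ∧ hypForm z (w - n) = c w ∧ bracket w ≤ bracket z
        then wt r w * wt r z else 0) ≤ C := by
  -- The loss $q>1$ pays for the sums along lines; $q<r$ allows the line bound to be used again with
  -- exponent $2r-q\ge q$.
  obtain ⟨q, hq1, hqr⟩ := exists_between hr
  set A := ENNReal.ofReal (3 ^ q) * ∑' k : ℤ, wtZ q k with hA
  have hAtop : A < ⊤ := ENNReal.mul_lt_top ENNReal.ofReal_lt_top (tsum_wtZ_lt_top hq1)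
  have hr0 : (0 : ℝ) < r := by linarith
  set S := ∑' n : Freq, wt (2 * r) n with hS
  have hStop : S < ⊤ := tsum_wt_lt_top (by linarith)
  refine ⟨A * (S + (S + A * (ENNReal.ofReal (2 * 2 ^ (2 * r)) * S))), ?_, ?_⟩
  · exact ENNReal.mul_lt_top hAtop (ENNReal.add_lt_top.mpr ⟨hStop, ENNReal.add_lt_top.mpr
      ⟨hStop, ENNReal.mul_lt_top hAtop (ENNReal.mul_lt_top ENNReal.ofReal_lt_top hStop)⟩⟩)
  intro n c
  have hsup : ∀ {w : Freq}, w ≠ n → 1 ≤ supNorm (primitive (w - n)) := fun h =>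
    one_le_supNorm (primitive_ne_zero (sub_ne_zero.mpr h))
  -- the sum over `z`
  have h1 : ∀ w : Freq, ∑' z : Freq, (if w ≠ n ∧ hypForm z (w - n) = c w ∧ bracket w ≤ bracket z
      then wt r w * wt r z else 0) ≤ A * (wt (2 * r) w + (wt (2 * r) w +
        if w ≠ n ∧ supNorm (primitive (w - n)) ≤ bracket w then
          wt (2 * r - q) w * ENNReal.ofReal (supNorm (primitive (w - n)) ^ (-q)) else 0)) := by
    intro w
    by_cases hw : w = n
    · simp [hw]
    have hb := bracket_pos w
    have hD : 0 < supNorm (primitive (w - n)) := by linarith [hsup hw]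
    have h2 := tsum_hypForm_eq_le hq1 hqr.le (sub_ne_zero.mpr hw) (c w) (bracket w)
      (one_le_bracket w)
    have h3 : ∑' z : Freq, (if w ≠ n ∧ hypForm z (w - n) = c w ∧ bracket w ≤ bracket z
        then wt r w * wt r z else 0) = wt r w * ∑' z : Freq,
        (if hypForm z (w - n) = c w ∧ bracket w ≤ bracket z then wt r z else 0) := by
      rw [← ENNReal.tsum_mul_left]
      refine tsum_congr fun z => ?_
      simp only [ne_eq, hw, not_false_eq_true, true_and, mul_ite, mul_zero]
    rw [h3]
    refine (mul_le_mul_right h2 _).trans ?_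
    rw [mul_left_comm]
    refine mul_le_mul_right ?_ _
    rw [ENNReal.ofReal_add (by positivity) (by positivity), mul_add]
    refine add_le_add ?_ ?_
    · change wt r w * wt r w ≤ _
      rw [wt_mul_wt, two_mul]
    · rw [ENNReal.ofReal_mul (by positivity), ← mul_assoc]
      have h4 : wt r w * ENNReal.ofReal (bracket w ^ (q - r)) = wt (2 * r - q) w := by
        have : ENNReal.ofReal (bracket w ^ (q - r)) = wt (r - q) w := by rw [wt, neg_sub]
        rw [this, wt_mul_wt]; congr 1; ring
      rw [h4]
      -- A primitive direction longer than $\langle w\rangle$ gives $D^{-q}\le\langle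
      -- w\rangle^{-q}$, hence the summable weight $\langle w\rangle^{-2r}$. Only short directions
      -- need the regrouping.
      by_cases h5 : supNorm (primitive (w - n)) ≤ bracket w
      · simp only [ne_eq, hw, not_false_eq_true, true_and, h5, if_true]
        exact le_add_self
      · simp only [h5, and_false, if_false, add_zero]
        have h6 : ENNReal.ofReal (supNorm (primitive (w - n)) ^ (-q)) ≤ wt q w :=
          ENNReal.ofReal_le_ofReal (Real.rpow_le_rpow_of_nonpos hb (not_le.mp h5).le (by linarith))
        refine (mul_le_mul_right h6 _).trans ?_
        rw [wt_mul_wt, sub_add_cancel]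
  refine (ENNReal.tsum_le_tsum h1).trans ?_
  rw [ENNReal.tsum_mul_left, ENNReal.tsum_add, ENNReal.tsum_add]
  gcongr
  -- the sum over `w`, grouped by the primitive direction of `w - n`
  have h2 : ∑' w : Freq, (if w ≠ n ∧ supNorm (primitive (w - n)) ≤ bracket w then
      wt (2 * r - q) w * ENNReal.ofReal (supNorm (primitive (w - n)) ^ (-q)) else 0) ≤
      ∑' vk : Freq × ℤ, if vk.1 ≠ 0 ∧ supNorm vk.1 ≤ bracket (n + vk.2 • vk.1) then
        wt (2 * r - q) (n + vk.2 • vk.1) * ENNReal.ofReal (supNorm vk.1 ^ (-q)) else 0 := by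
    have hkey : ∀ w : Freq, n + ((Int.gcd (w - n).1 (w - n).2 : ℕ) : ℤ) • primitive (w - n) = w :=
      fun w => by rw [gcd_smul_primitive]; abel
    refine tsum_le_tsum_of_injOn
      (fun w => (primitive (w - n), ((Int.gcd (w - n).1 (w - n).2 : ℕ) : ℤ))) {w | w ≠ n} ?_ _ _
      ?_ ?_
    · intro a _ b _ hab
      simp only [Prod.mk.injEq] at hab
      rw [← hkey a, ← hkey b, hab.1, hab.2]
    · intro w hw
      have hw' : w ≠ n := hw
      simp only [hkey, hw', primitive_ne_zero (sub_ne_zero.mpr hw'), ne_eq, not_false_eq_true,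
        true_and, le_refl]
    · intro w hw
      simp only [mem_ofPred_eq, not_not] at hw
      simp [hw]
  refine h2.trans ?_
  rw [ENNReal.tsum_prod (f := fun (v : Freq) (k : ℤ) => if v ≠ 0 ∧ supNorm v ≤ bracket (n + k • v)
    then wt (2 * r - q) (n + k • v) * ENNReal.ofReal (supNorm v ^ (-q)) else 0),
    ← ENNReal.tsum_mul_left, ← ENNReal.tsum_mul_left]
  refine ENNReal.tsum_le_tsum fun v => ?_
  by_cases hv : v = 0
  · simp [hv]
  have hD := one_le_supNorm hv
  have hD0 : 0 < supNorm v := by linarith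
  -- With threshold $N=|v|$ both terms of the line bound are $|v|^{-(2r-q)}$. Together with the
  -- factor $|v|^{-q}$ this is $|v|^{-2r}$, summable over $\mathbb Z^2$ because $2r>2$.
  have h3 := tsum_line_le hq1 (r := 2 * r - q) (by linarith) n v hv (supNorm v) hD
  have h4 : ∑' k : ℤ, (if v ≠ 0 ∧ supNorm v ≤ bracket (n + k • v)
      then wt (2 * r - q) (n + k • v) * ENNReal.ofReal (supNorm v ^ (-q)) else 0) =
      (∑' k : ℤ, (if supNorm v ≤ bracket (n + k • v)
        then wt (2 * r - q) (n + k • v) else 0)) * ENNReal.ofReal (supNorm v ^ (-q)) := by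
    rw [← ENNReal.tsum_mul_right]
    refine tsum_congr fun k => ?_
    simp only [ne_eq, hv, not_false_eq_true, true_and, ite_mul, zero_mul]
  rw [h4]
  refine (mul_le_mul_left h3 _).trans ?_
  rw [mul_assoc]
  refine mul_le_mul_right ?_ _
  rw [wt, ← ENNReal.ofReal_mul (by positivity), ← ENNReal.ofReal_mul (by positivity)]
  refine ENNReal.ofReal_le_ofReal ?_
  rw [add_mul, ← Real.rpow_add hD0, ← Real.rpow_add hD0, ← Real.rpow_add hD0]
  have e1 : -(2 * r - q) + -q = -(2 * r) := by ring
  have e2 : q - (2 * r - q) + -q + -q = -(2 * r) := by ring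
  rw [e1, e2, ← two_mul, mul_assoc]
  gcongr
  have h5 : supNorm v ^ (-(2 * r)) = 2 ^ (2 * r) * (2 * supNorm v) ^ (-(2 * r)) := by
    rw [Real.mul_rpow (by norm_num) hD0.le, ← mul_assoc, ← Real.rpow_add (by norm_num),
      add_neg_cancel, Real.rpow_zero, one_mul]
  rw [h5]
  gcongr ?_ * ?_
  exact Real.rpow_le_rpow_of_nonpos (bracket_pos v) (bracket_le_supNorm hv) (by linarith)

/-! ### The divisor bound -/

/-- The local factor of the divisor function at one prime, from $q^{\varepsilon a}\ge2^{\varepsilon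
a}\ge1+\varepsilon a\log2$. -/
theorem succ_le_mul_rpow {ε : ℝ} (hε : 0 < ε) {q : ℝ} (hq : 2 ≤ q) (a : ℕ) :
    ((a : ℝ) + 1) ≤ (1 + 1 / (ε * Real.log 2)) * (q ^ ε) ^ a := by
  have hl : 0 < Real.log 2 := Real.log_pos (by norm_num)
  have h1 : (2 : ℝ) ^ (ε * a) ≤ (q ^ ε) ^ a := by
    rw [← Real.rpow_natCast (q ^ ε), ← Real.rpow_mul (by linarith)]
    exact Real.rpow_le_rpow (by norm_num) hq (by positivity)
  have h2 : 1 + ε * a * Real.log 2 ≤ (2 : ℝ) ^ (ε * a) := by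
    rw [Real.rpow_def_of_pos (by norm_num)]
    linarith [Real.add_one_le_exp (Real.log 2 * (ε * a))]
  refine le_trans ?_ (mul_le_mul_of_nonneg_left (h2.trans h1) (by positivity))
  have h3 : (1 + 1 / (ε * Real.log 2)) * (1 + ε * a * Real.log 2) =
      a + 1 + (ε * a * Real.log 2 + 1 / (ε * Real.log 2)) := by
    field_simp; ring
  rw [h3]
  have : 0 ≤ ε * a * Real.log 2 + 1 / (ε * Real.log 2) := by positivity
  linarith

/-- The divisor function is a product over primes. A prime with $q^\varepsilon\ge2$ costs nothing,
as $a+1\le2^a$; the fewer than $B$ remaining primes cost a constant $K$ each. -/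
theorem exists_card_divisors_le_rpow {ε : ℝ} (hε : 0 < ε) :
    ∃ C : ℝ, 0 < C ∧ ∀ n : ℕ, n ≠ 0 → (n.divisors.card : ℝ) ≤ C * (n : ℝ) ^ ε := by
  have hl : 0 < Real.log 2 := Real.log_pos (by norm_num)
  set K : ℝ := 1 + 1 / (ε * Real.log 2) with hK
  have hK1 : 1 ≤ K := by
    have : 0 ≤ 1 / (ε * Real.log 2) := by positivity
    linarith
  obtain ⟨B, hB⟩ := exists_nat_gt ((2 : ℝ) ^ (1 / ε))
  refine ⟨K ^ B, by positivity, fun n hn => ?_⟩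
  rw [Nat.card_divisors hn]
  push_cast
  have h1 : ∀ q ∈ n.primeFactors, ((n.factorization q : ℝ) + 1) ≤
      (if q < B then K else 1) * ((q : ℝ) ^ ε) ^ n.factorization q := by
    intro q hq
    have hq2 : (2 : ℝ) ≤ q := by exact_mod_cast (Nat.prime_of_mem_primeFactors hq).two_le
    split_ifs with h
    · exact succ_le_mul_rpow hε hq2 _
    · have h2 : (2 : ℝ) ≤ (q : ℝ) ^ ε := by
        have h3 : (2 : ℝ) ^ (1 / ε) ≤ q := hB.le.trans (by exact_mod_cast not_lt.mp h)
        have h4 := Real.rpow_le_rpow (by positivity) h3 hε.le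
        rwa [← Real.rpow_mul (by norm_num), one_div_mul_cancel hε.ne', Real.rpow_one] at h4
      rw [one_mul]
      have h5 : ((n.factorization q : ℝ) + 1) ≤ 2 ^ n.factorization q := by
        exact_mod_cast Nat.lt_two_pow_self
      exact h5.trans (pow_le_pow_left₀ (by norm_num) h2 _)
  refine (Finset.prod_le_prod (fun _ _ => by positivity) h1).trans ?_
  rw [Finset.prod_mul_distrib]
  have h2 : ∏ q ∈ n.primeFactors, ((q : ℝ) ^ ε) ^ n.factorization q = (n : ℝ) ^ ε := by
    conv_rhs => rw [← Nat.prod_factorization_pow_eq_self hn]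
    rw [Finsupp.prod, Nat.support_factorization, Nat.cast_prod,
      ← Real.finsetProd_rpow _ _ (fun _ _ => by positivity)]
    refine Finset.prod_congr rfl fun q _ => ?_
    rw [Nat.cast_pow, ← Real.rpow_natCast, ← Real.rpow_natCast, ← Real.rpow_mul (by positivity),
      ← Real.rpow_mul (by positivity), mul_comm]
  rw [h2]
  gcongr
  rw [← Finset.prod_filter, Finset.prod_const]
  refine pow_le_pow_right₀ hK1 ?_
  calc _ ≤ (Finset.range B).card := Finset.card_le_card fun q hq => by
        simpa using (Finset.mem_filter.mp hq).2
    _ = B := Finset.card_range B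

/-! ### Lattice points on hyperbolas -/

/-- The integer `|n|₋²`. -/
def hypZ (n : Freq) : ℤ := n.1 ^ 2 - n.2 ^ 2

theorem hypZ_cast (n : Freq) : ((hypZ n : ℤ) : ℝ) = hypSq n := by
  simp [hypZ, hypSq]

theorem two_nsmul_fst (z : Freq) : (2 • z).1 = 2 * z.1 := by simp

theorem two_nsmul_snd (z : Freq) : (2 • z).2 = 2 * z.2 := by simp

/-- The lattice points in a disc on a nondegenerate hyperbola. -/
def hyperbolaPoints (c : Freq) (M : ℤ) (R : ℝ) : Set Freq :=
  {z | hypZ (2 • z - c) = M ∧ bracket z ≤ R}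

theorem finite_bracket_le (R : ℝ) : {z : Freq | bracket z ≤ R}.Finite := by
  refine ((Set.finite_Icc (-⌈R⌉) ⌈R⌉).prod (Set.finite_Icc (-⌈R⌉) ⌈R⌉)).subset fun z hz => ?_
  have h1 := abs_le.mp ((abs_fst_le_bracket z).trans (le_trans hz (Int.le_ceil R)))
  have h2 := abs_le.mp ((abs_snd_le_bracket z).trans (le_trans hz (Int.le_ceil R)))
  exact ⟨⟨by exact_mod_cast h1.1, by exact_mod_cast h1.2⟩,
    ⟨by exact_mod_cast h2.1, by exact_mod_cast h2.2⟩⟩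

theorem finite_hyperbolaPoints (c : Freq) (M : ℤ) (R : ℝ) : (hyperbolaPoints c M R).Finite :=
  (finite_bracket_le R).subset fun _ hz => hz.2

/-- Three lattice points in a disc of radius `R` on a hyperbola `AB = M` force `|M| ≲ R⁶`. -/
theorem abs_mul_le_of_three_points {A₀ B₀ A₁ B₁ A₂ B₂ M : ℤ} (hM : M ≠ 0) (h0 : A₀ * B₀ = M)
    (h1 : A₁ * B₁ = M) (h2 : A₂ * B₂ = M) (h01 : A₀ ≠ A₁) (h02 : A₀ ≠ A₂) (h12 : A₁ ≠ A₂) {R : ℝ}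
    (hR : 1 ≤ R) (ha1 : |((A₁ - A₀ : ℤ) : ℝ)| ≤ R) (hb1 : |((B₁ - B₀ : ℤ) : ℝ)| ≤ R)
    (ha2 : |((A₂ - A₀ : ℤ) : ℝ)| ≤ R) (hb2 : |((B₂ - B₀ : ℤ) : ℝ)| ≤ R) :
    |(M : ℝ)| ≤ 4 * R ^ 6 := by
  have hA0 : A₀ ≠ 0 := by rintro rfl; simp at h0; exact hM h0.symm
  have key : ∀ {A B : ℤ}, A * B = M → A₀ ≠ A → B - B₀ ≠ 0 := by
    intro A B h hne hB
    have hB' : B = B₀ := by linarith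
    subst hB'
    have hB0 : B ≠ 0 := by rintro rfl; simp at h0; exact hM h0.symm
    exact hne (mul_right_cancel₀ hB0 (h0.trans h.symm))
  have he1 := key h1 h01
  have he2 := key h2 h02
  set δ := A₁ - A₀ with hδ
  set e := B₁ - B₀ with he
  set δ' := A₂ - A₀ with hδ'
  set e' := B₂ - B₀ with he'
  -- Differences of the three equations form a linear system for $(A_0,B_0)$ whose coefficients are
  -- integers of size at most $R$. Cramer's rule bounds both unknowns by $2R^3$, since a nonzero
  -- integer determinant is at least $1$.
  have r1 : δ * B₀ + e * A₀ + δ * e = 0 := by rw [hδ, he]; linear_combination h1 - h0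
  have r2 : δ' * B₀ + e' * A₀ + δ' * e' = 0 := by rw [hδ', he']; linear_combination h2 - h0
  have d1 : B₀ * (δ * e' - δ' * e) = e * e' * (δ' - δ) := by linear_combination e' * r1 - e * r2
  have d2 : A₀ * (δ * e' - δ' * e) = δ * δ' * (e - e') := by
    linear_combination δ * r2 - δ' * r1
  -- A vanishing determinant would give $\delta=\delta'$, that is, two equal points.
  have hdet : δ * e' - δ' * e ≠ 0 := by
    intro h
    rw [h, mul_zero] at d1
    have h3 : δ' - δ = 0 := by
      rcases mul_eq_zero.mp d1.symm with h4 | h4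
      · rcases mul_eq_zero.mp h4 with h5 | h5
        · exact absurd h5 he1
        · exact absurd h5 he2
      · exact h4
    exact h12 (by rw [hδ, hδ'] at h3; linarith)
  have hdet1 : (1 : ℝ) ≤ |((δ * e' - δ' * e : ℤ) : ℝ)| := by exact_mod_cast Int.one_le_abs hdet
  have bound : ∀ {X a c d f : ℤ}, X * (δ * e' - δ' * e) = a * c * (d - f) → |(a : ℝ)| ≤ R →
      |(c : ℝ)| ≤ R → |(d : ℝ)| ≤ R → |(f : ℝ)| ≤ R → |(X : ℝ)| ≤ 2 * R ^ 3 := by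
    intro X a c d f hX ha hc hd hf
    have h3 : |(X : ℝ)| * |((δ * e' - δ' * e : ℤ) : ℝ)| = |(a : ℝ)| * |(c : ℝ)| * |(d : ℝ) - f| := by
      rw [← abs_mul, ← abs_mul, ← abs_mul]; exact_mod_cast congrArg (fun x : ℤ => |(x : ℝ)|) hX
    have h4 : |(d : ℝ) - f| ≤ 2 * R := (abs_sub _ _).trans (by linarith)
    calc |(X : ℝ)| ≤ |(X : ℝ)| * |((δ * e' - δ' * e : ℤ) : ℝ)| :=
          le_mul_of_one_le_right (abs_nonneg _) hdet1
      _ ≤ R * R * (2 * R) := by rw [h3]; gcongr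
      _ = 2 * R ^ 3 := by ring
  have hB := bound d1 hb1 hb2 ha2 ha1
  have hA := bound d2 ha1 ha2 hb1 hb2
  rw [← h0]
  push_cast
  rw [abs_mul]
  calc |(A₀ : ℝ)| * |(B₀ : ℝ)| ≤ (2 * R ^ 3) * (2 * R ^ 3) := by gcongr
    _ = 4 * R ^ 6 := by ring

theorem hypZ_eq_mul (x : Freq) : (x.1 - x.2) * (x.1 + x.2) = hypZ x := by
  rw [hypZ]; ring

/-- The divisor bound alone would depend on $M$. But a disc with more than two points forces
$|M|\lesssim R^6$, so $|M|^{\varepsilon/6}\lesssim R^\varepsilon$. The points inject into the signed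
divisors of $M$ through one factor of $AB=M$. -/
theorem ncard_hyperbolaPoints_le {ε : ℝ} (hε : 0 < ε) :
    ∃ C : ℝ, 0 < C ∧ ∀ (c : Freq) (M : ℤ), M ≠ 0 → ∀ R : ℝ, 1 ≤ R →
      ((hyperbolaPoints c M R).ncard : ℝ) ≤ C * R ^ ε := by
  obtain ⟨C, hC, hdiv⟩ := exists_card_divisors_le_rpow (ε := ε / 6) (by positivity)
  refine ⟨2 + 2 * C * (4 * 8 ^ 6) ^ (ε / 6), by positivity, fun c M hM R hR => ?_⟩
  have hfin := finite_hyperbolaPoints c M R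
  have hRε : 1 ≤ R ^ ε := Real.one_le_rpow hR hε.le
  by_cases hcard : (hyperbolaPoints c M R).ncard ≤ 2
  · have h1 : ((hyperbolaPoints c M R).ncard : ℝ) ≤ 2 := by exact_mod_cast hcard
    have h2 : 0 ≤ 2 * C * (4 * 8 ^ 6) ^ (ε / 6) * R ^ ε := by positivity
    nlinarith
  obtain ⟨z₀, hz₀, z₁, hz₁, z₂, hz₂, h01, h02, h12⟩ :=
    (Set.two_lt_ncard hfin).mp (not_le.mp hcard)
  set A : Freq → ℤ := fun z => (2 • z - c).1 - (2 • z - c).2 with hA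
  set B : Freq → ℤ := fun z => (2 • z - c).1 + (2 • z - c).2 with hB
  have hAB : ∀ z ∈ hyperbolaPoints c M R, A z * B z = M := fun z hz =>
    (hypZ_eq_mul _).trans hz.1
  have hinj : InjOn A (hyperbolaPoints c M R) := by
    intro x hx y hy hxy
    have hBxy : B x = B y := by
      have hA0 : A x ≠ 0 := by
        intro h; have := hAB x hx; rw [h, zero_mul] at this; exact hM this.symm
      refine mul_left_cancel₀ hA0 ?_
      rw [hAB x hx, hxy, hAB y hy]
    simp only [hA, hB, Prod.fst_sub, Prod.snd_sub, two_nsmul_fst, two_nsmul_snd] at hxy hBxy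
    exact Prod.ext (by linarith) (by linarith)
  have hdA : ∀ x ∈ hyperbolaPoints c M R, ∀ y ∈ hyperbolaPoints c M R,
      |((A x - A y : ℤ) : ℝ)| ≤ 8 * R ∧ |((B x - B y : ℤ) : ℝ)| ≤ 8 * R := by
    intro x hx y hy
    have a1 := abs_le.mp ((abs_fst_le_bracket x).trans hx.2)
    have a2 := abs_le.mp ((abs_snd_le_bracket x).trans hx.2)
    have a3 := abs_le.mp ((abs_fst_le_bracket y).trans hy.2)
    have a4 := abs_le.mp ((abs_snd_le_bracket y).trans hy.2)
    simp only [hA, hB, Prod.fst_sub, Prod.snd_sub, two_nsmul_fst, two_nsmul_snd]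
    push_cast
    constructor <;> rw [abs_le] <;> constructor <;> linarith
  have hMb := abs_mul_le_of_three_points hM (hAB _ hz₀) (hAB _ hz₁) (hAB _ hz₂)
    (fun h => h01 (hinj hz₀ hz₁ h)) (fun h => h02 (hinj hz₀ hz₂ h))
    (fun h => h12 (hinj hz₁ hz₂ h)) (by linarith : 1 ≤ 8 * R) (hdA _ hz₁ _ hz₀).1
    (hdA _ hz₁ _ hz₀).2 (hdA _ hz₂ _ hz₀).1 (hdA _ hz₂ _ hz₀).2
  -- the points inject into the signed divisors of `M`
  set D : Finset ℤ := M.natAbs.divisors.image (fun d : ℕ => (d : ℤ)) ∪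
    M.natAbs.divisors.image (fun d : ℕ => -(d : ℤ)) with hD
  have hmaps : ∀ z ∈ hyperbolaPoints c M R, A z ∈ (D : Set ℤ) := by
    intro z hz
    have hdvd : (A z).natAbs ∈ M.natAbs.divisors := by
      rw [Nat.mem_divisors]
      exact ⟨Int.natAbs_dvd_natAbs.mpr ⟨B z, (hAB z hz).symm⟩, by simpa using hM⟩
    rw [Finset.mem_coe, hD, Finset.mem_union, Finset.mem_image, Finset.mem_image]
    rcases Int.natAbs_eq (A z) with h | h
    · exact Or.inl ⟨_, hdvd, h.symm⟩
    · exact Or.inr ⟨_, hdvd, h.symm⟩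
  have hcardD : (D.card : ℝ) ≤ 2 * M.natAbs.divisors.card := by
    have h1 : D.card ≤ M.natAbs.divisors.card + M.natAbs.divisors.card :=
      (Finset.card_union_le _ _).trans (add_le_add Finset.card_image_le Finset.card_image_le)
    have h2 : (D.card : ℝ) ≤ M.natAbs.divisors.card + M.natAbs.divisors.card := by
      exact_mod_cast h1
    linarith
  have hle : ((hyperbolaPoints c M R).ncard : ℝ) ≤ D.card := by
    have := Set.ncard_le_ncard_of_injOn A hmaps hinj D.finite_toSet
    rw [Set.ncard_coe_finset] at this
    exact_mod_cast this
  have hMabs : ((M.natAbs : ℕ) : ℝ) = |(M : ℝ)| := by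
    rw [Nat.cast_natAbs]; push_cast; rfl
  have h3 := hdiv M.natAbs (by simpa using hM)
  rw [hMabs] at h3
  have h4 : |(M : ℝ)| ^ (ε / 6) ≤ (4 * 8 ^ 6) ^ (ε / 6) * R ^ ε := by
    refine (Real.rpow_le_rpow (abs_nonneg _) hMb (by positivity)).trans (le_of_eq ?_)
    rw [mul_pow, ← mul_assoc, Real.mul_rpow (by positivity) (by positivity),
      ← Real.rpow_natCast R 6, ← Real.rpow_mul (by linarith)]
    congr 2; push_cast; ring
  calc ((hyperbolaPoints c M R).ncard : ℝ) ≤ 2 * (C * |(M : ℝ)| ^ (ε / 6)) := by linarith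
    _ ≤ 2 * (C * ((4 * 8 ^ 6) ^ (ε / 6) * R ^ ε)) := by gcongr
    _ ≤ _ := by nlinarith

open Classical in
/-- Dyadic summation over a set of lattice points with few points in each disc. -/
theorem tsum_wt_le_of_ncard_le {ε : ℝ} (hε : 0 < ε) :
    ∃ C : ℝ≥0∞, C < ⊤ ∧ ∀ (S : Set Freq) (K : ℝ), 0 ≤ K →
      (∀ R : ℝ, 1 ≤ R → ((S ∩ {z | bracket z ≤ R}).ncard : ℝ) ≤ K * R ^ ε) →
      ∑' z : Freq, (if z ∈ S then wt (2 * ε) z else 0) ≤ ENNReal.ofReal K * C := by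
  set x : ℝ := 2 ^ (-ε) with hx
  have hx0 : 0 < x := by positivity
  have hx1 : x < 1 := Real.rpow_lt_one_of_one_lt_of_neg (by norm_num) (by linarith)
  refine ⟨ENNReal.ofReal (2 ^ ε) * ∑' j : ℕ, ENNReal.ofReal (x ^ j), ?_, fun S K hK hS => ?_⟩
  · exact ENNReal.mul_lt_top ENNReal.ofReal_lt_top
      (summable_geometric_of_lt_one hx0.le hx1).tsum_ofReal_ne_top.lt_top
  have h1 : ∀ z : Freq, (if z ∈ S then wt (2 * ε) z else 0) ≤
      ∑' j : ℕ, (if z ∈ S ∩ {z | bracket z ≤ 2 ^ (j + 1)} then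
        ENNReal.ofReal ((2 : ℝ) ^ (-(2 * ε) * j)) else 0) := by
    intro z
    by_cases hz : z ∈ S
    swap
    · simp [hz]
    have hb := one_le_bracket z
    -- Charge $z$ to its dyadic shell. The weight $2^{-2\varepsilon j}$ against $O(2^{\varepsilon
    -- j})$ points leaves a geometric series of ratio $2^{-\varepsilon}$.
    obtain ⟨j, hj1, hj2⟩ := exists_nat_pow_near hb (by norm_num : (1 : ℝ) < 2)
    refine le_trans ?_ (ENNReal.le_tsum j)
    rw [if_pos hz, if_pos ⟨hz, hj2.le⟩, wt]
    refine ENNReal.ofReal_le_ofReal ?_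
    have he : (2 : ℝ) ^ (-(2 * ε) * j) = ((2 : ℝ) ^ j) ^ (-(2 * ε)) := by
      rw [mul_comm, Real.rpow_mul (by norm_num), Real.rpow_natCast]
    rw [he]
    exact Real.rpow_le_rpow_of_nonpos (by positivity) hj1 (by linarith)
  refine (ENNReal.tsum_le_tsum h1).trans ?_
  rw [ENNReal.tsum_comm, ← mul_assoc, ← ENNReal.tsum_mul_left]
  refine ENNReal.tsum_le_tsum fun j => ?_
  set T := S ∩ {z | bracket z ≤ 2 ^ (j + 1)} with hT
  have hTfin : T.Finite := (finite_bracket_le _).subset inter_subset_right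
  have h2 : ∑' z : Freq, (if z ∈ T then ENNReal.ofReal ((2 : ℝ) ^ (-(2 * ε) * j)) else 0) =
      (T.ncard : ℝ≥0∞) * ENNReal.ofReal ((2 : ℝ) ^ (-(2 * ε) * j)) := by
    rw [tsum_eq_sum (s := hTfin.toFinset) (fun z hz => if_neg (by simpa using hz)),
      Finset.sum_congr rfl (fun z hz => if_pos (by simpa using hz)), Finset.sum_const,
      nsmul_eq_mul, ncard_eq_toFinset_card T hTfin]
  rw [h2, ← ENNReal.ofReal_natCast, ← ENNReal.ofReal_mul (by positivity),
    ← ENNReal.ofReal_mul hK, ← ENNReal.ofReal_mul (by positivity)]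
  refine ENNReal.ofReal_le_ofReal ?_
  have h3 := hS (2 ^ (j + 1)) (one_le_pow₀ (by norm_num))
  calc (T.ncard : ℝ) * (2 : ℝ) ^ (-(2 * ε) * j)
      ≤ K * ((2 : ℝ) ^ (j + 1)) ^ ε * (2 : ℝ) ^ (-(2 * ε) * j) := by gcongr
    _ = K * 2 ^ ε * x ^ j := by
      rw [hx, ← Real.rpow_natCast, ← Real.rpow_natCast, ← Real.rpow_mul (by norm_num),
        ← Real.rpow_mul (by norm_num), mul_assoc, mul_assoc, ← Real.rpow_add (by norm_num),
        ← Real.rpow_add (by norm_num)]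
      congr 2; push_cast; ring

/-- Sum over the part of a nondegenerate hyperbola outside a disc. -/
theorem tsum_hyperbola_le {r ε : ℝ} (hε : 0 < ε) (hεr : 2 * ε ≤ r) :
    ∃ C : ℝ≥0∞, C < ⊤ ∧ ∀ (c : Freq) (M : ℤ), M ≠ 0 → ∀ w : Freq,
      ∑' z : Freq, (if hypZ (2 • z - c) = M ∧ bracket w ≤ bracket z then wt r z else 0) ≤
        C * wt (r - 2 * ε) w := by
  obtain ⟨K, hK, hcount⟩ := ncard_hyperbolaPoints_le hε
  obtain ⟨C, hC, hsum⟩ := tsum_wt_le_of_ncard_le hε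
  refine ⟨ENNReal.ofReal K * C, ENNReal.mul_lt_top ENNReal.ofReal_lt_top hC,
    fun c M hM w => ?_⟩
  classical
  have h1 := hsum {z | hypZ (2 • z - c) = M} K hK.le (hcount c M hM)
  refine le_trans ?_ (mul_le_mul_left h1 _)
  rw [← ENNReal.tsum_mul_right]
  refine ENNReal.tsum_le_tsum fun z => ?_
  by_cases hz : hypZ (2 • z - c) = M ∧ bracket w ≤ bracket z
  · rw [if_pos hz, if_pos (show z ∈ {z | hypZ (2 • z - c) = M} from hz.1)]
    -- All decay except $2\varepsilon$ is transferred from $z$ to the smaller frequency $w$.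
    have h2 : wt (r - 2 * ε) z ≤ wt (r - 2 * ε) w :=
      ENNReal.ofReal_le_ofReal (Real.rpow_le_rpow_of_nonpos (bracket_pos w) hz.2 (by linarith))
    refine le_trans (le_of_eq ?_) (mul_le_mul_right h2 _)
    rw [wt_mul_wt]; congr 1; ring
  · rw [if_neg hz]; exact bot_le

/-- A set of lattice points labelled by a single integer of size $O(\langle z\rangle)$ is
one-dimensional, so its weighted sum is finite as soon as $r>1$. -/
theorem tsum_wt_le_of_injOn {r : ℝ} (hr : 0 ≤ r) (φ : Freq → ℤ)
    (hφ : ∀ z, |(φ z : ℝ)| ≤ 2 * bracket z) (p : Freq → Prop) [DecidablePred p]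
    (hp : ∀ x y, p x → p y → φ x = φ y → x = y) :
    ∑' z : Freq, (if p z then wt r z else 0) ≤ ENNReal.ofReal (3 ^ r) * ∑' k : ℤ, wtZ r k := by
  rw [← ENNReal.tsum_mul_left]
  refine tsum_le_tsum_of_injOn φ {z | p z} (fun x hx y hy => hp x y hx hy) _ _ ?_ ?_
  · intro z hz
    rw [if_pos (show p z from hz), wt, wtZ, ← ENNReal.ofReal_mul (by positivity)]
    refine ENNReal.ofReal_le_ofReal ?_
    have h1 : (1 + |(φ z : ℝ)|) ≤ 3 * bracket z := by linarith [hφ z, one_le_bracket z]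
    have h2 : bracket z ^ (-r) = 3 ^ r * (3 * bracket z) ^ (-r) := by
      rw [Real.mul_rpow (by norm_num) (bracket_pos z).le, ← mul_assoc,
        ← Real.rpow_add (by norm_num), add_neg_cancel, Real.rpow_zero, one_mul]
    rw [h2]
    gcongr ?_ * ?_
    exact Real.rpow_le_rpow_of_nonpos (by positivity) h1 (by linarith)
  · intro z hz
    exact if_neg hz

/-- Sum over a (possibly degenerate) hyperbola. -/
theorem tsum_conic_le {r : ℝ} (hr : 1 < r) :
    ∃ C : ℝ≥0∞, C < ⊤ ∧ ∀ (c : Freq) (M : ℤ),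
      ∑' z : Freq, (if hypZ (2 • z - c) = M then wt r z else 0) ≤ C := by
  set E := ENNReal.ofReal (3 ^ r) * ∑' k : ℤ, wtZ r k with hE
  have hEtop : E < ⊤ := ENNReal.mul_lt_top ENNReal.ofReal_lt_top (tsum_wtZ_lt_top hr)
  refine ⟨E + E, ENNReal.add_lt_top.mpr ⟨hEtop, hEtop⟩, fun c M => ?_⟩
  have hs : ∀ z : Freq, |((z.1 - z.2 : ℤ) : ℝ)| ≤ 2 * bracket z := fun z => by
    push_cast
    linarith [abs_sub (z.1 : ℝ) z.2, abs_fst_le_bracket z, abs_snd_le_bracket z]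
  have ha : ∀ z : Freq, |((z.1 + z.2 : ℤ) : ℝ)| ≤ 2 * bracket z := fun z => by
    push_cast
    linarith [abs_add_le (z.1 : ℝ) z.2, abs_fst_le_bracket z, abs_snd_le_bracket z]
  have hexp : ∀ z : Freq, hypZ (2 • z - c) =
      (2 * (z.1 - z.2) - (c.1 - c.2)) * (2 * (z.1 + z.2) - (c.1 + c.2)) := fun z => by
    simp only [hypZ, Prod.fst_sub, Prod.snd_sub, two_nsmul_fst, two_nsmul_snd]
    ring
  -- The conic is a product of linear forms in $z_1-z_2$ and $z_1+z_2$. Where the first factor is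
  -- nonzero, $z_1-z_2$ determines the point; where it vanishes, $z_1+z_2$ does.
  have h1 := tsum_wt_le_of_injOn (r := r) (by linarith) _ hs
    (fun z => hypZ (2 • z - c) = M ∧ 2 * (z.1 - z.2) - (c.1 - c.2) ≠ 0) (by
      rintro x y ⟨hx, hx0⟩ ⟨hy, -⟩ hxy
      rw [hexp] at hx hy
      have h2 := mul_left_cancel₀ hx0 (hx.trans (by rw [← hy, ← hxy]))
      exact Prod.ext (by linarith) (by linarith))
  have h2 := tsum_wt_le_of_injOn (r := r) (by linarith) _ ha
    (fun z => 2 * (z.1 - z.2) - (c.1 - c.2) = 0) (by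
      intro x y hx hy hxy
      exact Prod.ext (by linarith) (by linarith))
  refine le_trans ?_ (add_le_add h1 h2)
  rw [← ENNReal.tsum_add]
  refine ENNReal.tsum_le_tsum fun z => ?_
  by_cases hz : hypZ (2 • z - c) = M
  · rw [if_pos hz]
    by_cases hz0 : 2 * (z.1 - z.2) - (c.1 - c.2) = 0
    · rw [if_pos hz0]; exact le_add_self
    · rw [if_pos ⟨hz, hz0⟩]; exact le_self_add
  · rw [if_neg hz]; exact bot_le

/-- For a nondegenerate hyperbola the inner sum is $O(\langle w\rangle^{-(r-2\varepsilon)})$, so the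
outer exponent is $2r-2\varepsilon>2$. This serves the case in which the fixed frequency is $n_2$.
-/
theorem tsum_conics_lt_top {r : ℝ} (hr : 1 < r) :
    ∃ C : ℝ≥0∞, C < ⊤ ∧ ∀ (n : Freq) (c : ℤ),
      ∑' w : Freq, ∑' z : Freq, (if hypZ (2 • z - (w + n)) = hypZ (w - n) + c ∧
        bracket w ≤ bracket z then wt r w * wt r z else 0) ≤ C := by
  obtain ⟨ε, hε0, hε⟩ := exists_between (show 0 < (r - 1) / 2 by linarith)
  obtain ⟨C₁, hC₁, h1⟩ := tsum_hyperbola_le (r := r) hε0 (by linarith)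
  obtain ⟨C₂, hC₂, h2⟩ := tsum_conic_le hr
  set S := ∑' n : Freq, wt (2 * r - 2 * ε) n with hS
  have hStop : S < ⊤ := tsum_wt_lt_top (by linarith)
  refine ⟨C₁ * S + C₂ * C₂, ENNReal.add_lt_top.mpr ⟨ENNReal.mul_lt_top hC₁ hStop,
    ENNReal.mul_lt_top hC₂ hC₂⟩, fun n c => ?_⟩
  have h3 : ∀ w : Freq, ∑' z : Freq, (if hypZ (2 • z - (w + n)) = hypZ (w - n) + c ∧
      bracket w ≤ bracket z then wt r w * wt r z else 0) ≤
      C₁ * wt (2 * r - 2 * ε) w +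
        (if hypZ (2 • w - 2 • n) = -4 * c then wt r w else 0) * C₂ := by
    intro w
    have h4 : ∑' z : Freq, (if hypZ (2 • z - (w + n)) = hypZ (w - n) + c ∧
        bracket w ≤ bracket z then wt r w * wt r z else 0) = wt r w * ∑' z : Freq,
        (if hypZ (2 • z - (w + n)) = hypZ (w - n) + c ∧ bracket w ≤ bracket z
          then wt r z else 0) := by
      rw [← ENNReal.tsum_mul_left]
      exact tsum_congr fun z => by rw [mul_ite, mul_zero]
    rw [h4]
    -- If the hyperbola degenerates, then $w$ is itself confined to a conic, and two one-dimensional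
    -- sums with $r>1$ remain.
    by_cases hM : hypZ (w - n) + c = 0
    · have h5 : hypZ (2 • w - 2 • n) = -4 * c := by
        simp only [hypZ, Prod.fst_sub, Prod.snd_sub, two_nsmul_fst, two_nsmul_snd] at hM ⊢
        linear_combination 4 * hM
      rw [if_pos h5]
      refine le_trans ?_ le_add_self
      refine mul_le_mul_right (le_trans (ENNReal.tsum_le_tsum fun z => ?_)
        (h2 (w + n) (hypZ (w - n) + c))) _
      by_cases hz : hypZ (2 • z - (w + n)) = hypZ (w - n) + c ∧ bracket w ≤ bracket z
      · rw [if_pos hz, if_pos hz.1]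
      · rw [if_neg hz]; exact bot_le
    · refine le_trans (mul_le_mul_right (h1 (w + n) _ hM w) _) (le_trans (le_of_eq ?_) le_self_add)
      rw [mul_left_comm, wt_mul_wt]; congr 2; ring
  refine (ENNReal.tsum_le_tsum h3).trans ?_
  rw [ENNReal.tsum_add, ENNReal.tsum_mul_left, ENNReal.tsum_mul_right]
  gcongr
  exact h2 _ _

/-! ### The resonance counting estimate -/

/-- The resonance function of the interaction `n = n₁ - n₂ + n₃`. -/
def resonance (n n₁ n₂ n₃ : Freq) : ℤ := hypZ n₁ - hypZ n₂ + hypZ n₃ - hypZ n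

/-- The weight `(⟨n⟩ / (⟨n₁⟩⟨n₂⟩⟨n₃⟩))^r`. -/
def tripleWt (r : ℝ) (n n₁ n₂ n₃ : Freq) : ℝ≥0∞ :=
  ENNReal.ofReal ((bracket n / (bracket n₁ * bracket n₂ * bracket n₃)) ^ r)

/-- The largest of $\langle n_1\rangle,\langle n_2\rangle,\langle n_3\rangle$ is at least $\langle
n\rangle/3$ and cancels the numerator. -/
theorem tripleWt_le {r : ℝ} (hr : 0 ≤ r) {n n₁ n₂ n₃ : Freq} (h : n₁ - n₂ + n₃ = n) :
    tripleWt r n n₁ n₂ n₃ ≤ ENNReal.ofReal (3 ^ r) *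
      (wt r n₁ * wt r n₂ + wt r n₁ * wt r n₃ + wt r n₂ * wt r n₃) := by
  have b1 := bracket_pos n₁
  have b2 := bracket_pos n₂
  have b3 := bracket_pos n₃
  have hn : bracket n ≤ bracket n₁ + bracket n₂ + bracket n₃ := by
    rw [← h, sub_eq_add_neg]
    refine (bracket_add_le _ _).trans (add_le_add ((bracket_add_le _ _).trans ?_) le_rfl)
    rw [bracket_neg]
  have aux : ∀ {x y z : ℝ}, 0 < x → 0 < y → 0 < z → bracket n ≤ 3 * z →
      ENNReal.ofReal ((bracket n / (x * y * z)) ^ r) ≤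
        ENNReal.ofReal (3 ^ r) * (ENNReal.ofReal (x ^ (-r)) * ENNReal.ofReal (y ^ (-r))) := by
    intro x y z hx hy hz hle
    rw [← ENNReal.ofReal_mul (by positivity), ← ENNReal.ofReal_mul (by positivity)]
    refine ENNReal.ofReal_le_ofReal ?_
    rw [← Real.mul_rpow hx.le hy.le, Real.rpow_neg (by positivity), ← Real.inv_rpow (by positivity),
      ← Real.mul_rpow (by norm_num) (by positivity)]
    refine Real.rpow_le_rpow (div_nonneg (bracket_pos n).le (by positivity)) ?_ hr
    rw [div_le_iff₀ (by positivity)]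
    calc bracket n ≤ 3 * z := hle
      _ = 3 * (x * y)⁻¹ * (x * y * z) := by field_simp
  by_cases h3 : bracket n ≤ 3 * bracket n₃
  · refine (aux b1 b2 b3 h3).trans (mul_le_mul_right ?_ _)
    exact (le_self_add).trans le_self_add
  by_cases h2 : bracket n ≤ 3 * bracket n₂
  · have := aux b1 b3 b2 h2
    rw [mul_right_comm] at this
    exact this.trans (mul_le_mul_right (le_add_self.trans le_self_add) _)
  · have h1 : bracket n ≤ 3 * bracket n₁ := by linarith
    have := aux b2 b3 b1 h1
    rw [← mul_rotate] at this
    exact this.trans (mul_le_mul_right le_add_self _)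

/-- Once $n_2$ is eliminated the resonance function is bilinear in $n_1-n$ and $n_3-n$; this is why
its level sets are lines for fixed $n_1$ or $n_3$. -/
theorem resonance_eq (n n₁ n₃ : Freq) :
    resonance n n₁ (n₁ + n₃ - n) n₃ = -2 * hypForm (n₃ - n) (n₁ - n) := by
  simp only [resonance, hypZ, hypForm, Prod.fst_sub, Prod.snd_sub, Prod.fst_add, Prod.snd_add]
  ring

theorem tripleWt_self_left (r : ℝ) (n m : Freq) : tripleWt r n n m m = wt (2 * r) m := by
  have h1 := bracket_pos n
  have h2 := bracket_pos m
  rw [tripleWt, wt]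
  congr 1
  rw [neg_mul_eq_mul_neg, Real.rpow_mul h2.le, Real.rpow_neg (by positivity),
    ← Real.inv_rpow (by positivity)]
  congr 1
  rw [Real.rpow_ofNat]
  field_simp

theorem tripleWt_self_right (r : ℝ) (n m : Freq) : tripleWt r n m m n = wt (2 * r) m := by
  rw [← tripleWt_self_left r n m, tripleWt, tripleWt]
  congr 3; ring

/-- The core of the well-posedness proof. Interactions with $n_1=n$ or $n_3=n$ contribute
$\sum\langle m\rangle^{-2r}$; each of the others is dominated by three pairs of weights, and each
pair by two sums over lines or conics. -/
theorem exists_counting_bound {r : ℝ} (hr : 1 < r) :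
    ∃ C : ℝ≥0∞, C < ⊤ ∧ ∀ (n : Freq) (m : ℤ),
      ∑' n₁ : Freq, ∑' n₃ : Freq, (if resonance n n₁ (n₁ + n₃ - n) n₃ = m then
        tripleWt r n n₁ (n₁ + n₃ - n) n₃ else 0) ≤ C := by
  obtain ⟨C₁, hC₁, hline⟩ := tsum_lines_lt_top hr
  obtain ⟨C₂, hC₂, hconic⟩ := tsum_conics_lt_top hr
  set S := ∑' n : Freq, wt (2 * r) n with hS
  have hStop : S < ⊤ := tsum_wt_lt_top (by linarith)
  set A := ENNReal.ofReal (3 ^ r) with hA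
  refine ⟨S + S + A * ((C₁ + C₁) + ((C₁ + C₁) + (C₂ + C₂))), ?_, fun n m => ?_⟩
  · exact ENNReal.add_lt_top.mpr ⟨ENNReal.add_lt_top.mpr ⟨hStop, hStop⟩,
      ENNReal.mul_lt_top ENNReal.ofReal_lt_top (by simp [hC₁, hC₂])⟩
  -- The resonance function is even, so the rounding is harmless: on a nonempty level set $m=-2e$
  -- exactly.
  set e : ℤ := -m / 2 with he
  -- the two line sums and the conic sum
  set L : Freq → Freq → ℝ≥0∞ := fun w z => if w ≠ n ∧ hypForm z (w - n) = e + hypForm n (w - n) ∧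
    bracket w ≤ bracket z then wt r w * wt r z else 0 with hL
  set L' : Freq → Freq → ℝ≥0∞ := fun w z => if w ≠ n ∧ hypForm z (w - n) = e + hypForm w (w - n) ∧
    bracket w ≤ bracket z then wt r w * wt r z else 0 with hL'
  set D : Freq → Freq → ℝ≥0∞ := fun w z => if hypZ (2 • z - (w + n)) = hypZ (w - n) + -4 * e ∧
    bracket w ≤ bracket z then wt r w * wt r z else 0 with hD
  have hLsum : ∑' w, ∑' z, L w z ≤ C₁ := hline n _
  have hL'sum : ∑' w, ∑' z, L' w z ≤ C₁ := hline n _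
  have hDsum : ∑' w, ∑' z, D w z ≤ C₂ := hconic n _
  have hpt : ∀ n₁ n₃ : Freq, (if resonance n n₁ (n₁ + n₃ - n) n₃ = m then
      tripleWt r n n₁ (n₁ + n₃ - n) n₃ else 0) ≤
      ((if n₁ = n then wt (2 * r) n₃ else 0) + (if n₃ = n then wt (2 * r) n₁ else 0)) +
      A * ((L n₁ n₃ + L n₃ n₁) + ((L' n₃ (n₁ + n₃ - n) + L' n₁ (n₁ + n₃ - n)) +
        (D (n₁ + n₃ - n) n₃ + D (n₁ + n₃ - n) n₁))) := by
    intro n₁ n₃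
    by_cases hm : resonance n n₁ (n₁ + n₃ - n) n₃ = m
    swap
    · rw [if_neg hm]; exact bot_le
    rw [if_pos hm]
    -- Here the direction $n_1-n$ of the line degenerates; but then $n_2=n_3$ and the weight is
    -- $\langle n_3\rangle^{-2r}$.
    by_cases h1 : n₁ = n
    · subst h1
      rw [add_sub_cancel_left, tripleWt_self_left, if_pos rfl]
      exact le_self_add.trans le_self_add
    by_cases h3 : n₃ = n
    · subst h3
      rw [add_sub_cancel_right, tripleWt_self_right, if_pos rfl]
      exact le_add_self.trans le_self_add
    refine le_trans ?_ le_add_self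
    refine (tripleWt_le (by linarith) (by abel)).trans (mul_le_mul_right ?_ _)
    have hB : hypForm (n₃ - n) (n₁ - n) = e := by
      rw [resonance_eq] at hm; omega
    set n₂ := n₁ + n₃ - n with hn₂
    have e13 : wt r n₁ * wt r n₃ ≤ L n₁ n₃ + L n₃ n₁ := by
      rcases le_total (bracket n₁) (bracket n₃) with h | h
      · refine le_trans (le_of_eq ?_) le_self_add
        rw [hL]
        refine (if_pos ⟨h1, ?_, h⟩).symm
        rw [← hB]; simp only [hypForm, Prod.fst_sub, Prod.snd_sub]; ring
      · refine le_trans (le_of_eq ?_) le_add_self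
        rw [hL, mul_comm]
        refine (if_pos ⟨h3, ?_, h⟩).symm
        rw [← hB]; simp only [hypForm, Prod.fst_sub, Prod.snd_sub]; ring
    -- If $n_3$ is the smaller frequency, $n_2$ moves on a line. If $n_2$ is, then $n_1=n_2+n-n_3$
    -- makes the condition quadratic in $n_3$, and completing the square gives a hyperbola.
    have e23 : wt r n₂ * wt r n₃ ≤ L' n₃ n₂ + D n₂ n₃ := by
      rcases le_total (bracket n₃) (bracket n₂) with h | h
      · refine le_trans (le_of_eq ?_) le_self_add
        rw [hL', mul_comm]
        refine (if_pos ⟨h3, ?_, h⟩).symm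
        rw [← hB, hn₂]
        simp only [hypForm, Prod.fst_sub, Prod.snd_sub, Prod.fst_add, Prod.snd_add]; ring
      · refine le_trans (le_of_eq ?_) le_add_self
        rw [hD]
        refine (if_pos ⟨?_, h⟩).symm
        rw [← hB, hn₂]
        simp only [hypForm, hypZ, Prod.fst_sub, Prod.snd_sub, Prod.fst_add, Prod.snd_add,
          two_nsmul_fst, two_nsmul_snd]; ring
    have e12 : wt r n₁ * wt r n₂ ≤ L' n₁ n₂ + D n₂ n₁ := by
      rcases le_total (bracket n₁) (bracket n₂) with h | h
      · refine le_trans (le_of_eq ?_) le_self_add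
        rw [hL']
        refine (if_pos ⟨h1, ?_, h⟩).symm
        rw [← hB, hn₂]
        simp only [hypForm, Prod.fst_sub, Prod.snd_sub, Prod.fst_add, Prod.snd_add]; ring
      · refine le_trans (le_of_eq ?_) le_add_self
        rw [hD, mul_comm]
        refine (if_pos ⟨?_, h⟩).symm
        rw [← hB, hn₂]
        simp only [hypForm, hypZ, Prod.fst_sub, Prod.snd_sub, Prod.fst_add, Prod.snd_add,
          two_nsmul_fst, two_nsmul_snd]; ring
    calc _ ≤ (L' n₁ n₂ + D n₂ n₁) + (L n₁ n₃ + L n₃ n₁) + (L' n₃ n₂ + D n₂ n₃) :=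
          add_le_add (add_le_add e12 e13) e23
      _ = _ := by ring
  refine (ENNReal.tsum_le_tsum fun n₁ => ENNReal.tsum_le_tsum fun n₃ => hpt n₁ n₃).trans ?_
  simp_rw [ENNReal.tsum_add, ENNReal.tsum_mul_left, ENNReal.tsum_add]
  have s1 : ∑' n₁ : Freq, ∑' n₃ : Freq, (if n₁ = n then wt (2 * r) n₃ else 0) = S := by
    rw [tsum_eq_single n (fun b hb => by simp [hb])]
    simp [hS]
  have s2 : ∑' n₁ : Freq, ∑' n₃ : Freq, (if n₃ = n then wt (2 * r) n₁ else 0) = S := by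
    rw [ENNReal.tsum_comm]
    rw [tsum_eq_single n (fun b hb => by simp [hb])]
    simp [hS]
  have tr : ∀ (F : Freq → ℝ≥0∞) (a : Freq), ∑' x, F (x + a - n) = ∑' x, F x := fun F a => by
    rw [← (Equiv.addRight (a - n)).tsum_eq F]
    refine tsum_congr fun x => ?_
    rw [Equiv.coe_addRight, add_sub_assoc]
  have tr' : ∀ (F : Freq → ℝ≥0∞) (a : Freq), ∑' x, F (a + x - n) = ∑' x, F x := fun F a => by
    rw [← tr F a]
    refine tsum_congr fun x => ?_
    rw [add_comm]
  have s3 : ∑' n₁ : Freq, ∑' n₃ : Freq, L n₃ n₁ ≤ C₁ := by rw [ENNReal.tsum_comm]; exact hLsum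
  have s4 : ∑' n₁ : Freq, ∑' n₃ : Freq, L' n₃ (n₁ + n₃ - n) ≤ C₁ := by
    rw [ENNReal.tsum_comm]
    refine le_trans (le_of_eq (tsum_congr fun w => ?_)) hL'sum
    exact tr (L' w) w
  have s5 : ∑' n₁ : Freq, ∑' n₃ : Freq, L' n₁ (n₁ + n₃ - n) ≤ C₁ :=
    le_trans (le_of_eq (tsum_congr fun w => tr' (L' w) w)) hL'sum
  have s6 : ∑' n₁ : Freq, ∑' n₃ : Freq, D (n₁ + n₃ - n) n₃ ≤ C₂ := by
    rw [ENNReal.tsum_comm]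
    refine le_trans (le_of_eq (tsum_congr fun z => ?_)) (ENNReal.tsum_comm.trans_le hDsum)
    exact tr (fun w => D w z) z
  have s7 : ∑' n₁ : Freq, ∑' n₃ : Freq, D (n₁ + n₃ - n) n₁ ≤ C₂ :=
    le_trans (le_of_eq (tsum_congr fun z => tr' (fun w => D w z) z))
      (ENNReal.tsum_comm.trans_le hDsum)
  rw [s1, s2]
  gcongr

/-! ### The time cutoff -/

theorem schwartz_bound (f : SchwartzMap ℝ ℂ) :
    ∃ C : ℝ, 0 < C ∧ ∀ x : ℝ, ‖f x‖ ≤ C * (1 + x ^ 2)⁻¹ := by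
  obtain ⟨C0, h0⟩ := f.decay 0 0
  obtain ⟨C2, h2⟩ := f.decay 2 0
  refine ⟨|C0| + |C2| + 1, by positivity, fun x => ?_⟩
  have a0 := h0.2 x
  have a2 := h2.2 x
  simp only [norm_iteratedFDeriv_zero, pow_zero, one_mul, Real.norm_eq_abs, sq_abs] at a0 a2
  rw [← div_eq_mul_inv, le_div_iff₀ (by positivity)]
  nlinarith [le_abs_self C0, le_abs_self C2]

/-- The Fourier transform of a smooth bump equal to $1$ on $[-1,1]$ is a Schwartz function;
quadratic decay of it and of its derivative is all that is kept. -/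
theorem exists_cutoff :
    ∃ (θ θ' : ℝ → ℂ) (C : ℝ), 0 < C ∧ Continuous θ' ∧ (∀ x, HasDerivAt θ (θ' x) x) ∧
      (∀ x, ‖θ x‖ ≤ C * (1 + x ^ 2)⁻¹) ∧ (∀ x, ‖θ' x‖ ≤ C * (1 + x ^ 2)⁻¹) ∧
      ∀ t ∈ Icc (0 : ℝ) 1, ∫ σ : ℝ, Complex.exp (Complex.I * t * σ) * θ σ = 1 := by
  let f : ContDiffBump (0 : ℝ) := ⟨1, 2, by norm_num, by norm_num⟩
  have hcs : HasCompactSupport (fun x : ℝ => ((f x : ℝ) : ℂ)) :=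
    f.hasCompactSupport.comp_left (g := fun y : ℝ => (y : ℂ)) Complex.ofReal_zero
  have hcd : ContDiff ℝ ((⊤ : ℕ∞) : WithTop ℕ∞) (fun x : ℝ => ((f x : ℝ) : ℂ)) :=
    Complex.ofRealCLM.contDiff.comp f.contDiff
  let χ : SchwartzMap ℝ ℂ := hcs.toSchwartzMap hcd
  have hχ : ∀ x, χ x = ((f x : ℝ) : ℂ) := fun x => rfl
  let ψ : SchwartzMap ℝ ℂ := FourierTransform.fourier χ
  let ψ' : SchwartzMap ℝ ℂ := SchwartzMap.derivCLM ℝ ℂ ψ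
  obtain ⟨C1, hC1, h1⟩ := schwartz_bound ψ
  obtain ⟨C2, hC2, h2⟩ := schwartz_bound ψ'
  have hπ : 0 < 2 * Real.pi := by positivity
  have hπ1 : 1 ≤ 2 * Real.pi := by linarith [Real.pi_gt_three]
  -- Rescaling from the convention $e^{2\pi ixt}$ to the convention $e^{it\sigma}$ of `X.coeff`.
  set a : ℝ := (2 * Real.pi)⁻¹ with ha
  have ha0 : 0 < a := by positivity
  have ha1 : a ≤ 1 := inv_le_one_of_one_le₀ hπ1
  have hscale : ∀ x : ℝ, (1 + (a * x) ^ 2)⁻¹ ≤ (2 * Real.pi) ^ 2 * (1 + x ^ 2)⁻¹ := by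
    intro x
    rw [← div_eq_mul_inv, le_div_iff₀ (by positivity), inv_mul_le_iff₀ (by positivity)]
    have : (2 * Real.pi) ^ 2 * (a * x) ^ 2 = x ^ 2 := by rw [ha]; field_simp
    nlinarith
  refine ⟨fun x => a * ψ (a * x), fun x => a * (a * ψ' (a * x)),
    (C1 + C2) * (2 * Real.pi) ^ 2, by positivity, ?_, ?_, ?_, ?_, ?_⟩
  · have := ψ'.continuous
    fun_prop
  · intro x
    have h3 : HasDerivAt ψ (ψ' (a * x)) (a * x) := ψ.differentiableAt.hasDerivAt
    have h4 : HasDerivAt (fun x : ℝ => a * x) a x := by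
      simpa using (hasDerivAt_id x).const_mul a
    have h5 := (HasDerivAt.scomp x h3 h4).const_mul (a : ℂ)
    simpa using h5
  · intro x
    rw [norm_mul, Complex.norm_real, Real.norm_of_nonneg ha0.le]
    calc a * ‖ψ (a * x)‖ ≤ 1 * (C1 * (1 + (a * x) ^ 2)⁻¹) :=
          mul_le_mul ha1 (h1 _) (norm_nonneg _) (by norm_num)
      _ ≤ 1 * ((C1 + C2) * ((2 * Real.pi) ^ 2 * (1 + x ^ 2)⁻¹)) := by
          gcongr
          · linarith
          · exact hscale x
      _ = _ := by ring
  · intro x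
    rw [norm_mul, norm_mul, Complex.norm_real, Real.norm_of_nonneg ha0.le]
    calc a * (a * ‖ψ' (a * x)‖) ≤ 1 * (1 * (C2 * (1 + (a * x) ^ 2)⁻¹)) := by
          gcongr
          exact h2 _
      _ ≤ 1 * (1 * ((C1 + C2) * ((2 * Real.pi) ^ 2 * (1 + x ^ 2)⁻¹))) := by
          gcongr
          · linarith
          · exact hscale x
      _ = _ := by ring
  · intro t ht
    have hinv : FourierTransformInv.fourierInv ψ = χ := FourierTransform.fourierInv_fourier_eq χ
    have h3 : χ t = ∫ x : ℝ, Complex.exp (↑(2 * Real.pi * x * t) * Complex.I) * ψ x := by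
      rw [← hinv, SchwartzMap.fourierInv_coe, Real.fourierInv_eq']
      refine integral_congr_ae (Eventually.of_forall fun x => ?_)
      simp only [smul_eq_mul, RCLike.inner_apply, conj_trivial]
      congr 4
      ring
    have h4 : χ t = 1 := by
      rw [hχ, f.one_of_mem_closedBall, Complex.ofReal_one]
      rw [Metric.mem_closedBall, dist_zero_right, Real.norm_eq_abs, abs_le]
      exact ⟨by linarith [ht.1, (by norm_num : (0:ℝ) ≤ 1)], ht.2⟩
    rw [← h4, h3]
    have h5 := Measure.integral_comp_mul_left
      (fun x : ℝ => Complex.exp (↑(2 * Real.pi * x * t) * Complex.I) * ψ x) a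
    have h6 : |a⁻¹| = 2 * Real.pi := by rw [ha, inv_inv, abs_of_pos hπ]
    rw [h6] at h5
    have h7 : (∫ x : ℝ, Complex.exp (↑(2 * Real.pi * x * t) * Complex.I) * ψ x) =
        a * ∫ x : ℝ, Complex.exp (↑(2 * Real.pi * (a * x) * t) * Complex.I) * ψ (a * x) := by
      rw [h5, Complex.real_smul, ← mul_assoc, ← Complex.ofReal_mul, ha,
        inv_mul_cancel₀ hπ.ne', Complex.ofReal_one, one_mul]
    rw [h7, ← integral_const_mul]
    refine integral_congr_ae (Eventually.of_forall fun σ => ?_)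
    have h8 : 2 * Real.pi * (a * σ) * t = σ * t := by rw [ha]; field_simp
    simp only [h8]
    push_cast
    rw [mul_left_comm]
    congr 3
    ring

/-- The Fourier transform of a time cutoff that is `1` on `[0, 1]`. -/
def cutoffHat : ℝ → ℂ := exists_cutoff.choose

/-- The derivative of `cutoffHat`. -/
def cutoffHatDeriv : ℝ → ℂ := exists_cutoff.choose_spec.choose

theorem exists_cutoffHat_bound : ∃ C : ℝ, 0 < C ∧
    (∀ x, ‖cutoffHat x‖ ≤ C * (1 + x ^ 2)⁻¹) ∧ (∀ x, ‖cutoffHatDeriv x‖ ≤ C * (1 + x ^ 2)⁻¹) := by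
  obtain ⟨C, hC, -, -, h1, h2, -⟩ := exists_cutoff.choose_spec.choose_spec
  exact ⟨C, hC, h1, h2⟩

theorem continuous_cutoffHatDeriv : Continuous cutoffHatDeriv := by
  obtain ⟨C, hC, h, -⟩ := exists_cutoff.choose_spec.choose_spec
  exact h

theorem hasDerivAt_cutoffHat (x : ℝ) : HasDerivAt cutoffHat (cutoffHatDeriv x) x := by
  obtain ⟨C, hC, -, h, -⟩ := exists_cutoff.choose_spec.choose_spec
  exact h x

theorem continuous_cutoffHat : Continuous cutoffHat :=
  continuous_iff_continuousAt.mpr fun x => (hasDerivAt_cutoffHat x).continuousAt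

theorem integral_exp_mul_cutoffHat {t : ℝ} (ht : t ∈ Icc (0 : ℝ) 1) :
    ∫ σ : ℝ, Complex.exp (Complex.I * t * σ) * cutoffHat σ = 1 := by
  obtain ⟨C, hC, -, -, -, -, h⟩ := exists_cutoff.choose_spec.choose_spec
  exact h t ht

theorem integrable_of_norm_le_inv {f : ℝ → ℂ} (hf : Continuous f) {C : ℝ}
    (h : ∀ x, ‖f x‖ ≤ C * (1 + x ^ 2)⁻¹) : Integrable f :=
  (integrable_inv_one_add_sq.const_mul C).mono' hf.aestronglyMeasurable (Eventually.of_forall h)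

theorem integrable_cutoffHat : Integrable cutoffHat := by
  obtain ⟨C, -, h, -⟩ := exists_cutoffHat_bound
  exact integrable_of_norm_le_inv continuous_cutoffHat h

theorem integrable_cutoffHatDeriv : Integrable cutoffHatDeriv := by
  obtain ⟨C, -, -, h⟩ := exists_cutoffHat_bound
  exact integrable_of_norm_le_inv continuous_cutoffHatDeriv h

theorem norm_exp_I_mul (t σ : ℝ) : ‖Complex.exp (Complex.I * t * σ)‖ = 1 := by
  have : Complex.I * t * σ = ((t * σ : ℝ) : ℂ) * Complex.I := by push_cast; ring
  rw [this, Complex.norm_exp_ofReal_mul_I]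

theorem Integrable.exp_I_mul {f : ℝ → ℂ} (hf : Integrable f) (t : ℝ) :
    Integrable (fun σ : ℝ => Complex.exp (Complex.I * t * σ) * f σ) :=
  hf.bdd_mul (c := 1) (by fun_prop : Continuous fun σ : ℝ =>
    Complex.exp (Complex.I * t * σ)).aestronglyMeasurable
    (Eventually.of_forall fun σ => (norm_exp_I_mul t σ).le)

/-! ### The Duhamel kernel -/

/-- The Fourier transform in time of the cutoff of `t ↦ ∫₀ᵗ e^{iμt'} dt'`. -/
def duhamelKernel (σ μ : ℝ) : ℂ :=
  if μ = 0 then Complex.I * cutoffHatDeriv σ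
  else (cutoffHat (σ - μ) - cutoffHat σ) / (Complex.I * μ)

theorem measurable_duhamelKernel : Measurable (fun z : ℝ × ℝ => duhamelKernel z.1 z.2) := by
  unfold duhamelKernel
  have h1 := continuous_cutoffHat.measurable
  have h2 := continuous_cutoffHatDeriv.measurable
  refine Measurable.ite (measurable_snd (measurableSet_singleton 0)) ?_ ?_
  · fun_prop
  · fun_prop

/-- Integration by parts; it covers the removable singularity $\mu=0$ of the Duhamel kernel. -/
theorem integral_exp_mul_cutoffHatDeriv {t : ℝ} (ht : t ∈ Icc (0 : ℝ) 1) :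
    ∫ σ : ℝ, Complex.exp (Complex.I * t * σ) * cutoffHatDeriv σ = -(Complex.I * t) := by
  have hu : ∀ σ : ℝ, HasDerivAt (fun σ : ℝ => Complex.exp (Complex.I * t * σ))
      (Complex.I * t * Complex.exp (Complex.I * t * σ)) σ := by
    intro σ
    have h1 : HasDerivAt (fun σ : ℝ => Complex.I * t * (σ : ℂ)) (Complex.I * t) σ := by
      simpa using (Complex.ofRealCLM.hasDerivAt (x := σ)).const_mul (Complex.I * t)
    exact h1.cexp.congr_deriv (mul_comm _ _)
  rw [integral_mul_deriv_eq_deriv_mul_of_integrable (fun σ _ => hu σ)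
    (fun σ _ => hasDerivAt_cutoffHat σ) (Integrable.exp_I_mul integrable_cutoffHatDeriv t) ?_
    (Integrable.exp_I_mul integrable_cutoffHat t)]
  · have h3 : ∀ σ : ℝ, Complex.I * t * Complex.exp (Complex.I * t * σ) * cutoffHat σ =
        Complex.I * t * (Complex.exp (Complex.I * t * σ) * cutoffHat σ) := fun σ => by ring
    simp_rw [h3]
    rw [integral_const_mul, integral_exp_mul_cutoffHat ht, mul_one]
  · refine ((Integrable.exp_I_mul integrable_cutoffHat t).const_mul (Complex.I * t)).congr
      (Eventually.of_forall fun σ => ?_)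
    simp only [Pi.mul_apply]; ring

/-- Translation by $\mu$ on the Fourier side is multiplication by $e^{i\mu t}$, so the kernel
inverts to $(e^{i\mu t}-1)/(i\mu)$ where the cutoff is $1$. -/
theorem integral_exp_mul_duhamelKernel {t : ℝ} (ht : t ∈ Icc (0 : ℝ) 1) (μ : ℝ) :
    ∫ σ : ℝ, Complex.exp (Complex.I * t * σ) * duhamelKernel σ μ =
      ∫ t' in (0 : ℝ)..t, Complex.exp (Complex.I * μ * t') := by
  unfold duhamelKernel
  by_cases hμ : μ = 0
  · simp only [hμ, if_true]
    have h1 : ∀ σ : ℝ, Complex.exp (Complex.I * t * σ) * (Complex.I * cutoffHatDeriv σ) =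
        Complex.I * (Complex.exp (Complex.I * t * σ) * cutoffHatDeriv σ) := fun σ => by ring
    simp_rw [h1]
    rw [integral_const_mul, integral_exp_mul_cutoffHatDeriv ht]
    simp [← mul_assoc]
  · simp only [hμ, if_false]
    have hμ' : Complex.I * μ ≠ 0 := mul_ne_zero Complex.I_ne_zero (by exact_mod_cast hμ)
    rw [integral_exp_mul_complex hμ']
    have hi := integrable_cutoffHat
    have h1 : ∀ σ : ℝ, Complex.exp (Complex.I * t * σ) *
        ((cutoffHat (σ - μ) - cutoffHat σ) / (Complex.I * μ)) =
        (Complex.I * μ)⁻¹ * (Complex.exp (Complex.I * t * σ) * cutoffHat (σ - μ) -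
          Complex.exp (Complex.I * t * σ) * cutoffHat σ) := fun σ => by
      rw [div_eq_mul_inv]; ring
    simp_rw [h1]
    rw [integral_const_mul, integral_sub (Integrable.exp_I_mul (hi.comp_sub_right μ) t)
      (Integrable.exp_I_mul hi t), integral_exp_mul_cutoffHat ht]
    have h2 : ∫ σ : ℝ, Complex.exp (Complex.I * t * σ) * cutoffHat (σ - μ) =
        Complex.exp (Complex.I * μ * t) := by
      have h3 := integral_add_right_eq_self (μ := volume)
        (fun σ : ℝ => Complex.exp (Complex.I * t * σ) * cutoffHat (σ - μ)) μ
      rw [← h3]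
      have h4 : ∀ σ : ℝ, Complex.exp (Complex.I * t * ((σ + μ : ℝ) : ℂ)) *
          cutoffHat (σ + μ - μ) = Complex.exp (Complex.I * μ * t) *
          (Complex.exp (Complex.I * t * σ) * cutoffHat σ) := fun σ => by
        rw [add_sub_cancel_right, ← mul_assoc, ← Complex.exp_add]
        congr 2; push_cast; ring
      simp_rw [h4]
      rw [integral_const_mul, integral_exp_mul_cutoffHat ht, mul_one]
    rw [h2, Complex.ofReal_zero, mul_zero, Complex.exp_zero, div_eq_inv_mul]

/-- The one-dimensional bracket `⟨x⟩`. -/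
def jb (x : ℝ) : ℝ := √(1 + x ^ 2)

theorem jb_sq (x : ℝ) : jb x ^ 2 = 1 + x ^ 2 := Real.sq_sqrt (by positivity)

theorem one_le_jb (x : ℝ) : 1 ≤ jb x := by
  unfold jb; rw [Real.one_le_sqrt]; nlinarith [sq_nonneg x]

theorem jb_pos (x : ℝ) : 0 < jb x := lt_of_lt_of_le one_pos (one_le_jb x)

theorem continuous_jb : Continuous jb := by unfold jb; fun_prop

theorem jb_le {x A : ℝ} (hA : 0 ≤ A) (h : 1 + x ^ 2 ≤ A ^ 2) : jb x ≤ A :=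
  le_of_sq_le_sq (by rwa [jb_sq]) hA

theorem jb_add_le (x y : ℝ) : jb (x + y) ≤ 2 * (jb x * jb y) := by
  have h1 := jb_pos x
  have h2 := jb_pos y
  refine jb_le (by positivity) ?_
  rw [mul_pow, mul_pow, jb_sq, jb_sq]
  nlinarith [sq_nonneg (x - y), sq_nonneg (x * y), sq_nonneg x, sq_nonneg y]

/-- For $|\mu|\ge1$ the two terms are estimated separately. For $|\mu|<1$ the mean value inequality
compensates the denominator. -/
theorem exists_duhamelKernel_bound : ∃ C : ℝ, 0 < C ∧ ∀ σ μ : ℝ,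
    ‖duhamelKernel σ μ‖ ≤ C * (jb μ)⁻¹ * ((jb (σ - μ) ^ 2)⁻¹ + (jb σ ^ 2)⁻¹) := by
  obtain ⟨C, hC, h1, h2⟩ := exists_cutoffHat_bound
  refine ⟨6 * C, by positivity, fun σ μ => ?_⟩
  have hj := jb_pos μ
  rw [jb_sq, jb_sq]
  have hp1 : 0 < (1 + (σ - μ) ^ 2)⁻¹ := by positivity
  have hp2 : 0 < (1 + σ ^ 2)⁻¹ := by positivity
  unfold duhamelKernel
  by_cases hμ : μ = 0
  · have : jb 0 = 1 := by simp [jb]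
    rw [if_pos hμ, norm_mul, Complex.norm_I, one_mul, hμ, this, sub_zero, inv_one, mul_one]
    have := h2 σ
    nlinarith
  rw [if_neg hμ, norm_div, norm_mul, Complex.norm_I, one_mul, Complex.norm_real, Real.norm_eq_abs]
  have hμ0 : 0 < |μ| := abs_pos.mpr hμ
  rw [div_le_iff₀ hμ0]
  by_cases hμ1 : 1 ≤ |μ|
  · have h3 : jb μ ≤ 2 * |μ| := jb_le (by positivity) (by
      rw [mul_pow, sq_abs]; nlinarith [sq_abs μ])
    have h4 : 1 ≤ 2 * ((jb μ)⁻¹ * |μ|) := by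
      rw [← mul_assoc, mul_comm 2, mul_assoc, inv_mul_eq_div, one_le_div hj]; exact h3
    calc ‖cutoffHat (σ - μ) - cutoffHat σ‖ ≤ C * (1 + (σ - μ) ^ 2)⁻¹ + C * (1 + σ ^ 2)⁻¹ :=
          (norm_sub_le _ _).trans (add_le_add (h1 _) (h1 _))
      _ = C * ((1 + (σ - μ) ^ 2)⁻¹ + (1 + σ ^ 2)⁻¹) * 1 := by ring
      _ ≤ C * ((1 + (σ - μ) ^ 2)⁻¹ + (1 + σ ^ 2)⁻¹) * (6 * ((jb μ)⁻¹ * |μ|)) := by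
          gcongr; linarith
      _ = _ := by ring
  · push Not at hμ1
    have h3 : ∀ x ∈ uIcc σ (σ - μ), ‖cutoffHatDeriv x‖ ≤ 3 * C * (1 + σ ^ 2)⁻¹ := by
      intro x hx
      refine (h2 x).trans ?_
      have hx1 : |x - σ| ≤ 1 := by
        have := abs_sub_left_of_mem_uIcc hx
        rw [sub_sub_cancel_left, abs_neg] at this
        linarith
      have hx2 := abs_le.mp hx1
      rw [mul_comm 3 C, mul_assoc]
      gcongr
      rw [← div_eq_mul_inv, le_div_iff₀ (by positivity), inv_mul_le_iff₀ (by positivity)]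
      nlinarith [sq_nonneg (2 * x - σ), sq_nonneg (x - σ), sq_abs (x - σ), abs_nonneg (x - σ)]
    have h4 := Convex.norm_image_sub_le_of_norm_hasDerivWithin_le
      (fun x _ => (hasDerivAt_cutoffHat x).hasDerivWithinAt) h3 (convex_uIcc _ _)
      left_mem_uIcc right_mem_uIcc
    rw [sub_sub_cancel_left, norm_neg, Real.norm_eq_abs] at h4
    have h5 : jb μ ≤ 2 := jb_le (by norm_num) (by nlinarith [sq_abs μ])
    have h6 : 1 ≤ 2 * (jb μ)⁻¹ := by rw [← div_eq_mul_inv, one_le_div hj]; exact h5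
    calc _ ≤ 3 * C * (1 + σ ^ 2)⁻¹ * |μ| := h4
      _ = 3 * C * (1 + σ ^ 2)⁻¹ * |μ| * 1 := by ring
      _ ≤ 3 * C * ((1 + (σ - μ) ^ 2)⁻¹ + (1 + σ ^ 2)⁻¹) * |μ| * (2 * (jb μ)⁻¹) := by
          gcongr; linarith
      _ = _ := by ring

/-! ### The rescaled Duhamel kernel -/

/-- The Duhamel kernel with the time cutoff at scale `T`. -/
def duhamelKernelT (T σ μ : ℝ) : ℂ := (T : ℂ) ^ 2 * duhamelKernel (T * σ) (T * μ)

theorem measurable_duhamelKernelT (T : ℝ) :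
    Measurable (fun z : ℝ × ℝ => duhamelKernelT T z.1 z.2) := by
  unfold duhamelKernelT
  refine Measurable.const_mul ?_ _
  exact measurable_duhamelKernel.comp
    ((measurable_fst.const_mul T).prodMk (measurable_snd.const_mul T))

/-- The factor $T^2$ in the rescaled kernel pays for two changes of variables, one in $\sigma$ and
one in $t'$. -/
theorem integral_exp_mul_duhamelKernelT {T t : ℝ} (hT : 0 < T) (ht : t ∈ Icc (0 : ℝ) T) (μ : ℝ) :
    ∫ σ : ℝ, Complex.exp (Complex.I * t * σ) * duhamelKernelT T σ μ =
      ∫ t' in (0 : ℝ)..t, Complex.exp (Complex.I * μ * t') := by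
  have ht' : t / T ∈ Icc (0 : ℝ) 1 :=
    ⟨div_nonneg ht.1 hT.le, (div_le_one hT).mpr ht.2⟩
  have h1 := integral_exp_mul_duhamelKernel ht' (T * μ)
  have h2 := Measure.integral_comp_mul_left (fun σ : ℝ =>
    Complex.exp (Complex.I * (t / T : ℝ) * σ) * duhamelKernel σ (T * μ)) T
  have h3 := intervalIntegral.integral_comp_mul_left (a := 0) (b := t / T)
    (fun t' : ℝ => Complex.exp (Complex.I * μ * t')) hT.ne'
  have h4 : ∀ σ : ℝ, Complex.exp (Complex.I * t * σ) * duhamelKernelT T σ μ = (T : ℂ) ^ 2 *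
      (Complex.exp (Complex.I * (t / T : ℝ) * ((T * σ : ℝ) : ℂ)) *
        duhamelKernel (T * σ) (T * μ)) := by
    intro σ
    have hT' : (T : ℂ) ≠ 0 := by exact_mod_cast hT.ne'
    have h5 : Complex.I * (t / T : ℝ) * ((T * σ : ℝ) : ℂ) = Complex.I * t * σ := by
      push_cast; field_simp
    rw [h5, duhamelKernelT]; ring
  simp_rw [h4]
  rw [integral_const_mul, h2, h1]
  have h5 : ∀ t' : ℝ, Complex.exp (Complex.I * ((T * μ : ℝ) : ℂ) * t') =
      Complex.exp (Complex.I * μ * ((T * t' : ℝ) : ℂ)) := fun t' => by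
    congr 1; push_cast; ring
  simp_rw [h5]
  rw [h3, mul_zero, mul_div_cancel₀ _ hT.ne', abs_of_pos (inv_pos.mpr hT), smul_smul,
    Complex.real_smul]
  have hT' : (T : ℂ) ≠ 0 := by exact_mod_cast hT.ne'
  push_cast
  field_simp

/-- The output factor in the bound for the Duhamel kernel. -/
def schurA (γ T σ μ : ℝ) : ℝ := T * jb (T * (σ - μ)) ^ (-γ) + T * jb (T * σ) ^ (-γ)

/-- The input factor in the bound for the Duhamel kernel. -/
def schurB (γ T σ μ : ℝ) : ℝ := T * jb (T * (σ - μ)) ^ (-γ) + T * jb (T * μ) ^ (-γ)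

theorem jb_le_mul_jb {T σ : ℝ} (hT : 0 < T) (hT1 : T ≤ 1) : jb σ ≤ T⁻¹ * jb (T * σ) := by
  have := jb_pos (T * σ)
  refine jb_le (by positivity) ?_
  rw [mul_pow, jb_sq, mul_pow, mul_add, mul_one, ← mul_assoc, inv_pow,
    inv_mul_cancel₀ (by positivity), one_mul]
  have : 1 ≤ (T ^ 2)⁻¹ := one_le_inv_iff₀.mpr ⟨by positivity, pow_le_one₀ hT.le hT1⟩
  linarith

/-- The gain $T^{1-b}$ arises as $T^2\cdot T^{-b}\cdot T^{-1}$: the kernel carries $T^2$, rescaling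
$\langle\sigma\rangle^b$ costs $T^{-b}$, and one $T$ goes into the Schur weights to make their
integrals independent of $T$. -/
theorem exists_duhamelKernelT_bound {P Q b γ : ℝ} (hPQ : P.HolderConjugate Q) (hb : 0 ≤ b)
    (hb1 : b ≤ 1) (hγ0 : 0 ≤ γ) (hγb : γ ≤ 2 - b) (hγQ : γ ≤ Q) :
    ∃ C : ℝ, 0 < C ∧ ∀ T : ℝ, 0 < T → T ≤ 1 → ∀ σ μ : ℝ,
      jb σ ^ b * ‖duhamelKernelT T σ μ‖ ≤
        C * T ^ (1 - b) * (schurA γ T σ μ ^ P⁻¹ * schurB γ T σ μ ^ Q⁻¹) := by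
  obtain ⟨C, hC, hK⟩ := exists_duhamelKernel_bound
  refine ⟨3 * C, by positivity, fun T hT hT1 σ μ => ?_⟩
  have hP := hPQ.pos
  have hQ := hPQ.symm.pos
  have hPQ1 : P⁻¹ + Q⁻¹ = 1 := hPQ.inv_add_inv_eq_one
  set x := jb (T * σ) with hx
  set y := jb (T * μ) with hy
  set d := jb (T * (σ - μ)) with hd
  have hx1 : 1 ≤ x := one_le_jb _
  have hy1 : 1 ≤ y := one_le_jb _
  have hd1 : 1 ≤ d := one_le_jb _
  have hx0 : 0 < x := by linarith
  have hy0 : 0 < y := by linarith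
  have hd0 : 0 < d := by linarith
  have hxdy : x ≤ 2 * (d * y) := by
    have := jb_add_le (T * (σ - μ)) (T * μ)
    rwa [show T * (σ - μ) + T * μ = T * σ by ring] at this
  have hker : ‖duhamelKernelT T σ μ‖ ≤ T ^ 2 * (C * y⁻¹ * ((d ^ 2)⁻¹ + (x ^ 2)⁻¹)) := by
    rw [duhamelKernelT, norm_mul, norm_pow, Complex.norm_real, Real.norm_of_nonneg hT.le]
    have := hK (T * σ) (T * μ)
    rw [← mul_sub] at this
    gcongr
  have hσ : jb σ ^ b ≤ T ^ (-b) * x ^ b := by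
    rw [Real.rpow_neg hT.le, ← Real.inv_rpow hT.le, ← Real.mul_rpow (by positivity) hx0.le]
    exact Real.rpow_le_rpow (jb_pos σ).le (jb_le_mul_jb hT hT1) hb
  set A := schurA γ T σ μ with hA
  set B := schurB γ T σ μ with hB
  have hTd : 0 ≤ T * d ^ (-γ) := by positivity
  have hTx : 0 ≤ T * x ^ (-γ) := by positivity
  have hTy : 0 ≤ T * y ^ (-γ) := by positivity
  have hA0 : 0 ≤ A := add_nonneg hTd hTx
  have hB0 : 0 ≤ B := add_nonneg hTd hTy
  have hPi : 0 ≤ P⁻¹ := by positivity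
  have hQi : 0 ≤ Q⁻¹ := by positivity
  have hTT : T = T ^ P⁻¹ * T ^ Q⁻¹ := by rw [← Real.rpow_add hT, hPQ1, Real.rpow_one]
  have t1 : T * d ^ (-γ) ≤ A ^ P⁻¹ * B ^ Q⁻¹ := by
    have h1 : T * d ^ (-γ) = (T * d ^ (-γ)) ^ P⁻¹ * (T * d ^ (-γ)) ^ Q⁻¹ := by
      rw [← Real.rpow_add (by positivity), hPQ1, Real.rpow_one]
    rw [h1]
    gcongr
    · exact le_add_of_nonneg_right hTx
    · exact le_add_of_nonneg_right hTy
  -- Off the diagonal $\sigma\approx\mu$ the kernel splits as a product. The factor in $\mu$ decays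
  -- only like $\langle T\mu\rangle^{-1}$, which is the $1/Q$-th power of $\langle
  -- T\mu\rangle^{-\gamma}$ or better as long as $\gamma\le Q$.
  have t2 : T * (y⁻¹ * x ^ (b - 2)) ≤ A ^ P⁻¹ * B ^ Q⁻¹ := by
    have h1 : x ^ (b - 2) ≤ (x ^ (-γ)) ^ P⁻¹ := by
      rw [← Real.rpow_mul hx0.le]
      refine Real.rpow_le_rpow_of_exponent_le hx1 ?_
      have : γ * P⁻¹ ≤ γ * 1 := by gcongr; linarith
      linarith
    have h2 : y⁻¹ ≤ (y ^ (-γ)) ^ Q⁻¹ := by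
      rw [← Real.rpow_mul hy0.le, ← Real.rpow_neg_one]
      refine Real.rpow_le_rpow_of_exponent_le hy1 ?_
      have : γ * Q⁻¹ ≤ Q * Q⁻¹ := by gcongr
      rw [mul_inv_cancel₀ hQ.ne'] at this
      linarith
    calc T * (y⁻¹ * x ^ (b - 2)) ≤ T * ((y ^ (-γ)) ^ Q⁻¹ * (x ^ (-γ)) ^ P⁻¹) := by gcongr
      _ = (T * x ^ (-γ)) ^ P⁻¹ * (T * y ^ (-γ)) ^ Q⁻¹ := by
          rw [Real.mul_rpow hT.le (by positivity), Real.mul_rpow hT.le (by positivity)]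
          nth_rewrite 1 [hTT]
          ring
      _ ≤ _ := by
          gcongr
          · exact le_add_of_nonneg_left hTd
          · exact le_add_of_nonneg_left hTd
  -- Near the diagonal, $x\lesssim dy$ trades the growth $x^b$ for $d^by$; the factor $y$ is
  -- absorbed by $y^{-1}$.
  have s1 : x ^ b * y⁻¹ * (d ^ 2)⁻¹ ≤ 2 * d ^ (-γ) := by
    have h1 : x ^ b ≤ 2 * (d ^ b * y) := by
      calc x ^ b ≤ (2 * (d * y)) ^ b := Real.rpow_le_rpow hx0.le hxdy hb
        _ = 2 ^ b * (d ^ b * y ^ b) := by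
            rw [Real.mul_rpow (by norm_num) (by positivity), Real.mul_rpow hd0.le hy0.le]
        _ ≤ 2 ^ (1 : ℝ) * (d ^ b * y ^ (1 : ℝ)) := by
            gcongr
            norm_num
        _ = _ := by rw [Real.rpow_one, Real.rpow_one]
    have h2 : d ^ b * (d ^ 2)⁻¹ ≤ d ^ (-γ) := by
      rw [← Real.rpow_natCast d 2, ← Real.rpow_neg hd0.le, ← Real.rpow_add hd0]
      refine Real.rpow_le_rpow_of_exponent_le hd1 ?_
      push_cast; linarith
    calc x ^ b * y⁻¹ * (d ^ 2)⁻¹ ≤ 2 * (d ^ b * y) * y⁻¹ * (d ^ 2)⁻¹ := by gcongr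
      _ = 2 * (d ^ b * (d ^ 2)⁻¹) := by field_simp
      _ ≤ _ := by gcongr
  have s2 : x ^ b * y⁻¹ * (x ^ 2)⁻¹ = y⁻¹ * x ^ (b - 2) := by
    rw [Real.rpow_sub hx0, ← Real.rpow_natCast x 2]
    push_cast
    field_simp
  have hTb : T ^ (-b) * T ^ 2 = T ^ (1 - b) * T := by
    rw [← Real.rpow_natCast T 2, ← Real.rpow_add hT]
    nth_rewrite 3 [← Real.rpow_one T]
    rw [← Real.rpow_add hT]
    congr 1; push_cast; ring
  calc jb σ ^ b * ‖duhamelKernelT T σ μ‖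
      ≤ (T ^ (-b) * x ^ b) * (T ^ 2 * (C * y⁻¹ * ((d ^ 2)⁻¹ + (x ^ 2)⁻¹))) := by
        gcongr
    _ = C * (T ^ (-b) * T ^ 2) * (x ^ b * y⁻¹ * (d ^ 2)⁻¹ + x ^ b * y⁻¹ * (x ^ 2)⁻¹) := by ring
    _ ≤ C * (T ^ (1 - b) * T) * (2 * d ^ (-γ) + y⁻¹ * x ^ (b - 2)) := by
        rw [hTb, s2]
        gcongr
    _ = C * T ^ (1 - b) * (2 * (T * d ^ (-γ)) + T * (y⁻¹ * x ^ (b - 2))) := by ring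
    _ ≤ C * T ^ (1 - b) * (2 * (A ^ P⁻¹ * B ^ Q⁻¹) + A ^ P⁻¹ * B ^ Q⁻¹) := by gcongr
    _ = _ := by ring

theorem lintegral_jb_lt_top {γ : ℝ} (hγ : 1 < γ) :
    ∫⁻ x : ℝ, ENNReal.ofReal (jb x ^ (-γ)) < ⊤ := by
  have h1 : Integrable (fun x : ℝ => (1 + ‖x‖ ^ 2) ^ (-γ / 2)) :=
    integrable_rpow_neg_one_add_norm_sq (by simpa using hγ)
  have h2 : (fun x : ℝ => jb x ^ (-γ)) = fun x : ℝ => (1 + ‖x‖ ^ 2) ^ (-γ / 2) := by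
    funext x
    rw [Real.norm_eq_abs, sq_abs, jb, Real.sqrt_eq_rpow, ← Real.rpow_mul (by positivity)]
    congr 1; ring
  rw [← h2] at h1
  exact h1.lintegral_lt_top

theorem lintegral_scale {F : ℝ → ℝ≥0∞} (hF : Measurable F) {T : ℝ} (hT : 0 < T) (c : ℝ) :
    ∫⁻ x : ℝ, ENNReal.ofReal T * F (T * (x + c)) = ∫⁻ x, F x := by
  have h1 := lintegral_add_right_eq_self (μ := volume)
    (fun x : ℝ => ENNReal.ofReal T * F (T * x)) c
  rw [h1, lintegral_const_mul _ (by fun_prop)]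
  have h2 : ∫⁻ x, F x ∂(Measure.map (fun x : ℝ => T * x) volume) = ∫⁻ x, F (T * x) :=
    lintegral_map hF (by fun_prop)
  rw [← h2]
  conv_rhs => rw [← Real.smul_map_volume_mul_left hT.ne', abs_of_pos hT, lintegral_smul_measure]
  rfl

/-- The prefactor $T$ makes the mass scale invariant, so the Schur constants do not depend on $T$.
-/
theorem lintegral_jb_scale {γ T : ℝ} (hT : 0 < T) (c : ℝ) :
    ∫⁻ x : ℝ, ENNReal.ofReal (T * jb (T * (x + c)) ^ (-γ)) =
      ∫⁻ x : ℝ, ENNReal.ofReal (jb x ^ (-γ)) := by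
  rw [← lintegral_scale (F := fun x => ENNReal.ofReal (jb x ^ (-γ))) _ hT c]
  · refine lintegral_congr fun x => ?_
    rw [ENNReal.ofReal_mul hT.le]
  · have := continuous_jb.measurable
    fun_prop

/-- For $T\le1$ the function $x\mapsto\langle Tx\rangle$ varies by a bounded factor on unit
intervals, so the sum is comparable to the integral. -/
theorem tsum_jb_le {γ T : ℝ} (hγ : 0 ≤ γ) (hT : 0 < T) (hT1 : T ≤ 1) (x : ℝ) :
    ∑' m : ℤ, ENNReal.ofReal (T * jb (T * (x + m)) ^ (-γ)) ≤
      ENNReal.ofReal (4 ^ γ) * ∫⁻ x : ℝ, ENNReal.ofReal (jb x ^ (-γ)) := by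
  have hjm := continuous_jb.measurable
  have h1 : ∀ m : ℤ, ENNReal.ofReal (T * jb (T * (x + m)) ^ (-γ)) ≤
      ∫⁻ y in Ico (m : ℝ) (m + 1), ENNReal.ofReal (4 ^ γ) *
        ENNReal.ofReal (T * jb (T * (y + x)) ^ (-γ)) := by
    intro m
    have h2 : ENNReal.ofReal (T * jb (T * (x + m)) ^ (-γ)) =
        ∫⁻ y in Ico (m : ℝ) (m + 1), ENNReal.ofReal (T * jb (T * (x + m)) ^ (-γ)) := by
      rw [setLIntegral_const, Real.volume_Ico, add_sub_cancel_left, ENNReal.ofReal_one, mul_one]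
    rw [h2]
    refine setLIntegral_mono (by fun_prop) fun y hy => ?_
    rw [← ENNReal.ofReal_mul (by positivity)]
    refine ENNReal.ofReal_le_ofReal ?_
    have h3 : jb (T * (y + x)) ≤ 4 * jb (T * (x + m)) := by
      have h4 := jb_add_le (T * (x + m)) (T * (y - m))
      rw [show T * (x + m) + T * (y - m) = T * (y + x) by ring] at h4
      have h5 : jb (T * (y - m)) ≤ 2 := by
        refine jb_le (by norm_num) ?_
        have h6 : 0 ≤ T * (y - m) := mul_nonneg hT.le (by linarith [hy.1])
        have h7 : T * (y - m) ≤ 1 := mul_le_one₀ hT1 (by linarith [hy.1]) (by linarith [hy.2])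
        nlinarith
      have := jb_pos (T * (x + m))
      nlinarith
    have h8 : jb (T * (x + m)) ^ (-γ) ≤ 4 ^ γ * jb (T * (y + x)) ^ (-γ) := by
      have e : jb (T * (x + m)) ^ (-γ) = 4 ^ γ * (4 * jb (T * (x + m))) ^ (-γ) := by
        rw [Real.mul_rpow (by norm_num) (jb_pos _).le, ← mul_assoc, ← Real.rpow_add (by norm_num),
          add_neg_cancel, Real.rpow_zero, one_mul]
      rw [e]
      gcongr ?_ * ?_
      exact Real.rpow_le_rpow_of_nonpos (jb_pos _) h3 (by linarith)
    calc T * jb (T * (x + m)) ^ (-γ) ≤ T * (4 ^ γ * jb (T * (y + x)) ^ (-γ)) := by gcongr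
      _ = _ := by ring
  refine (ENNReal.tsum_le_tsum h1).trans ?_
  rw [← lintegral_iUnion (fun m => measurableSet_Ico) (pairwise_disjoint_Ico_intCast ℝ),
    iUnion_Ico_intCast, setLIntegral_univ, lintegral_const_mul _ (by fun_prop),
    lintegral_jb_scale hT x]

theorem lintegral_schurA {γ T : ℝ} (hT : 0 < T) (c μ : ℝ) :
    ∫⁻ τ : ℝ, ENNReal.ofReal (schurA γ T (τ + c) μ) =
      2 * ∫⁻ x : ℝ, ENNReal.ofReal (jb x ^ (-γ)) := by
  have hjm := continuous_jb.measurable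
  unfold schurA
  have h1 : ∀ τ : ℝ, ENNReal.ofReal (T * jb (T * (τ + c - μ)) ^ (-γ) + T * jb (T * (τ + c)) ^ (-γ))
      = ENNReal.ofReal (T * jb (T * (τ + (c - μ))) ^ (-γ)) +
        ENNReal.ofReal (T * jb (T * (τ + c)) ^ (-γ)) := fun τ => by
    have := jb_pos (T * (τ + (c - μ)))
    have := jb_pos (T * (τ + c))
    rw [add_sub_assoc, ENNReal.ofReal_add (by positivity) (by positivity)]
  simp_rw [h1]
  rw [lintegral_add_left (by fun_prop), lintegral_jb_scale hT, lintegral_jb_scale hT, two_mul]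

theorem jb_neg (x : ℝ) : jb (-x) = jb x := by simp [jb]

/-- The sum over all possible integer values of the resonance function, with the output modulation
$\sigma$ and the real shift $x$ fixed. -/
theorem tsum_schurB_le {γ T : ℝ} (hγ : 0 ≤ γ) (hT : 0 < T) (hT1 : T ≤ 1) (σ x : ℝ) :
    ∑' m : ℤ, ENNReal.ofReal (schurB γ T σ (x - m)) ≤
      2 * (ENNReal.ofReal (4 ^ γ) * ∫⁻ x : ℝ, ENNReal.ofReal (jb x ^ (-γ))) := by
  unfold schurB
  have h1 : ∀ m : ℤ, ENNReal.ofReal (T * jb (T * (σ - (x - m))) ^ (-γ) +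
      T * jb (T * (x - m)) ^ (-γ)) = ENNReal.ofReal (T * jb (T * ((σ - x) + m)) ^ (-γ)) +
        ENNReal.ofReal (T * jb (T * (-x + m)) ^ (-γ)) := fun m => by
    have := jb_pos (T * ((σ - x) + m))
    have := jb_pos (T * (x - m))
    rw [show σ - (x - m) = (σ - x) + m by ring,
      show T * (-x + m) = -(T * (x - m)) by ring, jb_neg,
      ENNReal.ofReal_add (by positivity) (by positivity)]
  simp_rw [h1]
  rw [ENNReal.tsum_add, two_mul]
  exact add_le_add (tsum_jb_le hγ hT hT1 _) (tsum_jb_le hγ hT hT1 _)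

theorem measurable_schurA (γ T : ℝ) : Measurable (fun z : ℝ × ℝ => schurA γ T z.1 z.2) := by
  have hjm := continuous_jb.measurable
  unfold schurA
  fun_prop

theorem measurable_schurB (γ T : ℝ) : Measurable (fun z : ℝ × ℝ => schurB γ T z.1 z.2) := by
  have hjm := continuous_jb.measurable
  unfold schurB
  fun_prop

/-! ### A Schur test for integral operators on `L^p` -/

section Schur

variable {Z Ω : Type*} [MeasurableSpace Z] [MeasurableSpace Ω]

/-- The bound `‖K‖ ≤ c a^{1/P} β^{1/Q}`, `∫ a dμ ≤ M₁`, `∫ β dν ≤ M₂` for an integral kernel. -/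
structure SchurBound (μ : Measure Z) (ν : Measure Ω) (P Q : ℝ) (K : Z → Ω → ℂ) (c M₁ M₂ : ℝ≥0∞)
    (a β : Z → Ω → ℝ≥0∞) : Prop where
  measurable_kernel : Measurable (Function.uncurry K)
  measurable_left : Measurable (Function.uncurry a)
  measurable_right : Measurable (Function.uncurry β)
  bound : ∀ z ω, ‖K z ω‖ₑ ≤ c * (a z ω ^ P⁻¹ * β z ω ^ Q⁻¹)
  left_le : ∀ ω, ∫⁻ z, a z ω ∂μ ≤ M₁
  right_le : ∀ z, ∫⁻ ω, β z ω ∂ν ≤ M₂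

variable {μ : Measure Z} {ν : Measure Ω} [SFinite μ] [SFinite ν] {P Q : ℝ} {K : Z → Ω → ℂ}
  {c M₁ M₂ : ℝ≥0∞} {a β : Z → Ω → ℝ≥0∞}

/-- Hölder in $\omega$ between $a^{1/P}|G|$ and $\beta^{1/Q}$, then Tonelli to integrate $a$ in $z$
first. Absolute values stay inside the integral so that Fubini can be justified later. -/
theorem SchurBound.lintegral_rpow_le (h : SchurBound μ ν P Q K c M₁ M₂ a β)
    (hPQ : P.HolderConjugate Q) {G : Ω → ℂ} (hG : AEStronglyMeasurable G ν) :
    ∫⁻ z, (∫⁻ ω, ‖K z ω‖ₑ * ‖G ω‖ₑ ∂ν) ^ P ∂μ ≤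
      (c * M₁ ^ P⁻¹ * M₂ ^ Q⁻¹) ^ P * ∫⁻ ω, ‖G ω‖ₑ ^ P ∂ν := by
  have hP := hPQ.pos
  have hQ := hPQ.symm.pos
  have hGm : AEMeasurable (fun ω => ‖G ω‖ₑ) ν := hG.enorm
  have h1 : ∀ z, (∫⁻ ω, ‖K z ω‖ₑ * ‖G ω‖ₑ ∂ν) ^ P ≤
      (c * M₂ ^ Q⁻¹) ^ P * ∫⁻ ω, a z ω * ‖G ω‖ₑ ^ P ∂ν := by
    intro z
    have ha : Measurable (a z) := h.measurable_left.comp measurable_prodMk_left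
    have hβ : Measurable (β z) := h.measurable_right.comp measurable_prodMk_left
    have h2 : ∫⁻ ω, ‖K z ω‖ₑ * ‖G ω‖ₑ ∂ν ≤
        c * ∫⁻ ω, (a z ω ^ P⁻¹ * ‖G ω‖ₑ) * β z ω ^ Q⁻¹ ∂ν := by
      rw [← lintegral_const_mul'' _ (by fun_prop)]
      refine lintegral_mono fun ω => ?_
      refine (mul_le_mul_left (h.bound z ω) _).trans (le_of_eq ?_)
      ring
    have h3 := ENNReal.lintegral_mul_le_Lp_mul_Lq ν hPQ
      (f := fun ω => a z ω ^ P⁻¹ * ‖G ω‖ₑ) (g := fun ω => β z ω ^ Q⁻¹) (by fun_prop) (by fun_prop)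
    have h4 : ∀ ω, (a z ω ^ P⁻¹ * ‖G ω‖ₑ) ^ P = a z ω * ‖G ω‖ₑ ^ P := fun ω => by
      rw [ENNReal.mul_rpow_of_nonneg _ _ hP.le, ENNReal.rpow_inv_rpow hP.ne']
    have h5 : ∀ ω, (β z ω ^ Q⁻¹) ^ Q = β z ω := fun ω => ENNReal.rpow_inv_rpow hQ.ne' _
    simp only [h4, h5, Pi.mul_apply, one_div] at h3
    have h6 : ∫⁻ ω, ‖K z ω‖ₑ * ‖G ω‖ₑ ∂ν ≤
        c * M₂ ^ Q⁻¹ * (∫⁻ ω, a z ω * ‖G ω‖ₑ ^ P ∂ν) ^ P⁻¹ := by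
      refine h2.trans ((mul_le_mul_right h3 _).trans ?_)
      rw [mul_assoc, mul_comm (M₂ ^ Q⁻¹)]
      gcongr
      exact h.right_le z
    refine (ENNReal.rpow_le_rpow h6 hP.le).trans (le_of_eq ?_)
    rw [ENNReal.mul_rpow_of_nonneg _ _ hP.le, ENNReal.rpow_inv_rpow hP.ne']
  refine (lintegral_mono h1).trans ?_
  have hjoint : AEMeasurable (Function.uncurry fun z ω => a z ω * ‖G ω‖ₑ ^ P) (μ.prod ν) := by
    refine h.measurable_left.aemeasurable.mul ?_
    exact (hGm.pow_const P).comp_quasiMeasurePreserving Measure.quasiMeasurePreserving_snd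
  have hinner : AEMeasurable (fun z => ∫⁻ ω, a z ω * ‖G ω‖ₑ ^ P ∂ν) μ :=
    hjoint.lintegral_prod_right'
  rw [lintegral_const_mul'' _ hinner, lintegral_lintegral_swap hjoint]
  have h7 : ∫⁻ ω, ∫⁻ z, a z ω * ‖G ω‖ₑ ^ P ∂μ ∂ν ≤ M₁ * ∫⁻ ω, ‖G ω‖ₑ ^ P ∂ν := by
    rw [← lintegral_const_mul'' _ (by fun_prop)]
    refine lintegral_mono fun ω => ?_
    have : Measurable fun z => a z ω := h.measurable_left.comp measurable_prodMk_right
    simp only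
    rw [lintegral_mul_const _ this]
    gcongr
    exact h.left_le ω
  refine (mul_le_mul_right h7 _).trans (le_of_eq ?_)
  rw [ENNReal.mul_rpow_of_nonneg _ _ hP.le, ENNReal.mul_rpow_of_nonneg _ _ hP.le,
    ENNReal.mul_rpow_of_nonneg _ _ hP.le, ENNReal.rpow_inv_rpow hP.ne']
  ring

variable {p : ℝ≥0∞}

theorem SchurBound.eLpNorm_le (h : SchurBound μ ν P Q K c M₁ M₂ a β)
    (hPQ : P.HolderConjugate Q) (hp : p = ENNReal.ofReal P) {G : Ω → ℂ}
    (hG : AEStronglyMeasurable G ν) :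
    eLpNorm (fun z => ∫ ω, K z ω * G ω ∂ν) p μ ≤ c * M₁ ^ P⁻¹ * M₂ ^ Q⁻¹ * eLpNorm G p ν := by
  have hP := hPQ.pos
  have hpP : p.toReal = P := by rw [hp, ENNReal.toReal_ofReal hP.le]
  have hp0 : p ≠ 0 := by rw [hp]; simpa using hP
  have hpt : p ≠ ⊤ := by rw [hp]; exact ENNReal.ofReal_ne_top
  rw [eLpNorm_eq_lintegral_rpow_enorm_toReal hp0 hpt,
    eLpNorm_eq_lintegral_rpow_enorm_toReal hp0 hpt, hpP]
  have h1 : ∫⁻ z, ‖∫ ω, K z ω * G ω ∂ν‖ₑ ^ P ∂μ ≤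
      (c * M₁ ^ P⁻¹ * M₂ ^ Q⁻¹) ^ P * ∫⁻ ω, ‖G ω‖ₑ ^ P ∂ν := by
    refine le_trans (lintegral_mono fun z => ?_) (h.lintegral_rpow_le hPQ hG)
    refine ENNReal.rpow_le_rpow ((enorm_integral_le_lintegral_enorm _).trans (le_of_eq ?_)) hP.le
    simp_rw [enorm_mul]
  refine (ENNReal.rpow_le_rpow h1 (by positivity : 0 ≤ 1 / P)).trans (le_of_eq ?_)
  rw [ENNReal.mul_rpow_of_nonneg _ _ (by positivity), one_div, ENNReal.rpow_rpow_inv hP.ne']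

/-- Needed for additivity of the operator, since the Bochner integral of a non-integrable function
is $0$ by convention. -/
theorem SchurBound.ae_integrable (h : SchurBound μ ν P Q K c M₁ M₂ a β)
    (hPQ : P.HolderConjugate Q) (hp : p = ENNReal.ofReal P) (hc : c ≠ ⊤) (hM₁ : M₁ ≠ ⊤)
    (hM₂ : M₂ ≠ ⊤) {G : Ω → ℂ} (hG : MemLp G p ν) :
    ∀ᵐ z ∂μ, Integrable (fun ω => K z ω * G ω) ν := by
  have hP := hPQ.pos
  have hpP : p.toReal = P := by rw [hp, ENNReal.toReal_ofReal hP.le]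
  have hp0 : p ≠ 0 := by rw [hp]; simpa using hP
  have hpt : p ≠ ⊤ := by rw [hp]; exact ENNReal.ofReal_ne_top
  have h1 := h.lintegral_rpow_le hPQ hG.1
  have h2 : ∫⁻ ω, ‖G ω‖ₑ ^ P ∂ν < ⊤ := by
    have := (eLpNorm_lt_top_iff_lintegral_rpow_enorm_lt_top hp0 hpt).mp hG.2
    rwa [hpP] at this
  have h3 : ∫⁻ z, (∫⁻ ω, ‖K z ω‖ₑ * ‖G ω‖ₑ ∂ν) ^ P ∂μ ≠ ⊤ := by
    refine (h1.trans_lt (ENNReal.mul_lt_top ?_ h2)).ne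
    refine ENNReal.rpow_lt_top_of_nonneg hP.le ?_
    have hQ := hPQ.symm.pos
    exact ENNReal.mul_ne_top (ENNReal.mul_ne_top hc
      (ENNReal.rpow_ne_top_of_nonneg (by positivity) hM₁))
      (ENNReal.rpow_ne_top_of_nonneg (by positivity) hM₂)
  have hKm := h.measurable_kernel
  have hjoint : AEMeasurable (Function.uncurry fun z ω => ‖K z ω‖ₑ * ‖G ω‖ₑ) (μ.prod ν) := by
    refine hKm.enorm.aemeasurable.mul ?_
    exact hG.1.enorm.comp_quasiMeasurePreserving Measure.quasiMeasurePreserving_snd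
  have hinner : AEMeasurable (fun z => ∫⁻ ω, ‖K z ω‖ₑ * ‖G ω‖ₑ ∂ν) μ :=
    hjoint.lintegral_prod_right'
  filter_upwards [ae_lt_top' (hinner.pow_const P) h3] with z hz
  refine ⟨(hKm.comp measurable_prodMk_left).aestronglyMeasurable.mul hG.1, ?_⟩
  rw [hasFiniteIntegral_iff_enorm]
  simp_rw [enorm_mul]
  exact (ENNReal.rpow_lt_top_iff_of_pos hP).mp hz

theorem SchurBound.exists_operator (h : SchurBound μ ν P Q K c M₁ M₂ a β)
    (hPQ : P.HolderConjugate Q) [Fact (1 ≤ p)] (hp : p = ENNReal.ofReal P) (hc : c ≠ ⊤)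
    (hM₁ : M₁ ≠ ⊤) (hM₂ : M₂ ≠ ⊤) :
    ∃ S : Lp ℂ p ν →L[ℂ] Lp ℂ p μ,
      (∀ G : Lp ℂ p ν, ∀ᵐ z ∂μ, S G z = ∫ ω, K z ω * G ω ∂ν) ∧
      ∀ G, ‖S G‖ ≤ (c * M₁ ^ P⁻¹ * M₂ ^ Q⁻¹).toReal * ‖G‖ := by
  have hP := hPQ.pos
  have hQ := hPQ.symm.pos
  have hCtop : c * M₁ ^ P⁻¹ * M₂ ^ Q⁻¹ ≠ ⊤ := ENNReal.mul_ne_top (ENNReal.mul_ne_top hc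
    (ENNReal.rpow_ne_top_of_nonneg (by positivity) hM₁))
    (ENNReal.rpow_ne_top_of_nonneg (by positivity) hM₂)
  have hmem : ∀ G : Lp ℂ p ν, MemLp (fun z => ∫ ω, K z ω * G ω ∂ν) p μ := by
    intro G
    refine ⟨?_, (h.eLpNorm_le hPQ hp (Lp.aestronglyMeasurable G)).trans_lt
      (ENNReal.mul_lt_top hCtop.lt_top (Lp.eLpNorm_lt_top G))⟩
    refine AEStronglyMeasurable.integral_prod_right' (f := fun x : Z × Ω => K x.1 x.2 * G x.2) ?_
    refine h.measurable_kernel.aestronglyMeasurable.mul ?_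
    exact (Lp.aestronglyMeasurable G).comp_quasiMeasurePreserving Measure.quasiMeasurePreserving_snd
  let S₀ : Lp ℂ p ν →ₗ[ℂ] Lp ℂ p μ :=
    { toFun := fun G => (hmem G).toLp _
      map_add' := fun G H => by
        ext1
        filter_upwards [(hmem (G + H)).coeFn_toLp, (hmem G).coeFn_toLp, (hmem H).coeFn_toLp,
          Lp.coeFn_add ((hmem G).toLp _) ((hmem H).toLp _),
          h.ae_integrable hPQ hp hc hM₁ hM₂ (Lp.memLp G),
          h.ae_integrable hPQ hp hc hM₁ hM₂ (Lp.memLp H)] with z h1 h2 h3 h4 h5 h6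
        rw [h1, h4, Pi.add_apply, h2, h3, ← integral_add h5 h6]
        refine integral_congr_ae ?_
        filter_upwards [Lp.coeFn_add G H] with ω hω
        rw [hω, Pi.add_apply, mul_add]
      map_smul' := fun k G => by
        ext1
        filter_upwards [(hmem (k • G)).coeFn_toLp, (hmem G).coeFn_toLp,
          Lp.coeFn_smul k ((hmem G).toLp _)] with z h1 h2 h3
        rw [h1, RingHom.id_apply, h3, Pi.smul_apply, h2, ← integral_smul]
        refine integral_congr_ae ?_
        filter_upwards [Lp.coeFn_smul k G] with ω hω
        rw [hω, Pi.smul_apply, smul_eq_mul, smul_eq_mul, mul_left_comm] }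
  have hbound : ∀ G, ‖S₀ G‖ ≤ (c * M₁ ^ P⁻¹ * M₂ ^ Q⁻¹).toReal * ‖G‖ := by
    intro G
    change ‖(hmem G).toLp _‖ ≤ _
    rw [Lp.norm_toLp, Lp.norm_def, ← ENNReal.toReal_mul]
    exact ENNReal.toReal_mono (ENNReal.mul_ne_top hCtop (Lp.eLpNorm_ne_top G))
      (h.eLpNorm_le hPQ hp (Lp.aestronglyMeasurable G))
  exact ⟨S₀.mkContinuous _ hbound, fun G => (hmem G).coeFn_toLp, hbound⟩

end Schur

/-! ### The trilinear Duhamel kernel -/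

/-- Triples of frequencies and of time frequencies. -/
abbrev TripleFreq : Type := (Freq × Freq × Freq) × (ℝ × ℝ × ℝ)

/-- Counting measure times Lebesgue measure. -/
abbrev tripleMeasure : Measure TripleFreq :=
  (Measure.count : Measure (Freq × Freq × Freq)).prod (volume : Measure (ℝ × ℝ × ℝ))

/-- The first space-time frequency. -/
def pr₁ (ω : TripleFreq) : Freq × ℝ := (ω.1.1, ω.2.1)

/-- The second space-time frequency. -/
def pr₂ (ω : TripleFreq) : Freq × ℝ := (ω.1.2.1, ω.2.2.1)

/-- The third space-time frequency. -/
def pr₃ (ω : TripleFreq) : Freq × ℝ := (ω.1.2.2, ω.2.2.2)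

theorem measurable_pr₁ : Measurable pr₁ := by unfold pr₁; fun_prop

theorem measurable_pr₂ : Measurable pr₂ := by unfold pr₂; fun_prop

theorem measurable_pr₃ : Measurable pr₃ := by unfold pr₃; fun_prop

/-- The interaction condition `n₁ - n₂ + n₃ = n`. -/
abbrev Interacts (n : Freq) (ν : Freq × Freq × Freq) : Prop := ν.1 - ν.2.1 + ν.2.2 = n

/-- The output modulation `τ₁ - τ₂ + τ₃ + |n|₋²`. -/
def modulation (n : Freq) (τ : ℝ × ℝ × ℝ) : ℝ := τ.1 - τ.2.1 + τ.2.2 + hypSq n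

/-- The kernel of the trilinear Duhamel operator between weighted spaces. -/
def trilinearKernel (s b T : ℝ) (z : Freq × ℝ) (ω : TripleFreq) : ℂ :=
  if Interacts z.1 ω.1 then
    duhamelKernelT T (z.2 + hypSq z.1) (modulation z.1 ω.2) *
      ((xWeight s b z / (xWeight s b (pr₁ ω) * xWeight s b (pr₂ ω) * xWeight s b (pr₃ ω)) : ℝ) : ℂ)
  else 0

/-- The Schur weight for the output. -/
def kernelA (γ T : ℝ) (z : Freq × ℝ) (ω : TripleFreq) : ℝ≥0∞ :=
  if Interacts z.1 ω.1 then
    ENNReal.ofReal (schurA γ T (z.2 + hypSq z.1) (modulation z.1 ω.2)) else 0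

/-- The modulation weights of the inputs. -/
def modWt (a : ℝ) (σ : ℝ × ℝ × ℝ) : ℝ≥0∞ :=
  ENNReal.ofReal (jb σ.1 ^ (-a)) *
    (ENNReal.ofReal (jb σ.2.1 ^ (-a)) * ENNReal.ofReal (jb σ.2.2 ^ (-a)))

/-- The modulations of the inputs. -/
def modShift (ν : Freq × Freq × Freq) : ℝ × ℝ × ℝ := (hypSq ν.1, hypSq ν.2.1, hypSq ν.2.2)

/-- The Schur weight for the inputs. -/
def kernelB (γ T r a : ℝ) (z : Freq × ℝ) (ω : TripleFreq) : ℝ≥0∞ :=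
  if Interacts z.1 ω.1 then
    ENNReal.ofReal (schurB γ T (z.2 + hypSq z.1) (modulation z.1 ω.2)) *
      (tripleWt r z.1 ω.1.1 ω.1.2.1 ω.1.2.2 * modWt a (ω.2 + modShift ω.1)) else 0

theorem measurable_hypSq : Measurable hypSq := measurable_of_countable _

theorem measurableSet_interacts :
    MeasurableSet {x : (Freq × ℝ) × TripleFreq | Interacts x.1.1 x.2.1} := by
  have h : Measurable (fun x : (Freq × ℝ) × TripleFreq => (x.1.1, x.2.1)) := by fun_prop
  exact h (Set.to_countable {y : Freq × (Freq × Freq × Freq) | Interacts y.1 y.2}).measurableSet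

theorem measurable_modulation :
    Measurable (fun x : (Freq × ℝ) × TripleFreq => modulation x.1.1 x.2.2) := by
  have := measurable_hypSq
  unfold modulation
  fun_prop

theorem measurable_sigma_modulation :
    Measurable (fun x : (Freq × ℝ) × TripleFreq =>
      (x.1.2 + hypSq x.1.1, modulation x.1.1 x.2.2)) := by
  have := measurable_hypSq
  have := measurable_modulation
  fun_prop

theorem measurable_xWeight_real (s b : ℝ) : Measurable (xWeight s b) := by
  have h := Complex.measurable_re.comp (measurable_xWeight s b)
  exact h

theorem measurable_trilinearKernel (s b T : ℝ) :
    Measurable (Function.uncurry (trilinearKernel s b T)) := by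
  unfold Function.uncurry trilinearKernel
  refine Measurable.ite measurableSet_interacts ?_ measurable_const
  have h1 := (measurable_duhamelKernelT T).comp measurable_sigma_modulation
  have h2 := measurable_xWeight_real s b
  have h3 := measurable_pr₁
  have h4 := measurable_pr₂
  have h5 := measurable_pr₃
  exact h1.mul (by fun_prop)

theorem measurable_kernelA (γ T : ℝ) : Measurable (Function.uncurry (kernelA γ T)) := by
  unfold Function.uncurry kernelA
  refine Measurable.ite measurableSet_interacts ?_ measurable_const
  exact ((measurable_schurA γ T).comp measurable_sigma_modulation).ennreal_ofReal

theorem measurable_modWt (a : ℝ) : Measurable (modWt a) := by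
  have := continuous_jb.measurable
  unfold modWt
  fun_prop

theorem measurable_tripleWt (r : ℝ) : Measurable (fun y : Freq × (Freq × Freq × Freq) =>
    tripleWt r y.1 y.2.1 y.2.2.1 y.2.2.2) :=
  measurable_of_countable _

theorem measurable_kernelB (γ T r a : ℝ) : Measurable (Function.uncurry (kernelB γ T r a)) := by
  unfold Function.uncurry kernelB
  refine Measurable.ite measurableSet_interacts ?_ measurable_const
  have h1 := ((measurable_schurB γ T).comp measurable_sigma_modulation).ennreal_ofReal
  have h2 : Measurable (fun x : (Freq × ℝ) × TripleFreq => (x.1.1, x.2.1)) := by fun_prop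
  have h3 : Measurable (fun x : (Freq × ℝ) × TripleFreq => x.2.2 + modShift x.2.1) := by
    have : Measurable modShift := measurable_of_countable _
    fun_prop
  have h4 := (measurable_tripleWt r).comp h2
  have h5 : Measurable (fun x : (Freq × ℝ) × TripleFreq => modWt a (x.2.2 + modShift x.2.1)) :=
    (measurable_modWt a).comp h3
  have h6 : Measurable (fun x : (Freq × ℝ) × TripleFreq =>
      tripleWt r x.1.1 x.2.1.1 x.2.1.2.1 x.2.1.2.2) := h4
  exact h1.mul (h6.mul h5)

/-- The triple of input frequencies determines $n$, so a single lattice point contributes. -/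
theorem lintegral_kernelA_le {γ T : ℝ} (hT : 0 < T) (ω : TripleFreq) :
    ∫⁻ z, kernelA γ T z ω ∂freqMeasure ≤ 2 * ∫⁻ x : ℝ, ENNReal.ofReal (jb x ^ (-γ)) := by
  have hm : Measurable fun z => kernelA γ T z ω :=
    (measurable_kernelA γ T).comp measurable_prodMk_right
  rw [lintegral_prod _ hm.aemeasurable, lintegral_count,
    tsum_eq_single (ω.1.1 - ω.1.2.1 + ω.1.2.2)]
  · simp only [kernelA, Interacts, if_true]
    rw [lintegral_schurA hT]
  · intro n hn
    have : ¬ Interacts n ω.1 := fun h => hn h.symm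
    simp [kernelA, this]

theorem lintegral_modWt (a : ℝ) :
    ∫⁻ σ, modWt a σ = (∫⁻ x : ℝ, ENNReal.ofReal (jb x ^ (-a))) *
      ((∫⁻ x : ℝ, ENNReal.ofReal (jb x ^ (-a))) * ∫⁻ x : ℝ, ENNReal.ofReal (jb x ^ (-a))) := by
  have hj := continuous_jb.measurable
  have hf : AEMeasurable (fun x : ℝ => ENNReal.ofReal (jb x ^ (-a))) volume := by fun_prop
  unfold modWt
  have h1 := lintegral_prod_mul (μ := (volume : Measure ℝ)) (ν := (volume : Measure (ℝ × ℝ))) hf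
    (g := fun y : ℝ × ℝ => ENNReal.ofReal (jb y.1 ^ (-a)) * ENNReal.ofReal (jb y.2 ^ (-a)))
    (by fun_prop)
  have h2 := lintegral_prod_mul (μ := (volume : Measure ℝ)) (ν := (volume : Measure ℝ)) hf hf
  rw [← h2]
  exact h1

/-- In recentred variables the frequencies enter the output modulation only through the integer
resonance function; this couples the time integral to the lattice count. -/
theorem modulation_sub_modShift {n : Freq} {ν : Freq × Freq × Freq} (σ : ℝ × ℝ × ℝ) :
    modulation n (σ - modShift ν) = (σ.1 - σ.2.1 + σ.2.2) - resonance n ν.1 ν.2.1 ν.2.2 := by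
  simp only [modulation, modShift, resonance, Prod.fst_sub, Prod.snd_sub]
  push_cast [hypZ_cast]
  ring

/-- The triples are fibred over the value of the resonance function, and each fibre obeys the
counting bound. -/
theorem tsum_resonance_le {r : ℝ} {C : ℝ≥0∞}
    (hC : ∀ (n : Freq) (m : ℤ), ∑' n₁ : Freq, ∑' n₃ : Freq,
      (if resonance n n₁ (n₁ + n₃ - n) n₃ = m then tripleWt r n n₁ (n₁ + n₃ - n) n₃ else 0) ≤ C)
    (F : ℤ → ℝ≥0∞) (n : Freq) :
    ∑' ν : Freq × Freq × Freq, (if Interacts n ν then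
      F (resonance n ν.1 ν.2.1 ν.2.2) * tripleWt r n ν.1 ν.2.1 ν.2.2 else 0) ≤
      (∑' m, F m) * C := by
  have h1 : ∑' ν : Freq × Freq × Freq, (if Interacts n ν then
      F (resonance n ν.1 ν.2.1 ν.2.2) * tripleWt r n ν.1 ν.2.1 ν.2.2 else 0) ≤
      ∑' q : Freq × Freq, F (resonance n q.1 (q.1 + q.2 - n) q.2) *
        tripleWt r n q.1 (q.1 + q.2 - n) q.2 := by
    refine tsum_le_tsum_of_injOn (fun ν => (ν.1, ν.2.2)) {ν | Interacts n ν} ?_ _ _ ?_ ?_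
    · rintro ⟨a, b, c⟩ h ⟨a', b', c'⟩ h' heq
      simp only [Prod.mk.injEq] at heq
      simp only [Interacts, mem_ofPred_eq] at h h'
      obtain ⟨rfl, rfl⟩ := heq
      have : b = b' := by
        have h2 : b = a + c - n := by rw [← h]; abel
        have h3 : b' = a + c - n := by rw [← h']; abel
        rw [h2, h3]
      rw [this]
    · intro ν hν
      have hν' : Interacts n ν := hν
      have h2 : ν.2.1 = ν.1 + ν.2.2 - n := by rw [← hν']; abel
      rw [if_pos hν', ← h2]
    · intro ν hν
      exact if_neg hν
  refine h1.trans ?_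
  rw [ENNReal.tsum_prod (f := fun n₁ n₃ => F (resonance n n₁ (n₁ + n₃ - n) n₃) *
        tripleWt r n n₁ (n₁ + n₃ - n) n₃)]
  have h2 : ∀ n₁ n₃ : Freq, F (resonance n n₁ (n₁ + n₃ - n) n₃) *
      tripleWt r n n₁ (n₁ + n₃ - n) n₃ = ∑' m : ℤ, F m *
        (if resonance n n₁ (n₁ + n₃ - n) n₃ = m then tripleWt r n n₁ (n₁ + n₃ - n) n₃ else 0) := by
    intro n₁ n₃
    rw [tsum_eq_single (resonance n n₁ (n₁ + n₃ - n) n₃) (fun m hm => by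
      rw [if_neg hm.symm, mul_zero]), if_pos rfl]
  have h3 : ∑' (n₁ : Freq) (n₃ : Freq), F (resonance n n₁ (n₁ + n₃ - n) n₃) *
      tripleWt r n n₁ (n₁ + n₃ - n) n₃ = ∑' m : ℤ, F m * ∑' (n₁ : Freq) (n₃ : Freq),
        (if resonance n n₁ (n₁ + n₃ - n) n₃ = m then tripleWt r n n₁ (n₁ + n₃ - n) n₃ else 0) := by
    simp_rw [h2, ← ENNReal.tsum_mul_left]
    rw [ENNReal.tsum_comm]
    conv_rhs => rw [ENNReal.tsum_comm]
    rw [ENNReal.tsum_comm]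
    refine tsum_congr fun n₁ => ?_
    rw [ENNReal.tsum_comm]
  rw [h3, ← ENNReal.tsum_mul_right]
  exact ENNReal.tsum_le_tsum fun m => mul_le_mul_right (hC n m) _

/-- After translation by `modShift` the modulation weights no longer depend on the frequencies. For
fixed $\sigma$ the lattice sum is then bounded uniformly, and the remaining integral is that of the
weights. -/
theorem lintegral_kernelB_le {γ T r a : ℝ} (hγ : 0 ≤ γ) (hT : 0 < T) (hT1 : T ≤ 1) {C : ℝ≥0∞}
    (hC : ∀ (n : Freq) (m : ℤ), ∑' n₁ : Freq, ∑' n₃ : Freq,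
      (if resonance n n₁ (n₁ + n₃ - n) n₃ = m then tripleWt r n n₁ (n₁ + n₃ - n) n₃ else 0) ≤ C)
    (z : Freq × ℝ) :
    ∫⁻ ω, kernelB γ T r a z ω ∂tripleMeasure ≤
      (2 * (ENNReal.ofReal (4 ^ γ) * ∫⁻ x : ℝ, ENNReal.ofReal (jb x ^ (-γ)))) * C *
        ∫⁻ σ, modWt a σ := by
  have hm : Measurable (kernelB γ T r a z) :=
    (measurable_kernelB γ T r a).comp measurable_prodMk_left
  set σ₀ := z.2 + hypSq z.1
  rw [lintegral_prod _ hm.aemeasurable, lintegral_count]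
  have hshift : ∀ ν : Freq × Freq × Freq, ∫⁻ τ : ℝ × ℝ × ℝ, kernelB γ T r a z (ν, τ) =
      ∫⁻ σ : ℝ × ℝ × ℝ, kernelB γ T r a z (ν, σ - modShift ν) := by
    intro ν
    have : (volume : Measure (ℝ × ℝ × ℝ)).IsAddLeftInvariant :=
      Measure.prod.instIsAddLeftInvariant (μ := (volume : Measure ℝ))
        (ν := (volume : Measure (ℝ × ℝ)))
    have h1 := lintegral_add_left_eq_self (μ := (volume : Measure (ℝ × ℝ × ℝ)))
      (fun τ => kernelB γ T r a z (ν, τ)) (-modShift ν)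
    simp_rw [neg_add_eq_sub] at h1
    exact h1.symm
  simp_rw [hshift]
  have hm' : ∀ ν : Freq × Freq × Freq,
      Measurable fun σ : ℝ × ℝ × ℝ => kernelB γ T r a z (ν, σ - modShift ν) := fun ν =>
    hm.comp (by fun_prop : Measurable fun σ : ℝ × ℝ × ℝ => (ν, σ - modShift ν))
  rw [← lintegral_tsum (fun ν => (hm' ν).aemeasurable),
    ← lintegral_const_mul _ (measurable_modWt a)]
  refine lintegral_mono fun σ => ?_
  have h1 : ∀ ν : Freq × Freq × Freq, kernelB γ T r a z (ν, σ - modShift ν) =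
      modWt a σ * (if Interacts z.1 ν then ENNReal.ofReal (schurB γ T σ₀
        ((σ.1 - σ.2.1 + σ.2.2) - resonance z.1 ν.1 ν.2.1 ν.2.2)) *
        tripleWt r z.1 ν.1 ν.2.1 ν.2.2 else 0) := by
    intro ν
    unfold kernelB
    by_cases hν : Interacts z.1 ν
    · rw [if_pos hν, if_pos hν, modulation_sub_modShift, sub_add_cancel]
      ring
    · rw [if_neg hν, if_neg hν, mul_zero]
  simp_rw [h1]
  rw [ENNReal.tsum_mul_left, mul_comm]
  refine mul_le_mul_left ?_ _
  refine (tsum_resonance_le hC (fun m => ENNReal.ofReal (schurB γ T σ₀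
    ((σ.1 - σ.2.1 + σ.2.2) - m))) z.1).trans ?_
  exact mul_le_mul_left (tsum_schurB_le hγ hT hT1 _ _) _

theorem xWeight_eq (s b : ℝ) (z : Freq × ℝ) :
    xWeight s b z = bracket z.1 ^ s * jb (z.2 + hypSq z.1) ^ b := rfl

/-- The input weights occur in `kernelB` to the power $Q$, so that its power $1/Q$ restores them.
Hence the exponents $sQ$ and $bQ$, both of which must exceed $1$. -/
theorem enorm_trilinearKernel_le {P Q b γ s C T : ℝ} (hPQ : P.HolderConjugate Q) (hC : 0 < C)
    (hT : 0 < T)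
    (hK : ∀ σ μ : ℝ, jb σ ^ b * ‖duhamelKernelT T σ μ‖ ≤
        C * T ^ (1 - b) * (schurA γ T σ μ ^ P⁻¹ * schurB γ T σ μ ^ Q⁻¹))
    (z : Freq × ℝ) (ω : TripleFreq) :
    ‖trilinearKernel s b T z ω‖ₑ ≤ ENNReal.ofReal (C * T ^ (1 - b)) *
      (kernelA γ T z ω ^ P⁻¹ * kernelB γ T (s * Q) (b * Q) z ω ^ Q⁻¹) := by
  have hP := hPQ.pos
  have hQ := hPQ.symm.pos
  unfold trilinearKernel kernelA kernelB
  by_cases h : Interacts z.1 ω.1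
  swap
  · rw [if_neg h]; simp
  rw [if_pos h, if_pos h, if_pos h]
  set σ := z.2 + hypSq z.1 with hσ
  set μ := modulation z.1 ω.2 with hμ
  have b0 := bracket_pos z.1
  have b1 := bracket_pos ω.1.1
  have b2 := bracket_pos ω.1.2.1
  have b3 := bracket_pos ω.1.2.2
  set σ₁ := ω.2.1 + hypSq ω.1.1 with hσ₁
  set σ₂ := ω.2.2.1 + hypSq ω.1.2.1 with hσ₂
  set σ₃ := ω.2.2.2 + hypSq ω.1.2.2 with hσ₃
  have j0 := jb_pos σ
  have j1 := jb_pos σ₁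
  have j2 := jb_pos σ₂
  have j3 := jb_pos σ₃
  have hA0 : 0 ≤ schurA γ T σ μ := by
    have := jb_pos (T * (σ - μ)); have := jb_pos (T * σ)
    unfold schurA; positivity
  have hB0 : 0 ≤ schurB γ T σ μ := by
    have := jb_pos (T * (σ - μ)); have := jb_pos (T * μ)
    unfold schurB; positivity
  have hmod : modWt (b * Q) (ω.2 + modShift ω.1) = ENNReal.ofReal (jb σ₁ ^ (-(b * Q)) *
      (jb σ₂ ^ (-(b * Q)) * jb σ₃ ^ (-(b * Q)))) := by
    rw [ENNReal.ofReal_mul (by positivity), ENNReal.ofReal_mul (by positivity)]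
    rfl
  rw [hmod, tripleWt, ← ENNReal.ofReal_mul (by positivity), ← ENNReal.ofReal_mul hB0,
    ENNReal.ofReal_rpow_of_nonneg hA0 (by positivity),
    ENNReal.ofReal_rpow_of_nonneg (by positivity) (by positivity),
    ← ENNReal.ofReal_mul (by positivity), ← ENNReal.ofReal_mul (by positivity),
    ← ofReal_norm]
  refine ENNReal.ofReal_le_ofReal ?_
  have hV : ((bracket z.1 / (bracket ω.1.1 * bracket ω.1.2.1 * bracket ω.1.2.2)) ^ (s * Q) *
      (jb σ₁ ^ (-(b * Q)) * (jb σ₂ ^ (-(b * Q)) * jb σ₃ ^ (-(b * Q))))) ^ Q⁻¹ =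
      bracket z.1 ^ s / (xWeight s b (pr₁ ω) * xWeight s b (pr₂ ω) * xWeight s b (pr₃ ω)) := by
    have hx : ∀ {x : ℝ}, 0 < x → (x ^ (-(b * Q))) ^ Q⁻¹ = (x ^ b)⁻¹ := fun {x} hx => by
      rw [← Real.rpow_mul hx.le, ← Real.rpow_neg hx.le]
      congr 1; field_simp
    have e1 : ((bracket z.1 / (bracket ω.1.1 * bracket ω.1.2.1 * bracket ω.1.2.2)) ^ (s * Q)) ^ Q⁻¹
        = bracket z.1 ^ s / (bracket ω.1.1 ^ s * bracket ω.1.2.1 ^ s * bracket ω.1.2.2 ^ s) := by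
      rw [← Real.rpow_mul (by positivity), mul_assoc s, mul_inv_cancel₀ hQ.ne', mul_one,
        Real.div_rpow b0.le (by positivity), Real.mul_rpow (by positivity) b3.le,
        Real.mul_rpow b1.le b2.le]
    rw [Real.mul_rpow (by positivity) (by positivity), e1, Real.mul_rpow (by positivity)
      (by positivity), Real.mul_rpow (by positivity) (by positivity), hx j1, hx j2, hx j3]
    simp only [xWeight_eq, pr₁, pr₂, pr₃]
    rw [← hσ₁, ← hσ₂, ← hσ₃]
    field_simp
  rw [Real.mul_rpow hB0 (by positivity), hV]
  have hW : 0 < xWeight s b (pr₁ ω) * xWeight s b (pr₂ ω) * xWeight s b (pr₃ ω) :=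
    mul_pos (mul_pos (xWeight_pos _ _ _) (xWeight_pos _ _ _)) (xWeight_pos _ _ _)
  rw [norm_mul, Complex.norm_real, Real.norm_of_nonneg (div_nonneg (xWeight_pos _ _ _).le hW.le),
    xWeight_eq s b z, ← hσ]
  set W := xWeight s b (pr₁ ω) * xWeight s b (pr₂ ω) * xWeight s b (pr₃ ω)
  calc ‖duhamelKernelT T σ μ‖ * (bracket z.1 ^ s * jb σ ^ b / W)
      = (jb σ ^ b * ‖duhamelKernelT T σ μ‖) * (bracket z.1 ^ s / W) := by ring
    _ ≤ (C * T ^ (1 - b) * (schurA γ T σ μ ^ P⁻¹ * schurB γ T σ μ ^ Q⁻¹)) *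
        (bracket z.1 ^ s / W) := by
        refine mul_le_mul_of_nonneg_right (hK σ μ) ?_
        positivity
    _ = _ := by ring

/-- The trilinear kernel satisfies the Schur test, with a constant that is small for small `T`. -/
theorem exists_schurBound_trilinearKernel {P Q b s : ℝ} (hPQ : P.HolderConjugate Q)
    (hb : 0 ≤ b) (hb1 : b < 1) (hbQ : 1 < b * Q) (hs : 1 < s * Q) :
    ∃ (γ C : ℝ) (M₁ M₂ : ℝ≥0∞), 0 < C ∧ M₁ ≠ ⊤ ∧ M₂ ≠ ⊤ ∧ ∀ T : ℝ, 0 < T → T ≤ 1 →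
      SchurBound freqMeasure tripleMeasure P Q (trilinearKernel s b T)
        (ENNReal.ofReal (C * T ^ (1 - b))) M₁ M₂ (kernelA γ T)
        (kernelB γ T (s * Q) (b * Q)) := by
  have hQ1 : 1 < Q := hPQ.symm.lt
  -- The largest exponent permitted by the kernel bound; it exceeds $1$ because $b<1$ and $Q>1$.
  set γ := min (2 - b) Q with hγ
  have hγ1 : 1 < γ := lt_min (by linarith) hQ1
  obtain ⟨C, hC, hK⟩ := exists_duhamelKernelT_bound (γ := γ) hPQ hb hb1.le (by linarith)
    (min_le_left _ _) (min_le_right _ _)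
  obtain ⟨C', hC', hcount⟩ := exists_counting_bound hs
  have hJ := lintegral_jb_lt_top hγ1
  have hJb := lintegral_jb_lt_top hbQ
  refine ⟨γ, C, 2 * ∫⁻ x : ℝ, ENNReal.ofReal (jb x ^ (-γ)),
    (2 * (ENNReal.ofReal (4 ^ γ) * ∫⁻ x : ℝ, ENNReal.ofReal (jb x ^ (-γ)))) * C' *
        ∫⁻ σ, modWt (b * Q) σ, hC, ?_, ?_, fun T hT hT1 => ?_⟩
  · exact (ENNReal.mul_lt_top ENNReal.ofNat_lt_top hJ).ne
  · rw [lintegral_modWt]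
    exact (ENNReal.mul_lt_top (ENNReal.mul_lt_top (ENNReal.mul_lt_top ENNReal.ofNat_lt_top
      (ENNReal.mul_lt_top ENNReal.ofReal_lt_top hJ)) hC')
      (ENNReal.mul_lt_top hJb (ENNReal.mul_lt_top hJb hJb))).ne
  · exact
      { measurable_kernel := measurable_trilinearKernel s b T
        measurable_left := measurable_kernelA γ T
        measurable_right := measurable_kernelB γ T _ _
        bound := enorm_trilinearKernel_le hPQ hC hT (hK T hT hT1)
        left_le := lintegral_kernelA_le hT
        right_le := lintegral_kernelB_le (by linarith) hT hT1 hcount }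

/-! ### Tensor products of `L^p` functions -/

/-- The projections of a triple to one frequency have infinite fibres and do not preserve measure.
Preserving null sets is enough to pull back almost-everywhere classes. -/
theorem quasiMeasurePreserving_count {α β : Type*} [MeasurableSpace α] [MeasurableSpace β]
    [MeasurableSingletonClass α] [MeasurableSingletonClass β] [Countable α] (f : α → β) :
    Measure.QuasiMeasurePreserving f (Measure.count : Measure α) (Measure.count : Measure β) := by
  refine ⟨measurable_of_countable f, Measure.AbsolutelyContinuous.mk fun s hs h0 => ?_⟩
  rw [Measure.map_apply (measurable_of_countable f) hs, Measure.count_eq_zero_iff]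
  rw [Measure.count_eq_zero_iff] at h0
  rw [h0, preimage_empty]

theorem quasiMeasurePreserving_pr₁ :
    Measure.QuasiMeasurePreserving pr₁ tripleMeasure freqMeasure :=
  QuasiMeasurePreserving.prodMap (quasiMeasurePreserving_count fun ν : Freq × Freq × Freq => ν.1)
    (Measure.quasiMeasurePreserving_fst (μ := (volume : Measure ℝ))
      (ν := (volume : Measure (ℝ × ℝ))))

theorem quasiMeasurePreserving_pr₂ :
    Measure.QuasiMeasurePreserving pr₂ tripleMeasure freqMeasure :=
  QuasiMeasurePreserving.prodMap (quasiMeasurePreserving_count fun ν : Freq × Freq × Freq => ν.2.1)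
    ((Measure.quasiMeasurePreserving_fst (μ := (volume : Measure ℝ))
      (ν := (volume : Measure ℝ))).comp
      (Measure.quasiMeasurePreserving_snd (μ := (volume : Measure ℝ))
        (ν := (volume : Measure (ℝ × ℝ)))))

theorem quasiMeasurePreserving_pr₃ :
    Measure.QuasiMeasurePreserving pr₃ tripleMeasure freqMeasure :=
  QuasiMeasurePreserving.prodMap (quasiMeasurePreserving_count fun ν : Freq × Freq × Freq => ν.2.2)
    ((Measure.quasiMeasurePreserving_snd (μ := (volume : Measure ℝ))
      (ν := (volume : Measure ℝ))).comp
      (Measure.quasiMeasurePreserving_snd (μ := (volume : Measure ℝ))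
        (ν := (volume : Measure (ℝ × ℝ)))))

/-- The function `f₁(z₁) conj(f₂(z₂)) f₃(z₃)`. -/
def tensor (f₁ f₂ f₃ : Freq × ℝ → ℂ) (ω : TripleFreq) : ℂ :=
  f₁ (pr₁ ω) * (starRingEnd ℂ) (f₂ (pr₂ ω)) * f₃ (pr₃ ω)

theorem aestronglyMeasurable_tensor {f₁ f₂ f₃ : Freq × ℝ → ℂ}
    (h₁ : AEStronglyMeasurable f₁ freqMeasure) (h₂ : AEStronglyMeasurable f₂ freqMeasure)
    (h₃ : AEStronglyMeasurable f₃ freqMeasure) :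
    AEStronglyMeasurable (tensor f₁ f₂ f₃) tripleMeasure :=
  ((h₁.comp_quasiMeasurePreserving quasiMeasurePreserving_pr₁).mul
    (Complex.continuous_conj.comp_aestronglyMeasurable
      (h₂.comp_quasiMeasurePreserving quasiMeasurePreserving_pr₂))).mul
    (h₃.comp_quasiMeasurePreserving quasiMeasurePreserving_pr₃)

theorem lintegral_triple_mul {F₁ F₂ F₃ : Freq × ℝ → ℝ≥0∞} (h₁ : AEMeasurable F₁ freqMeasure)
    (h₂ : AEMeasurable F₂ freqMeasure) (h₃ : AEMeasurable F₃ freqMeasure) :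
    ∫⁻ ω, F₁ (pr₁ ω) * (F₂ (pr₂ ω) * F₃ (pr₃ ω)) ∂tripleMeasure =
      (∫⁻ z, F₁ z ∂freqMeasure) * ((∫⁻ z, F₂ z ∂freqMeasure) * ∫⁻ z, F₃ z ∂freqMeasure) := by
  have hm : AEMeasurable (fun ω => F₁ (pr₁ ω) * (F₂ (pr₂ ω) * F₃ (pr₃ ω))) tripleMeasure :=
    (h₁.comp_quasiMeasurePreserving quasiMeasurePreserving_pr₁).mul
      ((h₂.comp_quasiMeasurePreserving quasiMeasurePreserving_pr₂).mul
      (h₃.comp_quasiMeasurePreserving quasiMeasurePreserving_pr₃))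
  have hs : ∀ {F : Freq × ℝ → ℝ≥0∞}, AEMeasurable F freqMeasure →
      ∀ n, AEMeasurable (fun τ : ℝ => F (n, τ)) := fun {F} hF n =>
    (hF.mono_measure (map_slice_le n)).comp_measurable measurable_prodMk_left
  rw [lintegral_prod _ hm, lintegral_count, lintegral_prod _ h₁, lintegral_prod _ h₂,
    lintegral_prod _ h₃, lintegral_count, lintegral_count, lintegral_count]
  have h4 : ∀ ν : Freq × Freq × Freq, ∫⁻ τ : ℝ × ℝ × ℝ,
      F₁ (pr₁ (ν, τ)) * (F₂ (pr₂ (ν, τ)) * F₃ (pr₃ (ν, τ))) =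
      (∫⁻ τ, F₁ (ν.1, τ)) * ((∫⁻ τ, F₂ (ν.2.1, τ)) * ∫⁻ τ, F₃ (ν.2.2, τ)) := by
    intro ν
    have e2 := lintegral_prod_mul (μ := (volume : Measure ℝ)) (ν := (volume : Measure ℝ))
      (hs h₂ ν.2.1) (hs h₃ ν.2.2)
    have e1 := lintegral_prod_mul (μ := (volume : Measure ℝ)) (ν := (volume : Measure (ℝ × ℝ)))
      (hs h₁ ν.1) (g := fun y : ℝ × ℝ => F₂ (ν.2.1, y.1) * F₃ (ν.2.2, y.2))
      (((hs h₂ ν.2.1).comp_quasiMeasurePreserving Measure.quasiMeasurePreserving_fst).mul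
        ((hs h₃ ν.2.2).comp_quasiMeasurePreserving Measure.quasiMeasurePreserving_snd))
    rw [← e2]
    exact e1
  simp_rw [h4]
  rw [ENNReal.tsum_prod (f := fun n (ν : Freq × Freq) =>
    (∫⁻ τ, F₁ (n, τ)) * ((∫⁻ τ, F₂ (ν.1, τ)) * ∫⁻ τ, F₃ (ν.2, τ)))]
  simp_rw [ENNReal.tsum_mul_left]
  rw [ENNReal.tsum_mul_right]
  congr 1
  rw [ENNReal.tsum_prod (f := fun n m => (∫⁻ τ, F₂ (n, τ)) * ∫⁻ τ, F₃ (m, τ))]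
  simp_rw [ENNReal.tsum_mul_left]
  rw [ENNReal.tsum_mul_right]

/-- Multiplicativity of the $L^p$ norm on tensors is what turns the trilinear estimate into a linear
one. -/
theorem eLpNorm_tensor {p : ℝ≥0∞} (hp0 : p ≠ 0) (hpt : p ≠ ⊤) {f₁ f₂ f₃ : Freq × ℝ → ℂ}
    (h₁ : AEStronglyMeasurable f₁ freqMeasure) (h₂ : AEStronglyMeasurable f₂ freqMeasure)
    (h₃ : AEStronglyMeasurable f₃ freqMeasure) :
    eLpNorm (tensor f₁ f₂ f₃) p tripleMeasure =
      eLpNorm f₁ p freqMeasure * (eLpNorm f₂ p freqMeasure * eLpNorm f₃ p freqMeasure) := by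
  simp_rw [eLpNorm_eq_lintegral_rpow_enorm_toReal hp0 hpt]
  rw [← ENNReal.mul_rpow_of_nonneg _ _ (by positivity),
    ← ENNReal.mul_rpow_of_nonneg _ _ (by positivity),
    ← lintegral_triple_mul (h₁.enorm.pow_const _) (h₂.enorm.pow_const _) (h₃.enorm.pow_const _)]
  congr 1
  refine lintegral_congr fun ω => ?_
  rw [tensor, enorm_mul, enorm_mul, RCLike.enorm_conj, ENNReal.mul_rpow_of_nonneg _ _
    ENNReal.toReal_nonneg, ENNReal.mul_rpow_of_nonneg _ _ ENNReal.toReal_nonneg, mul_assoc]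

theorem memLp_tensor {p : ℝ≥0∞} (hp0 : p ≠ 0) (hpt : p ≠ ⊤) (g₁ g₂ g₃ : Lp ℂ p freqMeasure) :
    MemLp (tensor g₁ g₂ g₃) p tripleMeasure := by
  have h₁ := Lp.memLp g₁
  have h₂ := Lp.memLp g₂
  have h₃ := Lp.memLp g₃
  refine ⟨aestronglyMeasurable_tensor h₁.1 h₂.1 h₃.1, ?_⟩
  rw [eLpNorm_tensor hp0 hpt h₁.1 h₂.1 h₃.1]
  exact ENNReal.mul_lt_top h₁.2 (ENNReal.mul_lt_top h₂.2 h₃.2)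

/-- The element `g₁ ⊗ conj g₂ ⊗ g₃` of `L^p`. -/
def tensorLp {p : ℝ≥0∞} (hp0 : p ≠ 0) (hpt : p ≠ ⊤) (g₁ g₂ g₃ : Lp ℂ p freqMeasure) :
    Lp ℂ p tripleMeasure :=
  (memLp_tensor hp0 hpt g₁ g₂ g₃).toLp _

section tensorLp

variable {p : ℝ≥0∞} (hp0 : p ≠ 0) (hpt : p ≠ ⊤)

theorem coeFn_tensorLp (g₁ g₂ g₃ : Lp ℂ p freqMeasure) :
    tensorLp hp0 hpt g₁ g₂ g₃ =ᵐ[tripleMeasure] tensor g₁ g₂ g₃ :=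
  MemLp.coeFn_toLp _

theorem norm_tensorLp (g₁ g₂ g₃ : Lp ℂ p freqMeasure) :
    ‖tensorLp hp0 hpt g₁ g₂ g₃‖ = ‖g₁‖ * ‖g₂‖ * ‖g₃‖ := by
  rw [tensorLp, Lp.norm_toLp, eLpNorm_tensor hp0 hpt (Lp.memLp g₁).1 (Lp.memLp g₂).1
    (Lp.memLp g₃).1, ENNReal.toReal_mul, ENNReal.toReal_mul, mul_assoc]
  rfl

theorem tensorLp_add₁ (g h g₂ g₃ : Lp ℂ p freqMeasure) :
    tensorLp hp0 hpt (g + h) g₂ g₃ = tensorLp hp0 hpt g g₂ g₃ + tensorLp hp0 hpt h g₂ g₃ := by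
  ext1
  filter_upwards [coeFn_tensorLp hp0 hpt (g + h) g₂ g₃, coeFn_tensorLp hp0 hpt g g₂ g₃,
    coeFn_tensorLp hp0 hpt h g₂ g₃, Lp.coeFn_add (tensorLp hp0 hpt g g₂ g₃)
    (tensorLp hp0 hpt h g₂ g₃), quasiMeasurePreserving_pr₁.ae (Lp.coeFn_add g h)]
    with ω h1 h2 h3 h4 h5
  rw [h1, h4, Pi.add_apply, h2, h3]
  simp only [tensor, h5, Pi.add_apply]; ring

theorem tensorLp_add₂ (g₁ g h g₃ : Lp ℂ p freqMeasure) :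
    tensorLp hp0 hpt g₁ (g + h) g₃ = tensorLp hp0 hpt g₁ g g₃ + tensorLp hp0 hpt g₁ h g₃ := by
  ext1
  filter_upwards [coeFn_tensorLp hp0 hpt g₁ (g + h) g₃, coeFn_tensorLp hp0 hpt g₁ g g₃,
    coeFn_tensorLp hp0 hpt g₁ h g₃, Lp.coeFn_add (tensorLp hp0 hpt g₁ g g₃)
    (tensorLp hp0 hpt g₁ h g₃), quasiMeasurePreserving_pr₂.ae (Lp.coeFn_add g h)]
    with ω h1 h2 h3 h4 h5
  rw [h1, h4, Pi.add_apply, h2, h3]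
  simp only [tensor, h5, Pi.add_apply, map_add]; ring

theorem tensorLp_add₃ (g₁ g₂ g h : Lp ℂ p freqMeasure) :
    tensorLp hp0 hpt g₁ g₂ (g + h) = tensorLp hp0 hpt g₁ g₂ g + tensorLp hp0 hpt g₁ g₂ h := by
  ext1
  filter_upwards [coeFn_tensorLp hp0 hpt g₁ g₂ (g + h), coeFn_tensorLp hp0 hpt g₁ g₂ g,
    coeFn_tensorLp hp0 hpt g₁ g₂ h, Lp.coeFn_add (tensorLp hp0 hpt g₁ g₂ g)
    (tensorLp hp0 hpt g₁ g₂ h), quasiMeasurePreserving_pr₃.ae (Lp.coeFn_add g h)]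
    with ω h1 h2 h3 h4 h5
  rw [h1, h4, Pi.add_apply, h2, h3]
  simp only [tensor, h5, Pi.add_apply]; ring

/-- Only real scalars are admitted because the second slot is conjugate linear; this is why
smoothness is over $\mathbb R$. -/
theorem tensorLp_smul₁ (k : ℝ) (g g₂ g₃ : Lp ℂ p freqMeasure) :
    tensorLp hp0 hpt (k • g) g₂ g₃ = k • tensorLp hp0 hpt g g₂ g₃ := by
  ext1
  filter_upwards [coeFn_tensorLp hp0 hpt (k • g) g₂ g₃, coeFn_tensorLp hp0 hpt g g₂ g₃,
    Lp.coeFn_smul k (tensorLp hp0 hpt g g₂ g₃), quasiMeasurePreserving_pr₁.ae (Lp.coeFn_smul k g)]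
    with ω h1 h2 h3 h4
  rw [h1, h3, Pi.smul_apply, h2]
  simp only [tensor, h4, Pi.smul_apply, Complex.real_smul]; ring

theorem tensorLp_smul₂ (k : ℝ) (g₁ g g₃ : Lp ℂ p freqMeasure) :
    tensorLp hp0 hpt g₁ (k • g) g₃ = k • tensorLp hp0 hpt g₁ g g₃ := by
  ext1
  filter_upwards [coeFn_tensorLp hp0 hpt g₁ (k • g) g₃, coeFn_tensorLp hp0 hpt g₁ g g₃,
    Lp.coeFn_smul k (tensorLp hp0 hpt g₁ g g₃), quasiMeasurePreserving_pr₂.ae (Lp.coeFn_smul k g)]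
    with ω h1 h2 h3 h4
  rw [h1, h3, Pi.smul_apply, h2]
  simp only [tensor, h4, Pi.smul_apply, Complex.real_smul, map_mul, Complex.conj_ofReal]; ring

theorem tensorLp_smul₃ (k : ℝ) (g₁ g₂ g : Lp ℂ p freqMeasure) :
    tensorLp hp0 hpt g₁ g₂ (k • g) = k • tensorLp hp0 hpt g₁ g₂ g := by
  ext1
  filter_upwards [coeFn_tensorLp hp0 hpt g₁ g₂ (k • g), coeFn_tensorLp hp0 hpt g₁ g₂ g,
    Lp.coeFn_smul k (tensorLp hp0 hpt g₁ g₂ g), quasiMeasurePreserving_pr₃.ae (Lp.coeFn_smul k g)]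
    with ω h1 h2 h3 h4
  rw [h1, h3, Pi.smul_apply, h2]
  simp only [tensor, h4, Pi.smul_apply, Complex.real_smul]; ring

end tensorLp

/-! ### Trilinear maps -/

/-- A bounded trilinear map from a function that is additive and homogeneous in each argument. -/
theorem exists_trilinear {E F : Type*} [NormedAddCommGroup E] [NormedSpace ℝ E]
    [NormedAddCommGroup F] [NormedSpace ℝ F] (D : E → E → E → F)
    (hadd₁ : ∀ x y v w, D (x + y) v w = D x v w + D y v w)
    (hadd₂ : ∀ u x y w, D u (x + y) w = D u x w + D u y w)
    (hadd₃ : ∀ u v x y, D u v (x + y) = D u v x + D u v y)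
    (hsmul₁ : ∀ (k : ℝ) x v w, D (k • x) v w = k • D x v w)
    (hsmul₂ : ∀ (k : ℝ) u x w, D u (k • x) w = k • D u x w)
    (hsmul₃ : ∀ (k : ℝ) u v x, D u v (k • x) = k • D u v x) (C : ℝ) (hC : 0 ≤ C)
    (hD : ∀ u v w, ‖D u v w‖ ≤ C * ‖u‖ * ‖v‖ * ‖w‖) :
    ∃ L : E →L[ℝ] E →L[ℝ] E →L[ℝ] F, ∀ u v w, L u v w = D u v w := by
  let D₃ : E → E → E →L[ℝ] F := fun u v => LinearMap.mkContinuous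
    { toFun := D u v, map_add' := hadd₃ u v, map_smul' := fun k x => hsmul₃ k u v x }
    (C * ‖u‖ * ‖v‖) (hD u v)
  have h₃ : ∀ u v, ‖D₃ u v‖ ≤ C * ‖u‖ * ‖v‖ := fun u v =>
    LinearMap.mkContinuous_norm_le _ (by positivity) _
  let D₂ : E → E →L[ℝ] E →L[ℝ] F := fun u => LinearMap.mkContinuous
    { toFun := D₃ u
      map_add' := fun x y => ContinuousLinearMap.ext fun w => hadd₂ u x y w
      map_smul' := fun k x => ContinuousLinearMap.ext fun w => hsmul₂ k u x w }
    (C * ‖u‖) (h₃ u)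
  have h₂ : ∀ u, ‖D₂ u‖ ≤ C * ‖u‖ := fun u => LinearMap.mkContinuous_norm_le _ (by positivity) _
  refine ⟨LinearMap.mkContinuous
    { toFun := D₂
      map_add' := fun x y => ?_
      map_smul' := fun k x => ?_ } C h₂, fun _ _ _ => rfl⟩
  · ext v w
    exact hadd₁ x y v w
  · ext v w
    exact hsmul₁ k x v w

/-! ### The weighted isometries -/

theorem norm_X_weighted {s b : ℝ} {p : ℝ≥0∞} [Fact (1 ≤ p)] (u : X s b p) :
    ‖X.weighted s b p u‖ = ‖u‖ := rfl

/-- Division by the positive weight. This identifies $X^{s,b}_p$ with $L^p$, from which completeness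
is inherited. -/
theorem X_weighted_surjective (s b : ℝ) (p : ℝ≥0∞) :
    Function.Surjective (X.weighted s b p) := by
  intro (g : Lp ℂ p freqMeasure)
  have hw : AEStronglyMeasurable (fun z => ((xWeight s b z : ℝ) : ℂ)⁻¹) freqMeasure :=
    (measurable_xWeight s b).inv.aestronglyMeasurable
  have h1 : xMul s b (AEEqFun.mk _ hw * g.1) = g.1 := by
    change AEEqFun.mk _ (measurable_xWeight s b).aestronglyMeasurable *
      (AEEqFun.mk _ hw * g.1) = g.1
    rw [← mul_assoc, AEEqFun.mk_mul_mk]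
    have h2 : ((fun z => ((xWeight s b z : ℝ) : ℂ)) * fun z => ((xWeight s b z : ℝ) : ℂ)⁻¹) =
        fun _ => 1 := by
      funext z
      exact mul_inv_cancel₀ (Complex.ofReal_ne_zero.mpr (xWeight_pos s b z).ne')
    simp_rw [h2]
    exact one_mul _
  exact ⟨⟨AEEqFun.mk _ hw * g.1, by
    refine Submodule.mem_comap.mpr ?_
    rw [h1]; exact g.2⟩, Subtype.ext h1⟩

/-- The isometry `u ↦ ⟨n⟩^s ⟨τ + |n|₋²⟩^b û` onto `L^p`. -/
def X.equiv (s b : ℝ) (p : ℝ≥0∞) [Fact (1 ≤ p)] : X s b p ≃ₗᵢ[ℂ] Lp ℂ p freqMeasure :=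
  LinearIsometryEquiv.ofSurjective ⟨X.weighted s b p, norm_X_weighted⟩
    (X_weighted_surjective s b p)

theorem X.equiv_apply {s b : ℝ} {p : ℝ≥0∞} [Fact (1 ≤ p)] (u : X s b p) :
    X.equiv s b p u = X.weighted s b p u := rfl

instance (s b : ℝ) (p : ℝ≥0∞) [Fact (1 ≤ p)] : CompleteSpace (X s b p) :=
  (completeSpace_congr (e := (X.equiv s b p).toEquiv)
    (X.equiv s b p).isometry.isUniformEmbedding).mpr inferInstance

/-! ### Fourier coefficients of functions in `X^{s,b}_p` -/

theorem X.integrable_exp_mul_hat {s b : ℝ} {p : ℝ≥0∞} (h : Admissible b p) (u : X s b p) (t : ℝ)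
    (n : Freq) : Integrable (fun τ : ℝ => Complex.exp (Complex.I * t * τ) * u.hat (n, τ)) := by
  refine (integrable_eval (s := s) h t n (X.weighted s b p u)).congr ?_
  filter_upwards [ae_slice (X.coeFn_weighted u) n] with τ hτ
  have : ((xWeight s b (n, τ) : ℝ) : ℂ) ≠ 0 :=
    Complex.ofReal_ne_zero.mpr (xWeight_pos s b _).ne'
  simp only [hτ, evalKernel]
  field_simp

theorem X.integrable_hat {s b : ℝ} {p : ℝ≥0∞} (h : Admissible b p) (u : X s b p) (n : Freq) :
    Integrable (fun τ : ℝ => u.hat (n, τ)) := by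
  simpa using X.integrable_exp_mul_hat h u 0 n

theorem X.continuous_coeff {s b : ℝ} {p : ℝ≥0∞} (h : Admissible b p) (u : X s b p) (n : Freq) :
    Continuous (fun t : ℝ => u.coeff t n) := by
  unfold X.coeff
  refine continuous_of_dominated (bound := fun τ => ‖u.hat (n, τ)‖)
    (fun t => (X.integrable_exp_mul_hat h u t n).aestronglyMeasurable) (fun t => ?_)
    (X.integrable_hat h u n).norm (Eventually.of_forall fun τ => by fun_prop)
  exact Eventually.of_forall fun τ => by rw [norm_mul, norm_exp_I_mul, one_mul]

/-! ### Time evaluation of the trilinear Duhamel operator -/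

/-- The symbol `e^{-it|n|₋²} ∫₀ᵗ e^{it'(τ₁ - τ₂ + τ₃ + |n|₋²)} dt'`. -/
def duhamelSymbol (t : ℝ) (n : Freq) (τ : ℝ × ℝ × ℝ) : ℂ :=
  Complex.exp (-(Complex.I * t * hypSq n)) *
    ∫ t' in (0 : ℝ)..t, Complex.exp (Complex.I * (modulation n τ : ℝ) * t')

/-- The integrand of the trilinear Duhamel operator at a time `t` and a frequency `n`. -/
def duhamelIntegrand (s b t : ℝ) (n : Freq) (G : TripleFreq → ℂ) (ω : TripleFreq) : ℂ :=
  if Interacts n ω.1 then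
    duhamelSymbol t n ω.2 *
      (((xWeight s b (pr₁ ω) * xWeight s b (pr₂ ω) * xWeight s b (pr₃ ω) : ℝ) : ℂ)⁻¹ * G ω)
  else 0

/-- The weight at $(n,\tau)$ cancels against `evalKernel`, and the inverse Fourier transform in
$\sigma=\tau+|n|_-^2$ turns the cutoff kernel into the true Duhamel integral for $t\in[0,T]$. -/
theorem integral_evalKernel_mul_trilinearKernel {s b t T : ℝ} (hT : 0 < T)
    (ht : t ∈ Icc (0 : ℝ) T) (n : Freq) (G : TripleFreq → ℂ) (ω : TripleFreq) :
    ∫ τ : ℝ, evalKernel s b t n τ * (trilinearKernel s b T (n, τ) ω * G ω) =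
      duhamelIntegrand s b t n G ω := by
  unfold duhamelIntegrand
  by_cases hω : Interacts n ω.1
  · rw [if_pos hω]
    obtain ⟨W, hW⟩ : ∃ W, W = xWeight s b (pr₁ ω) * xWeight s b (pr₂ ω) * xWeight s b (pr₃ ω) :=
      ⟨_, rfl⟩
    rw [← hW]
    have h1 : ∀ τ : ℝ, evalKernel s b t n τ * (trilinearKernel s b T (n, τ) ω * G ω) =
        Complex.exp (-(Complex.I * t * hypSq n)) * ((W : ℂ)⁻¹ * G ω) *
          (Complex.exp (Complex.I * t * ((τ + hypSq n : ℝ) : ℂ)) *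
            duhamelKernelT T (τ + hypSq n) (modulation n ω.2)) := by
      intro τ
      have hx : ((xWeight s b (n, τ) : ℝ) : ℂ) ≠ 0 :=
        Complex.ofReal_ne_zero.mpr (xWeight_pos s b _).ne'
      have he : Complex.exp (Complex.I * t * τ) = Complex.exp (-(Complex.I * t * hypSq n)) *
          Complex.exp (Complex.I * t * ((τ + hypSq n : ℝ) : ℂ)) := by
        rw [← Complex.exp_add]; congr 1; push_cast; ring
      rw [trilinearKernel, if_pos hω, evalKernel, he, ← hW, Complex.ofReal_div]
      field_simp
    simp_rw [h1]
    rw [integral_const_mul, integral_add_right_eq_self (fun σ : ℝ =>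
      Complex.exp (Complex.I * t * (σ : ℂ)) * duhamelKernelT T σ (modulation n ω.2)) (hypSq n),
      integral_exp_mul_duhamelKernelT hT ht, duhamelSymbol]
    ring
  · rw [if_neg hω]
    simp only [trilinearKernel, if_neg hω, zero_mul, mul_zero, integral_zero]

section Fubini

variable {p : ℝ≥0∞} {P Q b s : ℝ} {c M₁ M₂ : ℝ≥0∞} {a β : Freq × ℝ → TripleFreq → ℝ≥0∞}

/-- The hypothesis of Fubini: on the slice $n$ the evaluation kernel is in $L^Q$ and the Schur test
puts the absolute inner integral in $L^P$. -/
theorem integrable_evalKernel_mul_trilinearKernel {T : ℝ} (hPQ : P.HolderConjugate Q)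
    (hp : p = ENNReal.ofReal P) (h : Admissible b p)
    (hS : SchurBound freqMeasure tripleMeasure P Q (trilinearKernel s b T) c M₁ M₂ a β)
    (hc : c ≠ ⊤) (hM₁ : M₁ ≠ ⊤) (hM₂ : M₂ ≠ ⊤) {G : TripleFreq → ℂ}
    (hG : MemLp G p tripleMeasure) (t : ℝ) (n : Freq) :
    Integrable (Function.uncurry fun (τ : ℝ) (ω : TripleFreq) =>
      evalKernel s b t n τ * (trilinearKernel s b T (n, τ) ω * G ω))
      ((volume : Measure ℝ).prod tripleMeasure) := by
  have hP := hPQ.pos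
  have hQ := hPQ.symm.pos
  have hpP : p.toReal = P := by rw [hp, ENNReal.toReal_ofReal hP.le]
  have hp0 : p ≠ 0 := by rw [hp]; simpa using hP
  have hpt : p ≠ ⊤ := by rw [hp]; exact ENNReal.ofReal_ne_top
  have hq := h.holderConjugate
  have hqt : ENNReal.conjExponent p ≠ ⊤ :=
    (ENNReal.HolderConjugate.lt_top_iff_one_lt (ENNReal.conjExponent p) p).mpr h.1 |>.ne
  have hq0 : ENNReal.conjExponent p ≠ 0 :=
    (ENNReal.HolderConjugate.symm (p := p) (q := ENNReal.conjExponent p)).ne_zero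
  have hqQ : (ENNReal.conjExponent p).toReal = Q := by
    have h1 : P.HolderConjugate (ENNReal.conjExponent p).toReal := by
      rw [← hpP]; exact hq.toReal_of_ne_top hpt hqt
    exact h1.conjugate_eq.trans hPQ.conjugate_eq.symm
  have hke := memLp_evalKernel h s t n
  have hKm := hS.measurable_kernel
  have hKn : Measurable (Function.uncurry fun (τ : ℝ) (ω : TripleFreq) =>
      trilinearKernel s b T (n, τ) ω) :=
    hKm.comp ((measurable_prodMk_left.comp measurable_fst).prodMk measurable_snd)
  have hGs : AEStronglyMeasurable (fun x : ℝ × TripleFreq => G x.2)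
      ((volume : Measure ℝ).prod tripleMeasure) :=
    hG.1.comp_quasiMeasurePreserving Measure.quasiMeasurePreserving_snd
  have hjoint : AEMeasurable (Function.uncurry fun (τ : ℝ) (ω : TripleFreq) =>
      ‖trilinearKernel s b T (n, τ) ω‖ₑ * ‖G ω‖ₑ) ((volume : Measure ℝ).prod tripleMeasure) :=
    hKn.enorm.aemeasurable.mul hGs.enorm
  have hinner : AEMeasurable (fun τ : ℝ =>
      ∫⁻ ω, ‖trilinearKernel s b T (n, τ) ω‖ₑ * ‖G ω‖ₑ ∂tripleMeasure) volume :=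
    hjoint.lintegral_prod_right'
  have hm : AEStronglyMeasurable (Function.uncurry fun (τ : ℝ) (ω : TripleFreq) =>
      evalKernel s b t n τ * (trilinearKernel s b T (n, τ) ω * G ω))
      ((volume : Measure ℝ).prod tripleMeasure) :=
    (hke.1.comp_quasiMeasurePreserving Measure.quasiMeasurePreserving_fst).mul
      (hKn.aestronglyMeasurable.mul hGs)
  refine ⟨hm, ?_⟩
  rw [hasFiniteIntegral_iff_enorm, lintegral_prod _ hm.enorm]
  have h1 : ∀ τ : ℝ, ∫⁻ ω, ‖Function.uncurry (fun (τ : ℝ) (ω : TripleFreq) =>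
      evalKernel s b t n τ * (trilinearKernel s b T (n, τ) ω * G ω)) (τ, ω)‖ₑ ∂tripleMeasure =
      ‖evalKernel s b t n τ‖ₑ *
        ∫⁻ ω, ‖trilinearKernel s b T (n, τ) ω‖ₑ * ‖G ω‖ₑ ∂tripleMeasure := by
    intro τ
    simp only [Function.uncurry, enorm_mul]
    exact lintegral_const_mul' _ _ enorm_ne_top
  simp_rw [h1]
  have h2 := ENNReal.lintegral_mul_le_Lp_mul_Lq volume hPQ.symm hke.1.enorm hinner
  refine h2.trans_lt (ENNReal.mul_lt_top ?_ ?_)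
  · refine ENNReal.rpow_lt_top_of_nonneg (by positivity) ?_
    have := (eLpNorm_lt_top_iff_lintegral_rpow_enorm_lt_top hq0 hqt).mp hke.2
    rw [hqQ] at this
    exact this.ne
  · refine ENNReal.rpow_lt_top_of_nonneg (by positivity) (ne_top_of_le_ne_top ?_ (le_trans ?_
      (hS.lintegral_rpow_le hPQ hG.1)))
    · have h3 := (eLpNorm_lt_top_iff_lintegral_rpow_enorm_lt_top hp0 hpt).mp hG.2
      rw [hpP] at h3
      refine ENNReal.mul_ne_top (ENNReal.rpow_ne_top_of_nonneg hP.le ?_) h3.ne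
      exact ENNReal.mul_ne_top (ENNReal.mul_ne_top hc
        (ENNReal.rpow_ne_top_of_nonneg (by positivity) hM₁))
        (ENNReal.rpow_ne_top_of_nonneg (by positivity) hM₂)
    · have hj' : AEMeasurable (Function.uncurry fun (z : Freq × ℝ) (ω : TripleFreq) =>
          ‖trilinearKernel s b T z ω‖ₑ * ‖G ω‖ₑ) (freqMeasure.prod tripleMeasure) :=
        hKm.enorm.aemeasurable.mul
          (hG.1.enorm.comp_quasiMeasurePreserving Measure.quasiMeasurePreserving_snd)
      have hi' : AEMeasurable (fun z : Freq × ℝ =>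
          (∫⁻ ω, ‖trilinearKernel s b T z ω‖ₑ * ‖G ω‖ₑ ∂tripleMeasure) ^ P) freqMeasure :=
        hj'.lintegral_prod_right'.pow_const P
      refine le_trans (le_of_eq ?_) (lintegral_mono' (map_slice_le n) le_rfl)
      rw [lintegral_map' (hi'.mono_measure (map_slice_le n))
        measurable_prodMk_left.aemeasurable]

/-- The coefficients of the Duhamel operator, as an integral over space-time frequencies. -/
theorem integral_evalKernel_mul_operator {T : ℝ} (hPQ : P.HolderConjugate Q)
    (hp : p = ENNReal.ofReal P) (h : Admissible b p)
    (hS : SchurBound freqMeasure tripleMeasure P Q (trilinearKernel s b T) c M₁ M₂ a β)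
    (hc : c ≠ ⊤) (hM₁ : M₁ ≠ ⊤) (hM₂ : M₂ ≠ ⊤) {G : TripleFreq → ℂ}
    (hG : MemLp G p tripleMeasure) {t : ℝ} (hT : 0 < T) (ht : t ∈ Icc (0 : ℝ) T) (n : Freq)
    {F : Freq × ℝ → ℂ}
    (hF : ∀ᵐ z ∂freqMeasure, F z = ∫ ω, trilinearKernel s b T z ω * G ω ∂tripleMeasure) :
    Integrable (duhamelIntegrand s b t n G) tripleMeasure ∧
      ∫ τ : ℝ, evalKernel s b t n τ * F (n, τ) =
        ∫ ω, duhamelIntegrand s b t n G ω ∂tripleMeasure := by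
  have h1 := integrable_evalKernel_mul_trilinearKernel hPQ hp h hS hc hM₁ hM₂ hG t n
  have h2 := integral_evalKernel_mul_trilinearKernel (s := s) (b := b) hT ht n G
  refine ⟨?_, ?_⟩
  · refine h1.integral_prod_right.congr (Eventually.of_forall fun ω => ?_)
    exact h2 ω
  · calc ∫ τ : ℝ, evalKernel s b t n τ * F (n, τ)
        = ∫ τ : ℝ, (∫ ω, evalKernel s b t n τ * (trilinearKernel s b T (n, τ) ω * G ω)
            ∂tripleMeasure) := by
          refine integral_congr_ae ?_
          filter_upwards [ae_slice hF n] with τ hτ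
          rw [hτ, integral_const_mul]
      _ = ∫ ω, (∫ τ : ℝ, evalKernel s b t n τ * (trilinearKernel s b T (n, τ) ω * G ω))
            ∂tripleMeasure := integral_integral_swap h1
      _ = _ := integral_congr_ae (Eventually.of_forall h2)

end Fubini

/-! ### The Duhamel formula -/

/-- The polarized form of `cubic`. -/
def cubic₃ (N : ℕ) (a₁ a₂ a₃ : Freq → ℂ) (n : Freq) : ℂ :=
  ∑ n₁ ∈ freqBall N, ∑ n₂ ∈ freqBall N, ∑ n₃ ∈ freqBall N,
    if n₁ - n₂ + n₃ = n then a₁ n₁ * (starRingEnd ℂ) (a₂ n₂) * a₃ n₃ else 0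

theorem cubic₃_self (N : ℕ) (a : Freq → ℂ) : cubic₃ N a a a = cubic N a := rfl

theorem ae_slice_triple {P : TripleFreq → Prop} (h : ∀ᵐ ω ∂tripleMeasure, P ω)
    (ν : Freq × Freq × Freq) : ∀ᵐ τ : ℝ × ℝ × ℝ, P (ν, τ) :=
  Measure.ae_count_iff.mp (Measure.ae_ae_of_ae_prod h) ν

theorem integrable_triple {f₁ f₂ f₃ : ℝ → ℂ} (h₁ : Integrable f₁) (h₂ : Integrable f₂)
    (h₃ : Integrable f₃) : Integrable (fun τ : ℝ × ℝ × ℝ =>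
      f₁ τ.1 * ((starRingEnd ℂ) (f₂ τ.2.1) * f₃ τ.2.2)) := by
  have h₂' : Integrable (fun x => (starRingEnd ℂ) (f₂ x)) :=
    (LinearIsometryEquiv.integrable_comp_iff Complex.conjLIE).mpr h₂
  exact h₁.mul_prod (h₂'.mul_prod h₃)

theorem integral_triple (f₁ f₂ f₃ : ℝ → ℂ) :
    ∫ τ : ℝ × ℝ × ℝ, f₁ τ.1 * ((starRingEnd ℂ) (f₂ τ.2.1) * f₃ τ.2.2) =
      (∫ x, f₁ x) * ((starRingEnd ℂ) (∫ x, f₂ x) * ∫ x, f₃ x) := by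
  have e1 := integral_prod_mul (μ := (volume : Measure ℝ)) (ν := (volume : Measure (ℝ × ℝ))) f₁
    (fun y : ℝ × ℝ => (starRingEnd ℂ) (f₂ y.1) * f₃ y.2)
  have e2 := integral_prod_mul (μ := (volume : Measure ℝ)) (ν := (volume : Measure ℝ))
    (fun x => (starRingEnd ℂ) (f₂ x)) f₃
  rw [← integral_conj, ← e2]
  exact e1

/-- The phase $e^{it'(\tau_1-\tau_2+\tau_3)}$ factorises, with the conjugate accounting for
$-\tau_2$, so each factor inverts to a coefficient at time $t'$. -/
theorem integral_duhamelSymbol_mul (t : ℝ) (n : Freq) {f₁ f₂ f₃ : ℝ → ℂ} (h₁ : Integrable f₁)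
    (h₂ : Integrable f₂) (h₃ : Integrable f₃) :
    ∫ τ : ℝ × ℝ × ℝ, duhamelSymbol t n τ * (f₁ τ.1 * ((starRingEnd ℂ) (f₂ τ.2.1) * f₃ τ.2.2)) =
      ∫ t' in (0 : ℝ)..t, Complex.exp (-(Complex.I * (t - t' : ℝ) * hypSq n)) *
        ((∫ x : ℝ, Complex.exp (Complex.I * t' * x) * f₁ x) *
          (starRingEnd ℂ) (∫ x : ℝ, Complex.exp (Complex.I * t' * x) * f₂ x) *
          (∫ x : ℝ, Complex.exp (Complex.I * t' * x) * f₃ x)) := by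
  have hg := integrable_triple h₁ h₂ h₃
  set g : ℝ × ℝ × ℝ → ℂ := fun τ => f₁ τ.1 * ((starRingEnd ℂ) (f₂ τ.2.1) * f₃ τ.2.2) with hgdef
  have hmod : Continuous (modulation n) := by unfold modulation; fun_prop
  have hint : Integrable (Function.uncurry fun (t' : ℝ) (τ : ℝ × ℝ × ℝ) =>
      Complex.exp (Complex.I * (modulation n τ : ℝ) * t') * g τ)
      ((volume.restrict (Set.uIoc 0 t)).prod volume) := by
    have h1 : Integrable (fun x : ℝ × (ℝ × ℝ × ℝ) => (1 : ℂ) * g x.2)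
        ((volume.restrict (Set.uIoc 0 t)).prod volume) :=
      Integrable.mul_prod (f := fun _ => (1 : ℂ)) (by
        rw [Set.uIoc]; exact integrable_const 1) hg
    refine h1.mono ?_ (Eventually.of_forall fun x => ?_)
    · refine AEStronglyMeasurable.mul ?_ (by simpa using h1.aestronglyMeasurable)
      refine Continuous.aestronglyMeasurable ?_
      have := hmod.comp (continuous_snd (X := ℝ) (Y := ℝ × ℝ × ℝ))
      fun_prop
    · simp only [Function.uncurry]
      rw [norm_mul, norm_exp_I_mul, one_mul, one_mul]
  have h4 : ∀ t' : ℝ, ∫ τ : ℝ × ℝ × ℝ, Complex.exp (Complex.I * (modulation n τ : ℝ) * t') * g τ =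
      Complex.exp (Complex.I * t' * hypSq n) *
        ((∫ x : ℝ, Complex.exp (Complex.I * t' * x) * f₁ x) *
          ((starRingEnd ℂ) (∫ x : ℝ, Complex.exp (Complex.I * t' * x) * f₂ x) *
          (∫ x : ℝ, Complex.exp (Complex.I * t' * x) * f₃ x))) := by
    intro t'
    rw [← integral_triple, ← integral_const_mul]
    refine integral_congr_ae (Eventually.of_forall fun τ => ?_)
    have h5 : Complex.exp (Complex.I * (modulation n τ : ℝ) * t') =
        Complex.exp (Complex.I * t' * hypSq n) * (Complex.exp (Complex.I * t' * τ.1) *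
          ((starRingEnd ℂ) (Complex.exp (Complex.I * t' * τ.2.1)) *
            Complex.exp (Complex.I * t' * τ.2.2))) := by
      rw [← Complex.exp_conj, ← Complex.exp_add, ← Complex.exp_add, ← Complex.exp_add]
      congr 1
      simp only [modulation, map_mul, Complex.conj_I, Complex.conj_ofReal]
      push_cast
      ring
    simp only [h5, hgdef, map_mul]
    ring
  have h6 : ∀ τ : ℝ × ℝ × ℝ, duhamelSymbol t n τ * g τ =
      Complex.exp (-(Complex.I * t * hypSq n)) *
        ∫ t' in (0 : ℝ)..t, Complex.exp (Complex.I * (modulation n τ : ℝ) * t') * g τ := by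
    intro τ
    rw [duhamelSymbol, mul_assoc, intervalIntegral.integral_mul_const]
  change ∫ τ, duhamelSymbol t n τ * g τ = _
  simp_rw [h6]
  rw [integral_const_mul, ← intervalIntegral_integral_swap hint,
    ← intervalIntegral.integral_const_mul]
  refine intervalIntegral.integral_congr fun t' _ => ?_
  simp only [h4]
  rw [← mul_assoc, ← Complex.exp_add]
  congr 1
  · congr 1; push_cast; ring
  · ring

theorem mem_freqBall_iff {N : ℕ} {n : Freq} :
    n ∈ freqBall N ↔ n.1 ^ 2 + n.2 ^ 2 ≤ (N : ℤ) ^ 2 := by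
  unfold freqBall
  simp only [Finset.mem_filter, Finset.mem_product, Finset.mem_Icc, and_iff_right_iff_imp]
  intro h
  have h1 : |n.1| ≤ (N : ℤ) := abs_le_of_sq_le_sq (by nlinarith [sq_nonneg n.2]) (by positivity)
  have h2 : |n.2| ≤ (N : ℤ) := abs_le_of_sq_le_sq (by nlinarith [sq_nonneg n.1]) (by positivity)
  exact ⟨abs_le.mp h1, abs_le.mp h2⟩

theorem freqBall_mono : Monotone freqBall := by
  intro N M h n hn
  rw [mem_freqBall_iff] at hn ⊢
  have : (N : ℤ) ≤ M := by exact_mod_cast h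
  exact hn.trans (pow_le_pow_left₀ (by positivity) this 2)

theorem exists_mem_freqBall (n : Freq) : ∃ N, n ∈ freqBall N := by
  refine ⟨n.1.natAbs + n.2.natAbs, ?_⟩
  rw [mem_freqBall_iff]
  push_cast
  have h1 := sq_abs n.1
  have h2 := sq_abs n.2
  nlinarith [abs_nonneg n.1, abs_nonneg n.2]

/-- The triples of frequencies with `|n₁|, |n₂|, |n₃| ≤ N`. -/
def tripleBall (N : ℕ) : Finset (Freq × Freq × Freq) :=
  freqBall N ×ˢ freqBall N ×ˢ freqBall N

theorem cubic₃_eq_sum (N : ℕ) (a₁ a₂ a₃ : Freq → ℂ) (n : Freq) :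
    cubic₃ N a₁ a₂ a₃ n = ∑ ν ∈ tripleBall N,
      if Interacts n ν then a₁ ν.1 * (starRingEnd ℂ) (a₂ ν.2.1) * a₃ ν.2.2 else 0 := by
  rw [tripleBall, Finset.sum_product]
  simp_rw [Finset.sum_product]
  rfl

/-- Absolute integrability over all triples makes the frequency truncations converge. This gives the
nonlinearity its meaning even when $u(t)\notin L^3$. -/
theorem tendsto_sum_tripleBall {F : TripleFreq → ℂ} (hF : Integrable F tripleMeasure) :
    Tendsto (fun N => ∑ ν ∈ tripleBall N, ∫ τ, F (ν, τ)) atTop (𝓝 (∫ ω, F ω ∂tripleMeasure)) := by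
  have hmono : Monotone fun N => (tripleBall N : Set (Freq × Freq × Freq)) ×ˢ
      (Set.univ : Set (ℝ × ℝ × ℝ)) := by
    intro N M h
    refine Set.prod_mono ?_ le_rfl
    exact Finset.coe_subset.mpr (Finset.product_subset_product (freqBall_mono h)
      (Finset.product_subset_product (freqBall_mono h) (freqBall_mono h)))
  have hU : ⋃ N, (tripleBall N : Set (Freq × Freq × Freq)) ×ˢ
      (Set.univ : Set (ℝ × ℝ × ℝ)) = Set.univ := by
    refine Set.eq_univ_of_forall fun ω => Set.mem_iUnion.mpr ?_
    obtain ⟨N₁, h1⟩ := exists_mem_freqBall ω.1.1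
    obtain ⟨N₂, h2⟩ := exists_mem_freqBall ω.1.2.1
    obtain ⟨N₃, h3⟩ := exists_mem_freqBall ω.1.2.2
    refine ⟨N₁ + N₂ + N₃, ⟨?_, trivial⟩⟩
    simp only [tripleBall, Finset.coe_product, Set.mem_prod, Finset.mem_coe]
    exact ⟨freqBall_mono (by omega) h1, freqBall_mono (by omega) h2, freqBall_mono (by omega) h3⟩
  have h := tendsto_setIntegral_of_monotone (μ := tripleMeasure) (f := F)
    (fun N => (tripleBall N).measurableSet.prod MeasurableSet.univ) hmono
    (by rw [hU]; exact hF.integrableOn)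
  rw [hU, setIntegral_univ] at h
  refine h.congr fun N => ?_
  have hi : IntegrableOn F ((tripleBall N : Set (Freq × Freq × Freq)) ×ˢ
      (Set.univ : Set (ℝ × ℝ × ℝ))) tripleMeasure := hF.integrableOn
  rw [setIntegral_prod F hi, setIntegral_finset]
  · simp
  · have : IntegrableOn (fun ν => ∫ τ, F (ν, τ)) (tripleBall N : Set (Freq × Freq × Freq))
      Measure.count := hF.integral_prod_left.integrableOn
    simpa using this

theorem intervalIntegrable_trilinear {s b : ℝ} {p : ℝ≥0∞} (h : Admissible b p)
    (u₁ u₂ u₃ : X s b p) (t : ℝ) (n n₁ n₂ n₃ : Freq) (x y : ℝ) :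
    IntervalIntegrable (fun t' : ℝ => Complex.exp (-(Complex.I * (t - t' : ℝ) * hypSq n)) *
      (u₁.coeff t' n₁ * (starRingEnd ℂ) (u₂.coeff t' n₂) * u₃.coeff t' n₃)) volume x y := by
  refine Continuous.intervalIntegrable ?_ _ _
  have h₁ := X.continuous_coeff h u₁ n₁
  have h₂ := X.continuous_coeff h u₂ n₂
  have h₃ := X.continuous_coeff h u₃ n₃
  have h₂' : Continuous fun t' => (starRingEnd ℂ) (u₂.coeff t' n₂) :=
    Complex.continuous_conj.comp h₂
  fun_prop

theorem integral_duhamelIntegrand {s b : ℝ} {p : ℝ≥0∞} (h : Admissible b p)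
    (u₁ u₂ u₃ : X s b p) (t : ℝ) (n : Freq) {G : TripleFreq → ℂ}
    (hG : G =ᵐ[tripleMeasure] tensor (X.weighted s b p u₁) (X.weighted s b p u₂)
      (X.weighted s b p u₃)) (ν : Freq × Freq × Freq) :
    ∫ τ, duhamelIntegrand s b t n G (ν, τ) =
      ∫ t' in (0 : ℝ)..t, Complex.exp (-(Complex.I * (t - t' : ℝ) * hypSq n)) *
        (if Interacts n ν then
          u₁.coeff t' ν.1 * (starRingEnd ℂ) (u₂.coeff t' ν.2.1) * u₃.coeff t' ν.2.2 else 0) := by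
  by_cases hν : Interacts n ν
  · simp_rw [if_pos hν]
    have h1 := integral_duhamelSymbol_mul t n (X.integrable_hat h u₁ ν.1)
      (X.integrable_hat h u₂ ν.2.1) (X.integrable_hat h u₃ ν.2.2)
    refine Eq.trans (integral_congr_ae ?_) h1
    filter_upwards [ae_slice_triple hG ν,
      ae_slice_triple (quasiMeasurePreserving_pr₁.ae (X.coeFn_weighted u₁)) ν,
      ae_slice_triple (quasiMeasurePreserving_pr₂.ae (X.coeFn_weighted u₂)) ν,
      ae_slice_triple (quasiMeasurePreserving_pr₃.ae (X.coeFn_weighted u₃)) ν]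
      with τ h2 h3 h4 h5
    rw [duhamelIntegrand, if_pos hν, h2, tensor, h3, h4, h5]
    have e1 := Complex.ofReal_ne_zero.mpr (xWeight_pos s b (pr₁ (ν, τ))).ne'
    have e2 := Complex.ofReal_ne_zero.mpr (xWeight_pos s b (pr₂ (ν, τ))).ne'
    have e3 := Complex.ofReal_ne_zero.mpr (xWeight_pos s b (pr₃ (ν, τ))).ne'
    rw [map_mul, Complex.conj_ofReal]
    push_cast
    field_simp
    rfl
  · simp_rw [if_neg hν]
    have : ∀ τ, duhamelIntegrand s b t n G (ν, τ) = 0 := fun τ => by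
      rw [duhamelIntegrand, if_neg hν]
    simp [this]

/-- The part of the operator from frequencies at most $N$ is exactly the Duhamel integral of the
truncated nonlinearity. -/
theorem sum_integral_duhamelIntegrand {s b : ℝ} {p : ℝ≥0∞} (h : Admissible b p)
    (u₁ u₂ u₃ : X s b p) (t : ℝ) (n : Freq) {G : TripleFreq → ℂ}
    (hG : G =ᵐ[tripleMeasure] tensor (X.weighted s b p u₁) (X.weighted s b p u₂)
      (X.weighted s b p u₃)) (N : ℕ) :
    ∑ ν ∈ tripleBall N, ∫ τ, duhamelIntegrand s b t n G (ν, τ) =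
      ∫ t' in (0 : ℝ)..t,
        propagator (t - t') (cubic₃ N (u₁.coeff t') (u₂.coeff t') (u₃.coeff t')) n := by
  simp_rw [integral_duhamelIntegrand h u₁ u₂ u₃ t n hG, propagator, cubic₃_eq_sum, Finset.mul_sum]
  rw [intervalIntegral.integral_finsetSum]
  intro ν _
  by_cases hν : Interacts n ν
  · simp_rw [if_pos hν]
    exact intervalIntegrable_trilinear h u₁ u₂ u₃ t n _ _ _ _ _
  · simp_rw [if_neg hν, mul_zero]
    exact intervalIntegrable_const

/-- `u` is the trilinear Duhamel integral of `u₁`, `u₂`, `u₃` on the time interval `[0, T]`. -/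
def IsDuhamel (T : ℝ) (u₁ u₂ u₃ u : ℝ → Freq → ℂ) : Prop :=
  ∀ t ∈ Icc (0 : ℝ) T, ∀ n, Tendsto (fun N : ℕ => ∫ t' in (0 : ℝ)..t,
    propagator (t - t') (cubic₃ N (u₁ t') (u₂ t') (u₃ t')) n) atTop (𝓝 (u t n))

theorem X.weighted_real_smul {s b : ℝ} {p : ℝ≥0∞} [Fact (1 ≤ p)] (k : ℝ) (u : X s b p) :
    X.weighted s b p (k • u) = k • X.weighted s b p u := by
  have h : k • u = (k : ℂ) • u := (Complex.coe_smul k u).symm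
  rw [h, map_smul]
  exact Complex.coe_smul k _

/-- The trilinear Duhamel operator on `X^{s,b}_p`, with a small constant for short times. -/
theorem exists_duhamel_operator {s b : ℝ} {p : ℝ≥0∞} [Fact (1 ≤ p)] (h : Admissible b p)
    (hb1 : b < 1) (hs : 1 - 1 / p.toReal < s) :
    ∃ C : ℝ, 0 < C ∧ ∀ T : ℝ, 0 < T → T ≤ 1 →
      ∃ D : X s b p →L[ℝ] X s b p →L[ℝ] X s b p →L[ℝ] X s b p,
        (∀ u v w, ‖D u v w‖ ≤ C * T ^ (1 - b) * ‖u‖ * ‖v‖ * ‖w‖) ∧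
        ∀ u₁ u₂ u₃, IsDuhamel T u₁.coeff u₂.coeff u₃.coeff (D u₁ u₂ u₃).coeff := by
  have hpt := h.2.1
  have hp0 : p ≠ 0 := (zero_lt_one.trans h.1).ne'
  obtain ⟨P, hP⟩ : ∃ P, P = p.toReal := ⟨_, rfl⟩
  have hpP : p = ENNReal.ofReal P := by rw [hP, ENNReal.ofReal_toReal hpt]
  have hP1 : 1 < P := by
    rw [hP]; simpa using ENNReal.toReal_strict_mono hpt h.1
  have hPQ := Real.HolderConjugate.conjExponent hP1
  set Q := P.conjExponent
  have hQ := hPQ.symm.pos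
  -- The thresholds for $b$ and for $s$ are the same number $1/Q$.
  have hPQ' : 1 - 1 / P = Q⁻¹ := by
    rw [one_div]; exact hPQ.one_sub_inv
  have hbQ : 1 < b * Q := by
    have := h.2.2
    rw [← hP, hPQ', inv_lt_iff_one_lt_mul₀ hQ] at this
    exact this
  have hsQ : 1 < s * Q := by
    rw [← hP, hPQ', inv_lt_iff_one_lt_mul₀ hQ] at hs
    exact hs
  have hb0 : 0 ≤ b := by
    have : 0 < b * Q := by linarith
    exact (pos_of_mul_pos_left this hQ.le).le
  obtain ⟨γ, C, M₁, M₂, hC, hM₁, hM₂, hS⟩ :=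
    exists_schurBound_trilinearKernel hPQ hb0 hb1 hbQ hsQ
  set M := (M₁ ^ P⁻¹ * M₂ ^ Q⁻¹).toReal
  refine ⟨C * (M + 1), by positivity, fun T hT hT1 => ?_⟩
  obtain ⟨S, hS1, hS2⟩ := (hS T hT hT1).exists_operator hPQ hpP ENNReal.ofReal_ne_top hM₁ hM₂
  have hnorm : ∀ G, ‖S G‖ ≤ C * (M + 1) * T ^ (1 - b) * ‖G‖ := by
    intro G
    refine (hS2 G).trans (mul_le_mul_of_nonneg_right ?_ (norm_nonneg _))
    rw [mul_assoc, ENNReal.toReal_mul, ENNReal.toReal_ofReal (by positivity)]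
    have : 0 ≤ C * T ^ (1 - b) := by positivity
    change C * T ^ (1 - b) * M ≤ _
    nlinarith
  let G : X s b p → X s b p → X s b p → Lp ℂ p tripleMeasure := fun u₁ u₂ u₃ =>
    tensorLp hp0 hpt (X.weighted s b p u₁) (X.weighted s b p u₂) (X.weighted s b p u₃)
  have hsm : ∀ (k : ℝ) (g : Lp ℂ p tripleMeasure), (X.equiv s b p).symm (S (k • g)) =
      k • (X.equiv s b p).symm (S g) := by
    intro k g
    have hk : k • g = (k : ℂ) • g := (Complex.coe_smul k g).symm
    rw [hk, map_smul, map_smul]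
    exact Complex.coe_smul k _
  obtain ⟨D, hD⟩ := exists_trilinear (fun u₁ u₂ u₃ => (X.equiv s b p).symm (S (G u₁ u₂ u₃)))
    (fun x y v w => by simp only [G, map_add, tensorLp_add₁])
    (fun u x y w => by simp only [G, map_add, tensorLp_add₂])
    (fun u v x y => by simp only [G, map_add, tensorLp_add₃])
    (fun k x v w => by simp only [G, X.weighted_real_smul, tensorLp_smul₁, hsm])
    (fun k u x w => by simp only [G, X.weighted_real_smul, tensorLp_smul₂, hsm])
    (fun k u v x => by simp only [G, X.weighted_real_smul, tensorLp_smul₃, hsm])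
    (C * (M + 1) * T ^ (1 - b)) (by positivity) (fun u v w => by
      rw [LinearIsometryEquiv.norm_map]
      refine (hnorm _).trans (le_of_eq ?_)
      rw [norm_tensorLp, norm_X_weighted, norm_X_weighted, norm_X_weighted]
      ring)
  refine ⟨D, fun u v w => ?_, fun u₁ u₂ u₃ t ht n => ?_⟩
  · rw [hD, LinearIsometryEquiv.norm_map]
    refine (hnorm _).trans (le_of_eq ?_)
    rw [norm_tensorLp, norm_X_weighted, norm_X_weighted, norm_X_weighted]
    ring
  · have h1 := integral_evalKernel_mul_operator hPQ hpP h (hS T hT hT1) ENNReal.ofReal_ne_top hM₁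
      hM₂ (Lp.memLp (G u₁ u₂ u₃)) hT ht n (hS1 _)
    have h2 : (D u₁ u₂ u₃).coeff t n =
        ∫ ω, duhamelIntegrand s b t n (G u₁ u₂ u₃) ω ∂tripleMeasure := by
      rw [X.coeff_eq, ← X.equiv_apply, hD, LinearIsometryEquiv.apply_symm_apply, h1.2]
    rw [h2]
    refine (tendsto_sum_tripleBall h1.1).congr fun N => ?_
    exact sum_integral_duhamelIntegrand h u₁ u₂ u₃ t n (coeFn_tensorLp hp0 hpt _ _ _) N

/-! ### Fourier–Lebesgue spaces as weighted `ℓ^p` spaces -/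

theorem FL.ext {s : ℝ} {p : ℝ≥0∞} {f g : FL s p} (h : ∀ n, f.coeff n = g.coeff n) : f = g :=
  Subtype.ext (funext h)

theorem FL.coeff_sub {s : ℝ} {p : ℝ≥0∞} (f g : FL s p) : (f - g).coeff = f.coeff - g.coeff := rfl

theorem FL.norm_weighted_apply {s : ℝ} {p : ℝ≥0∞} (f : FL s p) (n : Freq) :
    ‖FL.weighted s p f n‖ = bracket n ^ s * ‖f.coeff n‖ := by
  change ‖((bracket n ^ s : ℝ) : ℂ) * f.coeff n‖ = _
  rw [norm_mul, Complex.norm_real,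
    Real.norm_of_nonneg (Real.rpow_pos_of_pos (bracket_pos n) s).le]

theorem FL.exists_of_bound {s : ℝ} {p : ℝ≥0∞} (hp : 0 < p.toReal) {a : Freq → ℂ} {B : Freq → ℝ}
    (hB : Summable (fun n => B n ^ p.toReal)) (h : ∀ n, bracket n ^ s * ‖a n‖ ≤ B n) :
    ∃ f : FL s p, f.coeff = a := by
  refine ⟨⟨a, ?_⟩, rfl⟩
  change Memℓp _ p
  refine memℓp_gen (hB.of_nonneg_of_le (fun n => by positivity) fun n => ?_)
  have := bracket_pos n
  refine Real.rpow_le_rpow (norm_nonneg _) (le_trans (le_of_eq ?_) (h n)) hp.le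
  rw [norm_mul, Complex.norm_real, Real.norm_of_nonneg (by positivity)]

section FL

variable {s : ℝ} {p : ℝ≥0∞} [Fact (1 ≤ p)]

theorem FL.hasSum_norm (hp : 0 < p.toReal) (f : FL s p) :
    HasSum (fun n => (bracket n ^ s * ‖f.coeff n‖) ^ p.toReal) (‖f‖ ^ p.toReal) := by
  have h := lp.hasSum_norm hp (FL.weighted s p f)
  simp_rw [FL.norm_weighted_apply] at h
  exact h

theorem FL.norm_coeff_le (hp : p ≠ 0) (f : FL s p) (n : Freq) :
    bracket n ^ s * ‖f.coeff n‖ ≤ ‖f‖ := by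
  rw [← FL.norm_weighted_apply]
  exact lp.norm_apply_le_norm hp (FL.weighted s p f) n

theorem FL.norm_le_of_hasSum (hp : 0 < p.toReal) (f : FL s p) {B : Freq → ℝ} {S : ℝ} (hS : 0 ≤ S)
    (hB : HasSum (fun n => B n ^ p.toReal) (S ^ p.toReal))
    (h : ∀ n, bracket n ^ s * ‖f.coeff n‖ ≤ B n) : ‖f‖ ≤ S := by
  refine (Real.rpow_le_rpow_iff (norm_nonneg _) hS hp).mp
    (hasSum_le (fun n => ?_) (FL.hasSum_norm hp f) hB)
  have := bracket_pos n
  exact Real.rpow_le_rpow (by positivity) (h n) hp.le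

/-- Continuity in time is checked coefficientwise and upgraded to the norm by dominated convergence
in $\ell^p$. -/
theorem FL.tendsto_of_dominated (hp : 0 < p.toReal) {α : Type*} {l : Filter α}
    {f : α → FL s p} {g : FL s p} {B : Freq → ℝ} (hB : Summable (fun n => B n ^ p.toReal))
    (hf : ∀ x n, bracket n ^ s * ‖(f x).coeff n - g.coeff n‖ ≤ B n)
    (h : ∀ n, Tendsto (fun x => (f x).coeff n) l (𝓝 (g.coeff n))) : Tendsto f l (𝓝 g) := by
  rw [tendsto_iff_norm_sub_tendsto_zero]
  have h1 : Tendsto (fun x => ∑' n, (bracket n ^ s * ‖(f x - g).coeff n‖) ^ p.toReal) l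
      (𝓝 (∑' _ : Freq, (0 : ℝ))) := by
    refine tendsto_tsum_of_dominated_convergence hB (fun n => ?_)
      (Eventually.of_forall fun x n => ?_)
    · have h2 := (((h n).sub_const (g.coeff n)).norm.const_mul (bracket n ^ s)).rpow_const
        (p := p.toReal) (Or.inr hp.le)
      simpa [Real.zero_rpow hp.ne', FL.coeff_sub] using h2
    · have := bracket_pos n
      rw [Real.norm_of_nonneg (by positivity)]
      exact Real.rpow_le_rpow (by positivity) (hf x n) hp.le
  simp_rw [(FL.hasSum_norm hp _).tsum_eq, tsum_zero] at h1
  have h2 := h1.rpow_const (p := p.toReal⁻¹) (Or.inr (inv_pos.mpr hp).le)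
  rw [Real.zero_rpow (inv_pos.mpr hp).ne'] at h2
  refine h2.congr fun x => ?_
  rw [← Real.rpow_mul (norm_nonneg _), mul_inv_cancel₀ hp.ne', Real.rpow_one]

end FL

/-! ### Elements of `X^{s,b}_p` from weighted functions -/

section Xmk

variable {s b : ℝ} {p : ℝ≥0∞} [Fact (1 ≤ p)]

/-- The element of `X^{s,b}_p` with `⟨n⟩^s ⟨τ + |n|₋²⟩^b û = F`. -/
def X.ofWeighted (s b : ℝ) {F : Freq × ℝ → ℂ} (hF : MemLp F p freqMeasure) : X s b p :=
  (X.equiv s b p).symm (hF.toLp F)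

theorem X.weighted_ofWeighted {F : Freq × ℝ → ℂ} (hF : MemLp F p freqMeasure) :
    X.weighted s b p (X.ofWeighted s b hF) = hF.toLp F :=
  (X.equiv s b p).apply_symm_apply _

theorem X.norm_ofWeighted {F : Freq × ℝ → ℂ} (hF : MemLp F p freqMeasure) :
    ‖X.ofWeighted s b hF‖ = (eLpNorm F p freqMeasure).toReal := by
  rw [X.ofWeighted, LinearIsometryEquiv.norm_map, Lp.norm_toLp]

theorem X.coeff_ofWeighted {F : Freq × ℝ → ℂ} (hF : MemLp F p freqMeasure) (t : ℝ) (n : Freq) :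
    (X.ofWeighted s b hF).coeff t n = ∫ τ : ℝ, evalKernel s b t n τ * F (n, τ) := by
  rw [X.coeff_eq, X.weighted_ofWeighted]
  refine integral_congr_ae ?_
  filter_upwards [ae_slice hF.coeFn_toLp n] with τ hτ
  rw [hτ]

/-- Translation in time. -/
theorem X.exists_shift (a : ℝ) (u : X s b p) :
    ∃ v : X s b p, ‖v‖ = ‖u‖ ∧ ∀ t n, v.coeff t n = u.coeff (t + a) n := by
  have hm : AEStronglyMeasurable (fun z : Freq × ℝ => Complex.exp (Complex.I * a * z.2) *
      X.weighted s b p u z) freqMeasure := by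
    refine AEStronglyMeasurable.mul (Measurable.aestronglyMeasurable ?_)
      (Lp.aestronglyMeasurable _)
    fun_prop
  have hn : ∀ z : Freq × ℝ, ‖Complex.exp (Complex.I * a * z.2) * X.weighted s b p u z‖ =
      ‖X.weighted s b p u z‖ := fun z => by rw [norm_mul, norm_exp_I_mul, one_mul]
  have hF : MemLp (fun z : Freq × ℝ => Complex.exp (Complex.I * a * z.2) *
      X.weighted s b p u z) p freqMeasure :=
    (Lp.memLp (X.weighted s b p u)).congr_norm hm (Eventually.of_forall fun z => (hn z).symm)
  refine ⟨X.ofWeighted s b hF, ?_, fun t n => ?_⟩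
  · rw [X.norm_ofWeighted, eLpNorm_congr_norm_ae (Eventually.of_forall hn), ← norm_X_weighted,
      Lp.norm_def]
  · rw [X.coeff_ofWeighted, X.coeff_eq]
    congr 1
    funext τ
    rw [evalKernel, evalKernel]
    have : Complex.exp (Complex.I * ((t + a : ℝ) : ℂ) * τ) =
        Complex.exp (Complex.I * t * τ) * Complex.exp (Complex.I * a * τ) := by
      rw [← Complex.exp_add]; congr 1; push_cast; ring
    rw [this]
    ring

/-! ### The embedding into continuous functions of time -/

/-- The `L^p` norm in `τ` of the weighted space-time Fourier transform at the frequency `n`. -/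
def X.freqNorm (u : X s b p) (n : Freq) : ℝ :=
  (∫⁻ τ : ℝ, ‖X.weighted s b p u (n, τ)‖ₑ ^ p.toReal).toReal ^ p.toReal⁻¹

theorem X.tsum_lintegral (hp0 : p ≠ 0) (hpt : p ≠ ⊤) (u : X s b p) :
    ∑' n, ∫⁻ τ : ℝ, ‖X.weighted s b p u (n, τ)‖ₑ ^ p.toReal =
      ENNReal.ofReal (‖u‖ ^ p.toReal) := by
  have hp := ENNReal.toReal_pos hp0 hpt
  have hm : AEMeasurable (fun z => ‖X.weighted s b p u z‖ₑ ^ p.toReal) freqMeasure :=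
    (Lp.aestronglyMeasurable (X.weighted s b p u)).enorm.pow_const _
  rw [← lintegral_count, ← lintegral_prod _ hm, ← norm_X_weighted,
    ← ENNReal.ofReal_rpow_of_nonneg (norm_nonneg _) hp.le, Lp.norm_def,
    ENNReal.ofReal_toReal (Lp.eLpNorm_ne_top _), eLpNorm_eq_lintegral_rpow_enorm_toReal hp0 hpt,
    one_div, ENNReal.rpow_inv_rpow hp.ne']

theorem X.hasSum_freqNorm (hp0 : p ≠ 0) (hpt : p ≠ ⊤) (u : X s b p) :
    HasSum (fun n => X.freqNorm u n ^ p.toReal) (‖u‖ ^ p.toReal) := by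
  have hp := ENNReal.toReal_pos hp0 hpt
  have h := X.tsum_lintegral hp0 hpt u
  have h1 : ∀ n, X.freqNorm u n ^ p.toReal =
      (∫⁻ τ : ℝ, ‖X.weighted s b p u (n, τ)‖ₑ ^ p.toReal).toReal := fun n => by
    rw [X.freqNorm, ← Real.rpow_mul ENNReal.toReal_nonneg, inv_mul_cancel₀ hp.ne', Real.rpow_one]
  simp_rw [h1]
  have h2 : ∑' n, ∫⁻ τ : ℝ, ‖X.weighted s b p u (n, τ)‖ₑ ^ p.toReal ≠ ⊤ := by
    rw [h]; exact ENNReal.ofReal_ne_top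
  have h3 := ENNReal.hasSum_toReal h2
  rwa [← ENNReal.tsum_toReal_eq (fun n => ENNReal.ne_top_of_tsum_ne_top h2 n), h,
    ENNReal.toReal_ofReal (by positivity)] at h3

end Xmk

/-- Hölder in $\tau$, with $\langle\cdot\rangle^{-b}\in L^Q$ because $bQ>1$. The bound is an
$\ell^p$ sequence independent of $t$, so it serves as the dominating sequence. -/
theorem X.exists_coeff_bound (s : ℝ) {b : ℝ} {p : ℝ≥0∞} (h : Admissible b p) : ∃ A : ℝ, 0 < A ∧
    ∀ (u : X s b p) (t : ℝ) (n : Freq),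
      bracket n ^ s * ‖u.coeff t n‖ ≤ A * X.freqNorm u n := by
  have hpt := h.2.1
  have hp0 : p ≠ 0 := (zero_lt_one.trans h.1).ne'
  have hp1 : 1 < p.toReal := by simpa using ENNReal.toReal_strict_mono hpt h.1
  have hPQ := Real.HolderConjugate.conjExponent hp1
  set P := p.toReal
  set Q := P.conjExponent
  have hP := hPQ.pos
  have hQ := hPQ.symm.pos
  have hbQ : 1 < b * Q := by
    have h1 := h.2.2
    have hPQ' : 1 - 1 / P = Q⁻¹ := by rw [one_div]; exact hPQ.one_sub_inv
    change 1 - 1 / P < b at h1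
    rwa [hPQ', inv_lt_iff_one_lt_mul₀ hQ] at h1
  have hJ := lintegral_jb_lt_top hbQ
  set J := ∫⁻ x : ℝ, ENNReal.ofReal (jb x ^ (-(b * Q)))
  refine ⟨(J ^ (1 / Q)).toReal + 1, by positivity, fun u t n => ?_⟩
  have hbr : 0 < bracket n ^ s := Real.rpow_pos_of_pos (bracket_pos n) s
  set g := X.weighted s b p u
  have hgm : AEMeasurable (fun τ : ℝ => ‖g (n, τ)‖ₑ) volume := (memLp_slice g n).1.1.enorm
  have h1 : ∀ τ : ℝ, ‖evalKernel s b t n τ * g (n, τ)‖ₑ = ENNReal.ofReal ((bracket n ^ s)⁻¹) *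
      (ENNReal.ofReal (jb (τ + hypSq n) ^ (-b)) * ‖g (n, τ)‖ₑ) := by
    intro τ
    have hj := jb_pos (τ + hypSq n)
    rw [enorm_mul, ← mul_assoc, ← ENNReal.ofReal_mul (by positivity)]
    congr 1
    rw [← ofReal_norm]
    congr 1
    rw [evalKernel, norm_mul, norm_exp_I_mul, one_mul, norm_inv, Complex.norm_real,
      Real.norm_of_nonneg (xWeight_pos s b _).le, xWeight_eq, mul_inv, Real.rpow_neg hj.le]
  have h2 : ∫⁻ τ : ℝ, ENNReal.ofReal (jb (τ + hypSq n) ^ (-b)) ^ Q = J := by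
    have h3 : ∀ τ : ℝ, ENNReal.ofReal (jb (τ + hypSq n) ^ (-b)) ^ Q =
        ENNReal.ofReal (jb (τ + hypSq n) ^ (-(b * Q))) := fun τ => by
      have hj := jb_pos (τ + hypSq n)
      rw [ENNReal.ofReal_rpow_of_nonneg (by positivity) hQ.le, ← Real.rpow_mul hj.le, neg_mul]
    simp_rw [h3]
    exact lintegral_add_right_eq_self (fun τ => ENNReal.ofReal (jb τ ^ (-(b * Q)))) (hypSq n)
  have hjm := continuous_jb.measurable
  have h4 := ENNReal.lintegral_mul_le_Lp_mul_Lq volume hPQ.symm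
    (f := fun τ : ℝ => ENNReal.ofReal (jb (τ + hypSq n) ^ (-b))) (by fun_prop) hgm
  rw [h2] at h4
  have hfin : ∫⁻ τ : ℝ, ‖g (n, τ)‖ₑ ^ P ≠ ⊤ := by
    have := (eLpNorm_lt_top_iff_lintegral_rpow_enorm_lt_top hp0 hpt).mp (memLp_slice g n).1.2
    exact this.ne
  have h5 : ‖u.coeff t n‖ ≤ (bracket n ^ s)⁻¹ * ((J ^ (1 / Q)).toReal * X.freqNorm u n) := by
    have h6 : ‖u.coeff t n‖ₑ ≤ ENNReal.ofReal ((bracket n ^ s)⁻¹) *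
        (J ^ (1 / Q) * (∫⁻ τ : ℝ, ‖g (n, τ)‖ₑ ^ P) ^ (1 / P)) := by
      rw [X.coeff_eq]
      refine (enorm_integral_le_lintegral_enorm _).trans ?_
      rw [lintegral_congr h1, lintegral_const_mul' _ _ ENNReal.ofReal_ne_top]
      exact mul_le_mul_right h4 _
    have h7 : ENNReal.ofReal ((bracket n ^ s)⁻¹) *
        (J ^ (1 / Q) * (∫⁻ τ : ℝ, ‖g (n, τ)‖ₑ ^ P) ^ (1 / P)) ≠ ⊤ :=
      ENNReal.mul_ne_top ENNReal.ofReal_ne_top (ENNReal.mul_ne_top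
        (ENNReal.rpow_ne_top_of_nonneg (by positivity) hJ.ne)
        (ENNReal.rpow_ne_top_of_nonneg (by positivity) hfin))
    have h8 := ENNReal.toReal_mono h7 h6
    rw [toReal_enorm, ENNReal.toReal_mul, ENNReal.toReal_mul, ENNReal.toReal_ofReal (by positivity),
      ← ENNReal.toReal_rpow _ (1 / P), one_div P] at h8
    exact h8
  have h9 : 0 ≤ X.freqNorm u n := Real.rpow_nonneg ENNReal.toReal_nonneg _
  calc bracket n ^ s * ‖u.coeff t n‖
      ≤ bracket n ^ s * ((bracket n ^ s)⁻¹ * ((J ^ (1 / Q)).toReal * X.freqNorm u n)) := by gcongr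
    _ = (J ^ (1 / Q)).toReal * X.freqNorm u n := mul_inv_cancel_left₀ hbr.ne' _
    _ ≤ _ := by gcongr; linarith

theorem X.coeff_add {s b : ℝ} {p : ℝ≥0∞} [Fact (1 ≤ p)] (h : Admissible b p) (u v : X s b p)
    (t : ℝ) (n : Freq) : (u + v).coeff t n = u.coeff t n + v.coeff t n :=
  (X.eval h t n).map_add u v

theorem X.coeff_smul {s b : ℝ} {p : ℝ≥0∞} [Fact (1 ≤ p)] (h : Admissible b p) (k : ℂ) (u : X s b p)
    (t : ℝ) (n : Freq) : (k • u).coeff t n = k * u.coeff t n :=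
  (X.eval h t n).map_smul k u

theorem X.coeff_sub {s b : ℝ} {p : ℝ≥0∞} [Fact (1 ≤ p)] (h : Admissible b p) (u v : X s b p)
    (t : ℝ) (n : Freq) : (u - v).coeff t n = u.coeff t n - v.coeff t n :=
  (X.eval h t n).map_sub u v

/-- The embedding of `X^{s,b}_p` into `C([0, T]; FL^{s,p})`. -/
theorem exists_embedding (s : ℝ) {b : ℝ} {p : ℝ≥0∞} [Fact (1 ≤ p)] (h : Admissible b p) (T : ℝ) :
    ∃ E : X s b p →L[ℂ] C(Icc (0 : ℝ) T, FL s p),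
      ∀ (u : X s b p) (t : Icc (0 : ℝ) T) (n : Freq), (E u t).coeff n = u.coeff t n := by
  have hpt := h.2.1
  have hp0 : p ≠ 0 := (zero_lt_one.trans h.1).ne'
  have hp := ENNReal.toReal_pos hp0 hpt
  obtain ⟨A, hA, hbd⟩ := X.exists_coeff_bound (p := p) s h
  have hB : ∀ u : X s b p, HasSum (fun n => (A * X.freqNorm u n) ^ p.toReal)
      ((A * ‖u‖) ^ p.toReal) := fun u => by
    have h0 : ∀ n, 0 ≤ X.freqNorm u n := fun n => Real.rpow_nonneg ENNReal.toReal_nonneg _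
    simp_rw [Real.mul_rpow hA.le (h0 _), Real.mul_rpow hA.le (norm_nonneg _)]
    exact (X.hasSum_freqNorm hp0 hpt u).mul_left _
  have hex : ∀ (u : X s b p) (t : ℝ), ∃ f : FL s p, f.coeff = u.coeff t := fun u t =>
    FL.exists_of_bound hp (hB u).summable (hbd u t)
  choose e he using hex
  have hnorm : ∀ u t, ‖e u t‖ ≤ A * ‖u‖ := fun u t =>
    FL.norm_le_of_hasSum hp _ (by positivity) (hB u) fun n => by rw [he]; exact hbd u t n
  have hcont : ∀ u, Continuous (e u) := by
    intro u
    refine continuous_iff_continuousAt.mpr fun t => ?_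
    have h2 : Summable fun n => (2 * (A * X.freqNorm u n)) ^ p.toReal := by
      have h0 : ∀ n, 0 ≤ A * X.freqNorm u n := fun n =>
        mul_nonneg hA.le (Real.rpow_nonneg ENNReal.toReal_nonneg _)
      simp_rw [Real.mul_rpow zero_le_two (h0 _)]
      exact (hB u).summable.mul_left _
    refine FL.tendsto_of_dominated hp h2 (fun t' n => ?_) fun n => ?_
    · rw [he, he]
      have h3 := bracket_pos n
      have h4 := norm_sub_le (u.coeff t' n) (u.coeff t n)
      have h5 : 0 < bracket n ^ s := by positivity
      nlinarith [hbd u t n, hbd u t' n, mul_le_mul_of_nonneg_left h4 h5.le]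
    · simp_rw [he]
      exact (X.continuous_coeff h u n).tendsto t
  refine ⟨LinearMap.mkContinuous
    { toFun := fun u => ⟨fun t : Icc (0 : ℝ) T => e u t, (hcont u).comp continuous_subtype_val⟩
      map_add' := fun u v => ContinuousMap.ext fun t => FL.ext fun n => ?_
      map_smul' := fun k u => ContinuousMap.ext fun t => FL.ext fun n => ?_ } A
    fun u => ?_, fun u t n => ?_⟩
  · change (e (u + v) t).coeff n = (e u t).coeff n + (e v t).coeff n
    rw [he, he, he, X.coeff_add h]
  · change (e (k • u) t).coeff n = k * (e u t).coeff n
    rw [he, he, X.coeff_smul h]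
  · exact (ContinuousMap.norm_le _ (by positivity)).mpr fun t => hnorm u t
  · change (e u t).coeff n = _
    rw [he]

/-- The free evolution, cut off in time. -/
theorem exists_free_evolution (s : ℝ) {b : ℝ} {p : ℝ≥0∞} [Fact (1 ≤ p)] (h : Admissible b p)
    (hb : b < 1) :
    ∃ L : FL s p →L[ℂ] X s b p, ∀ f : FL s p, ∀ t ∈ Icc (0 : ℝ) 1, ∀ n : Freq,
      (L f).coeff t n = propagator t f.coeff n := by
  have hpt := h.2.1
  have hp0 : p ≠ 0 := (zero_lt_one.trans h.1).ne'
  have hp1 : 1 < p.toReal := by simpa using ENNReal.toReal_strict_mono hpt h.1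
  have hp : 0 < p.toReal := by linarith
  have hθ := continuous_cutoffHat
  have hj : Continuous fun σ => jb σ ^ b := continuous_jb.rpow_const fun x => Or.inl (jb_pos x).ne'
  -- The weighted transform of the cutoff decays like $\langle\sigma\rangle^{b-2}$, which is in
  -- $L^p$ since $(2-b)p>1$.
  let φ : ℝ → ℂ := fun σ => ((jb σ ^ b : ℝ) : ℂ) * cutoffHat σ
  have hφ : Continuous φ := (Complex.continuous_ofReal.comp hj).mul hθ
  have hK : ∫⁻ σ, ‖φ σ‖ₑ ^ p.toReal < ⊤ := by
    obtain ⟨C, hC, hC', -⟩ := exists_cutoffHat_bound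
    have h1 : ∀ σ, ‖φ σ‖ₑ ^ p.toReal ≤ ENNReal.ofReal (C ^ p.toReal) *
        ENNReal.ofReal (jb σ ^ (-((2 - b) * p.toReal))) := by
      intro σ
      have hj := jb_pos σ
      rw [← ENNReal.ofReal_mul (by positivity), ← ofReal_norm,
        ENNReal.ofReal_rpow_of_nonneg (norm_nonneg _) hp.le]
      refine ENNReal.ofReal_le_ofReal ?_
      have h2 : ‖φ σ‖ ≤ C * jb σ ^ (-(2 - b)) := by
        simp only [φ]
        rw [norm_mul, Complex.norm_real, Real.norm_of_nonneg (by positivity), neg_sub,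
          Real.rpow_sub hj, Real.rpow_two, jb_sq]
        calc jb σ ^ b * ‖cutoffHat σ‖ ≤ jb σ ^ b * (C * (1 + σ ^ 2)⁻¹) := by gcongr; exact hC' σ
          _ = _ := by ring
      refine (Real.rpow_le_rpow (norm_nonneg _) h2 hp.le).trans (le_of_eq ?_)
      rw [Real.mul_rpow hC.le (by positivity), ← Real.rpow_mul hj.le, neg_mul]
    refine (lintegral_mono h1).trans_lt ?_
    rw [lintegral_const_mul' _ _ ENNReal.ofReal_ne_top]
    exact ENNReal.mul_lt_top ENNReal.ofReal_lt_top (lintegral_jb_lt_top (by nlinarith))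
  set K := ∫⁻ σ, ‖φ σ‖ₑ ^ p.toReal
  let F : FL s p → Freq × ℝ → ℂ := fun f z => FL.weighted s p f z.1 * φ (z.2 + hypSq z.1)
  have hFm : ∀ f, Measurable (F f) := by
    intro f
    have h1 : Measurable fun n : Freq => FL.weighted s p f n := measurable_of_countable _
    have h2 := measurable_hypSq
    exact (h1.comp measurable_fst).mul (hφ.measurable.comp
      (measurable_snd.add (h2.comp measurable_fst)))
  have hFn : ∀ f, eLpNorm (F f) p freqMeasure =
      ENNReal.ofReal ‖f‖ * K ^ p.toReal⁻¹ := by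
    intro f
    rw [eLpNorm_eq_lintegral_rpow_enorm_toReal hp0 hpt,
      lintegral_prod _ ((hFm f).enorm.pow_const _).aemeasurable, lintegral_count]
    have h1 : ∀ n, ∫⁻ τ, ‖F f (n, τ)‖ₑ ^ p.toReal =
        ENNReal.ofReal ((bracket n ^ s * ‖f.coeff n‖) ^ p.toReal) * K := by
      intro n
      have hbr := bracket_pos n
      simp only [F, enorm_mul, ENNReal.mul_rpow_of_nonneg _ _ hp.le]
      rw [lintegral_const_mul' _ _ (ENNReal.rpow_ne_top_of_nonneg hp.le enorm_ne_top),
        lintegral_add_right_eq_self (fun σ => ‖φ σ‖ₑ ^ p.toReal) (hypSq n),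
        ← FL.norm_weighted_apply, ← ENNReal.ofReal_rpow_of_nonneg (norm_nonneg _) hp.le,
        ofReal_norm]
    simp_rw [h1]
    have h2 := FL.hasSum_norm hp f
    rw [ENNReal.tsum_mul_right, ← ENNReal.ofReal_tsum_of_nonneg
      (fun n => by have := bracket_pos n; positivity) h2.summable, h2.tsum_eq, one_div,
      ENNReal.mul_rpow_of_nonneg _ _ (by positivity),
      ← ENNReal.ofReal_rpow_of_nonneg (norm_nonneg _) hp.le, ENNReal.rpow_rpow_inv hp.ne']
  have hF : ∀ f, MemLp (F f) p freqMeasure := fun f => ⟨(hFm f).aestronglyMeasurable, by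
    rw [hFn]
    exact ENNReal.mul_lt_top ENNReal.ofReal_lt_top
      (ENNReal.rpow_lt_top_of_nonneg (by positivity) hK.ne)⟩
  refine ⟨LinearMap.mkContinuous
    { toFun := fun f => X.ofWeighted s b (hF f)
      map_add' := fun f g => ?_
      map_smul' := fun k f => ?_ } (K ^ p.toReal⁻¹).toReal fun f => ?_, fun f t ht n => ?_⟩
  · rw [X.ofWeighted, X.ofWeighted, X.ofWeighted, ← map_add, ← MemLp.toLp_add]
    congr 1
    refine MemLp.toLp_congr _ _ (Eventually.of_forall fun z => ?_)
    simp only [F, map_add, lp.coeFn_add, Pi.add_apply, add_mul]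
  · rw [X.ofWeighted, X.ofWeighted, RingHom.id_apply, ← map_smul, ← MemLp.toLp_const_smul]
    congr 1
    refine MemLp.toLp_congr _ _ (Eventually.of_forall fun z => ?_)
    simp only [F, map_smul, lp.coeFn_smul, Pi.smul_apply, smul_eq_mul, mul_assoc]
  · change ‖X.ofWeighted s b (hF f)‖ ≤ _
    rw [X.norm_ofWeighted, hFn, ENNReal.toReal_mul, ENNReal.toReal_ofReal (norm_nonneg _), mul_comm]
  · change (X.ofWeighted s b (hF f)).coeff t n = _
    rw [X.coeff_ofWeighted]
    have h1 : ∀ τ : ℝ, evalKernel s b t n τ * F f (n, τ) = propagator t f.coeff n *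
        (Complex.exp (Complex.I * t * ((τ + hypSq n : ℝ) : ℂ)) * cutoffHat (τ + hypSq n)) := by
      intro τ
      have hj : ((jb (τ + hypSq n) ^ b : ℝ) : ℂ) ≠ 0 :=
        Complex.ofReal_ne_zero.mpr (Real.rpow_pos_of_pos (jb_pos _) b).ne'
      have hbr : ((bracket n ^ s : ℝ) : ℂ) ≠ 0 :=
        Complex.ofReal_ne_zero.mpr (Real.rpow_pos_of_pos (bracket_pos n) s).ne'
      have he : Complex.exp (Complex.I * t * τ) = Complex.exp (-(Complex.I * t * hypSq n)) *
          Complex.exp (Complex.I * t * ((τ + hypSq n : ℝ) : ℂ)) := by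
        rw [← Complex.exp_add]; congr 1; push_cast; ring
      have hw : FL.weighted s p f n = ((bracket n ^ s : ℝ) : ℂ) * f.coeff n := rfl
      simp only [F, φ]
      rw [hw, evalKernel, xWeight_eq, he, propagator, Complex.ofReal_mul]
      field_simp
    simp_rw [h1]
    rw [integral_const_mul, integral_add_right_eq_self (fun σ : ℝ =>
      Complex.exp (Complex.I * t * (σ : ℂ)) * cutoffHat σ) (hypSq n),
      integral_exp_mul_cutoffHat ht, mul_one]

/-! ### A fixed point problem with smooth dependence on the data -/

/-- If `g` is smooth, `g 0 = 0`, and `g` is `1/2`-Lipschitz on a ball, then `x = y + g x` has a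
solution `x` that depends smoothly on `y`. -/
theorem exists_smooth_fixedPoint {E : Type*} [NormedAddCommGroup E] [NormedSpace ℝ E]
    [CompleteSpace E] {g : E → E} (hg : ContDiff ℝ ((⊤ : ℕ∞) : WithTop ℕ∞) g) (hg0 : g 0 = 0)
    {ρ : ℝ} (hρ : 0 < ρ) (hlip : LipschitzOnWith (1 / 2) g (Metric.ball 0 (3 * ρ))) :
    ∃ Ψ : E → E, ContDiffOn ℝ ((⊤ : ℕ∞) : WithTop ℕ∞) Ψ (Metric.ball 0 ρ) ∧
      ∀ y ∈ Metric.ball 0 ρ, Ψ y = y + g (Ψ y) := by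
  set N : E → E := fun x => x - g x with hN
  set s : Set E := Metric.ball 0 (3 * ρ) with hs
  set e := ContinuousLinearEquiv.refl ℝ E with he
  have happ : ApproximatesLinearOn N (e : E →L[ℝ] E) s (1 / 2) := by
    intro x hx y hy
    have h1 := hlip.norm_sub_le hx hy
    have h2 : N x - N y - (e : E →L[ℝ] E) (x - y) = -(g x - g y) := by
      simp only [hN, he, ContinuousLinearEquiv.coe_refl, ContinuousLinearMap.id_apply]
      abel
    rw [h2, norm_neg]
    exact h1
  have hc : Subsingleton E ∨ (1 / 2 : NNReal) < ‖(e.symm : E →L[ℝ] E)‖₊⁻¹ := by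
    rcases subsingleton_or_nontrivial E with h | h
    · exact Or.inl h
    · right
      have : ‖(e.symm : E →L[ℝ] E)‖₊ = 1 := by
        refine NNReal.eq ?_
        exact ContinuousLinearMap.norm_id
      rw [this, inv_one]
      exact NNReal.half_lt_self one_ne_zero
  set H := happ.toOpenPartialHomeomorph N s hc Metric.isOpen_ball with hH
  have hN0 : N 0 = 0 := by simp [hN, hg0]
  -- A map within $\frac12$ of the identity covers, from a ball of radius $2\rho$, the ball of
  -- radius $(1-\frac12)2\rho=\rho$. The larger open ball $3\rho$ leaves room for the closed one.
  have hsurj : Metric.closedBall 0 ρ ⊆ N '' s := by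
    have h1 := happ.surjOn_closedBall_of_nonlinearRightInverse
      (⟨id, 1, fun y => by simp, fun y => rfl⟩ :
        (e : E →L[ℝ] E).NonlinearRightInverse) (ε := 2 * ρ) (b := 0) (by linarith)
      (Metric.closedBall_subset_ball (by linarith))
    rw [hN0] at h1
    intro y hy
    have h2 : y ∈ Metric.closedBall (0 : E) ((((1 : NNReal) : ℝ)⁻¹ - ((1 / 2 : NNReal) : ℝ)) *
        (2 * ρ)) := by
      rw [mem_closedBall_zero_iff] at hy ⊢
      refine hy.trans (le_of_eq ?_)
      push_cast
      ring
    obtain ⟨x, hx, hxy⟩ := h1 h2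
    exact ⟨x, Metric.closedBall_subset_ball (by linarith) hx, hxy⟩
  have htar : ∀ y ∈ Metric.ball (0 : E) ρ, y ∈ H.target := fun y hy =>
    hsurj (Metric.ball_subset_closedBall hy)
  have hNsm : ContDiff ℝ ((⊤ : ℕ∞) : WithTop ℕ∞) N := contDiff_id.sub hg
  refine ⟨H.symm, fun y hy => ContDiffAt.contDiffWithinAt ?_, fun y hy => ?_⟩
  · have hx : H.symm y ∈ s := H.map_target (htar y hy)
    obtain ⟨x, hxe⟩ : ∃ x, x = H.symm y := ⟨_, rfl⟩
    rw [← hxe] at hx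
    have hgd : HasFDerivAt g (fderiv ℝ g x) x :=
      (hg.differentiable (by simp)).differentiableAt.hasFDerivAt
    -- The Lipschitz constant bounds the derivative by $\frac12$, so $1-g'(x)$ is invertible by a
    -- Neumann series and the local inverse is smooth.
    have hgn : ‖fderiv ℝ g x‖ < 1 := by
      have h1 := hgd.le_of_lipschitzOn (Metric.isOpen_ball.mem_nhds hx) hlip
      refine h1.trans_lt ?_
      push_cast
      norm_num
    have hNd : HasFDerivAt N ((ContinuousLinearEquiv.ofUnit
        (Units.oneSub (fderiv ℝ g x) hgn) : E ≃L[ℝ] E) : E →L[ℝ] E) x := by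
      have h1 := (hasFDerivAt_id x).sub hgd
      exact h1
    refine H.contDiffAt_symm (htar y hy) (f₀' := ContinuousLinearEquiv.ofUnit
        (Units.oneSub (fderiv ℝ g x) hgn)) ?_ ?_
    · rw [← hxe]; exact hNd
    · exact hNsm.contDiffAt
  · have h1 : N (H.symm y) = y := H.right_inv (htar y hy)
    exact (sub_eq_iff_eq_add.mp h1)

section Trilinear

variable {E F : Type*} [NormedAddCommGroup E] [NormedSpace ℝ E] [NormedAddCommGroup F]
  [NormedSpace ℝ F]

theorem norm_trilinear_sub_le (D : E →L[ℝ] E →L[ℝ] E →L[ℝ] F) {κ M : ℝ} (hκ : 0 ≤ κ)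
    (hD : ∀ u v w, ‖D u v w‖ ≤ κ * ‖u‖ * ‖v‖ * ‖w‖) {u v : E} (hu : ‖u‖ ≤ M) (hv : ‖v‖ ≤ M) :
    ‖D u u u - D v v v‖ ≤ 3 * κ * M ^ 2 * ‖u - v‖ := by
  have hM : 0 ≤ M := (norm_nonneg u).trans hu
  have h1 : D u u u - D v v v = D (u - v) u u + D v (u - v) u + D v v (u - v) := by
    simp only [map_sub, sub_apply]
    abel
  rw [h1]
  have h2 : ‖D (u - v) u u‖ ≤ κ * ‖u - v‖ * M * M := (hD _ _ _).trans (by gcongr)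
  have h3 : ‖D v (u - v) u‖ ≤ κ * M * ‖u - v‖ * M := (hD _ _ _).trans (by gcongr)
  have h4 : ‖D v v (u - v)‖ ≤ κ * M * M * ‖u - v‖ := (hD _ _ _).trans (by gcongr)
  calc _ ≤ ‖D (u - v) u u‖ + ‖D v (u - v) u‖ + ‖D v v (u - v)‖ := norm_add₃_le
    _ ≤ κ * ‖u - v‖ * M * M + κ * M * ‖u - v‖ * M + κ * M * M * ‖u - v‖ := by gcongr
    _ = _ := by ring

theorem contDiff_trilinear_diag (D : E →L[ℝ] E →L[ℝ] E →L[ℝ] F) :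
    ContDiff ℝ ((⊤ : ℕ∞) : WithTop ℕ∞) fun u => D u u u := by
  fun_prop

end Trilinear

/-- The step is $T_0/N$ with $N$ an integer so that finitely many steps exhaust $[0,T_0]$ exactly.
Smallness comes from $1-b>0$. -/
theorem exists_short_time {b : ℝ} (hb : b < 1) (C K T₀ : ℝ) :
    ∃ N : ℕ, 0 < N ∧ T₀ / N ≤ 1 ∧ C * (T₀ / N) ^ (1 - b) * K ≤ 1 / 2 := by
  have h1 : Tendsto (fun N : ℕ => T₀ / N) atTop (𝓝 0) :=
    tendsto_const_div_atTop_nhds_zero_nat T₀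
  have h2 : Tendsto (fun N : ℕ => C * (T₀ / N) ^ (1 - b) * K) atTop (𝓝 (C * 0 ^ (1 - b) * K)) :=
    ((h1.rpow_const (Or.inr (by linarith))).const_mul C).mul_const K
  rw [Real.zero_rpow (by linarith), mul_zero, zero_mul] at h2
  obtain ⟨N, hN1, hN2, hN3⟩ := ((eventually_gt_atTop 0).and
    ((h1.eventually_le_const zero_lt_one).and
    (h2.eventually_le_const (by norm_num : (0 : ℝ) < 1 / 2)))).exists
  exact ⟨N, hN1, hN2, hN3⟩

/-! ### Local well-posedness -/

theorem isBoundedLinearMap_mk {s b T : ℝ} {p : ℝ≥0∞} [Fact (1 ≤ p)] (h : Admissible b p) :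
    IsBoundedLinearMap ℝ (fun u : X s b p => (Submodule.Quotient.mk u : XLoc s h T)) :=
  IsLinearMap.with_bound ⟨fun _ _ => rfl, fun _ _ => rfl⟩ 1 fun u => by
    rw [one_mul]; exact Submodule.Quotient.norm_mk_le _ u

theorem toPath_apply {s T : ℝ} {p : ℝ≥0∞} [Fact (1 ≤ p)] (hT : 0 ≤ T)
    (u : C(Icc (0 : ℝ) T, FL s p)) {t : ℝ} (ht : t ∈ Icc (0 : ℝ) T) :
    toPath hT u t = (u ⟨t, ht⟩).coeff := by
  rw [toPath, IccExtend_of_mem hT u ht]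

/-- The fixed point of $u=Lf+iD(u,u,u)$ in the whole-line space $X^{s,b}_p$. The equation holds on
$[0,T]$, where all cutoffs equal $1$; both solution maps are bounded linear images of the fixed
point. -/
theorem exists_local_solution {s b : ℝ} {p : ℝ≥0∞} [Fact (1 ≤ p)] (h : Admissible b p)
    (hb1 : b < 1) (hs : 1 - 1 / p.toReal < s) (R : ℝ) (hR : 0 < R) :
    ∃ (T : ℝ) (hT : 0 < T) (Φ : FL s p → C(Icc (0 : ℝ) T, FL s p)) (Ψ : FL s p → XLoc s h T),
      (∀ f : FL s p, ‖f‖ < R →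
        IsSolution T f.coeff (toPath hT.le (Φ f)) ∧ XLoc.Represents (Ψ f) (Φ f)) ∧
      ContDiffOn ℝ ((⊤ : ℕ∞) : WithTop ℕ∞) Φ (Metric.ball 0 R) ∧
      ContDiffOn ℝ ((⊤ : ℕ∞) : WithTop ℕ∞) Ψ (Metric.ball 0 R) := by
  obtain ⟨C, hC, hD⟩ := exists_duhamel_operator h hb1 hs
  obtain ⟨L, hL⟩ := exists_free_evolution s h hb1
  -- The free evolutions of the data ball lie in the ball of radius $\rho$, with the $1$ keeping
  -- $\rho$ positive. The next choice of $T$ makes the cubic map $\frac12$-Lipschitz on the ball of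
  -- radius $3\rho$.
  set ρ := (‖L‖ + 1) * R with hρdef
  have hρ : 0 < ρ := by positivity
  obtain ⟨N, hN, hT1, hsmall⟩ := exists_short_time hb1 C (3 * (3 * ρ) ^ 2) 1
  have hN' : (0 : ℝ) < N := by exact_mod_cast hN
  set T : ℝ := 1 / N
  have hT : 0 < T := by positivity
  obtain ⟨D, hDn, hDf⟩ := hD T hT hT1
  obtain ⟨E, hE⟩ := exists_embedding s h T
  set κ := C * T ^ (1 - b)
  have hκ : 0 ≤ κ := by positivity
  let J : X s b p →L[ℝ] X s b p :=
    (Complex.I • ContinuousLinearMap.id ℂ (X s b p)).restrictScalars ℝ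
  have hJ : ∀ u, J u = Complex.I • u := fun u => rfl
  let g : X s b p → X s b p := fun u => J (D u u u)
  have hg : ContDiff ℝ ((⊤ : ℕ∞) : WithTop ℕ∞) g :=
    J.contDiff.comp (contDiff_trilinear_diag D)
  have hlip : LipschitzOnWith (1 / 2) g (Metric.ball 0 (3 * ρ)) := by
    refine LipschitzOnWith.of_dist_le_mul fun u hu v hv => ?_
    rw [mem_ball_zero_iff] at hu hv
    rw [dist_eq_norm, dist_eq_norm]
    change ‖J (D u u u) - J (D v v v)‖ ≤ _
    rw [← map_sub, hJ, norm_smul, Complex.norm_I, one_mul]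
    refine (norm_trilinear_sub_le D hκ hDn hu.le hv.le).trans ?_
    push_cast
    refine mul_le_mul_of_nonneg_right ?_ (norm_nonneg _)
    linarith
  obtain ⟨Ψ, hΨ, hfix⟩ := exists_smooth_fixedPoint hg (by simp [g]) hρ hlip
  have hLball : ∀ f ∈ Metric.ball (0 : FL s p) R, L f ∈ Metric.ball (0 : X s b p) ρ := by
    intro f hf
    rw [mem_ball_zero_iff] at hf ⊢
    have := L.le_opNorm f
    have h2 := norm_nonneg L
    have h3 := norm_nonneg f
    nlinarith
  let S : FL s p → X s b p := fun f => Ψ (L f)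
  have hS : ContDiffOn ℝ ((⊤ : ℕ∞) : WithTop ℕ∞) S (Metric.ball 0 R) :=
    hΨ.comp (L.restrictScalars ℝ).contDiff.contDiffOn hLball
  have hcoeff : ∀ f ∈ Metric.ball (0 : FL s p) R, ∀ t ∈ Icc (0 : ℝ) T, ∀ n,
      (S f).coeff t n = propagator t f.coeff n +
        Complex.I * (D (S f) (S f) (S f)).coeff t n := by
    intro f hf t ht n
    have h1 : S f = L f + Complex.I • D (S f) (S f) (S f) := hfix (L f) (hLball f hf)
    have h2 := X.coeff_add h (L f) (Complex.I • D (S f) (S f) (S f)) t n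
    rw [← h1, X.coeff_smul h, hL f t ⟨ht.1, ht.2.trans hT1⟩ n] at h2
    exact h2
  refine ⟨T, hT, fun f => E (S f), fun f => Submodule.Quotient.mk (S f), fun f hf => ⟨?_, ?_⟩,
    ?_, ?_⟩
  · have hf' : f ∈ Metric.ball (0 : FL s p) R := mem_ball_zero_iff.mpr hf
    have hpath : ∀ t ∈ Icc (0 : ℝ) T, toPath hT.le (E (S f)) t = (S f).coeff t := by
      intro t ht
      rw [toPath_apply hT.le _ ht]
      exact funext fun n => hE (S f) ⟨t, ht⟩ n
    intro t ht n
    rw [hpath t ht, hcoeff f hf' t ht n]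
    refine ((hDf (S f) (S f) (S f) t ht n).const_mul Complex.I).const_add _ |>.congr fun M => ?_
    congr 2
    refine intervalIntegral.integral_congr fun t' ht' => ?_
    rw [uIcc_of_le ht.1] at ht'
    simp only
    rw [hpath t' ⟨ht'.1, ht'.2.trans ht.2⟩, cubic₃_self]
  · exact ⟨S f, rfl, fun t n => (hE (S f) t n).symm⟩
  · exact (E.restrictScalars ℝ).contDiff.comp_contDiffOn hS
  · exact (isBoundedLinearMap_mk h).contDiff.comp_contDiffOn hS

/-! ### Uniqueness -/

/-- The operator acts on functions on the whole line, but its values on $[0,T]$ depend only on the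
input there; so extensions may be changed freely. -/
theorem IsDuhamel.unique {T : ℝ} {u u' v v' : ℝ → Freq → ℂ} (h : IsDuhamel T u u u v)
    (h' : IsDuhamel T u' u' u' v') (huu : ∀ t ∈ Icc (0 : ℝ) T, u t = u' t) {t : ℝ}
    (ht : t ∈ Icc (0 : ℝ) T) (n : Freq) : v t n = v' t n := by
  refine tendsto_nhds_unique (h t ht n) ((h' t ht n).congr fun N => ?_)
  refine intervalIntegral.integral_congr fun t' ht' => ?_
  rw [uIcc_of_le ht.1] at ht'
  simp only [huu t' ⟨ht'.1, ht'.2.trans ht.2⟩]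

theorem IsSolution.congr {T : ℝ} {f : Freq → ℂ} {u v : ℝ → Freq → ℂ} (h : IsSolution T f u)
    (huv : ∀ t ∈ Icc (0 : ℝ) T, u t = v t) : IsSolution T f v := by
  intro t ht n
  rw [← huv t ht]
  refine (h t ht n).congr fun N => ?_
  congr 2
  refine intervalIntegral.integral_congr fun t' ht' => ?_
  rw [uIcc_of_le ht.1] at ht'
  simp only [huv t' ⟨ht'.1, ht'.2.trans ht.2⟩]

/-- The equation controls $u-v$ only on $[0,\delta]$, so the contraction is run in the quotient
norm, after replacing $u$ by the extension $v+d$ whose difference from $v$ is nearly minimal. -/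
theorem coeff_eq_of_isDuhamel {s b δ κ M : ℝ} {p : ℝ≥0∞} [Fact (1 ≤ p)] (h : Admissible b p)
    {D : X s b p →L[ℝ] X s b p →L[ℝ] X s b p →L[ℝ] X s b p} (hκ : 0 ≤ κ)
    (hDn : ∀ u v w, ‖D u v w‖ ≤ κ * ‖u‖ * ‖v‖ * ‖w‖)
    (hDf : ∀ u, IsDuhamel δ u.coeff u.coeff u.coeff (D u u u).coeff)
    {u v : X s b p} (hu : ‖u‖ ≤ M) (hv : ‖v‖ ≤ M) (hsmall : 3 * κ * (3 * M + 1) ^ 2 ≤ 1 / 2)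
    (heq : ∀ t ∈ Icc (0 : ℝ) δ, ∀ n, u.coeff t n - v.coeff t n =
      Complex.I * ((D u u u).coeff t n - (D v v v).coeff t n)) :
    ∀ t ∈ Icc (0 : ℝ) δ, ∀ n, u.coeff t n = v.coeff t n := by
  have hM : 0 ≤ M := (norm_nonneg u).trans hu
  set q : XLoc s h δ := Submodule.Quotient.mk (u - v) with hq
  have hq2 : ‖q‖ ≤ 2 * M := by
    refine (Submodule.Quotient.norm_mk_le _ _).trans ((norm_sub_le _ _).trans ?_)
    linarith
  have hq0 : q = 0 := by
    by_contra hne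
    have hpos : 0 < ‖q‖ := norm_pos_iff.mpr hne
    -- The slack $\min(\|q\|,1)$ gives both $\|d\|<2\|q\|$, which closes the contraction, and
    -- $\|d\|\le2M+1$, which keeps $v+d$ in the ball where the operator is small.
    obtain ⟨d, hd, hdn⟩ := Submodule.Quotient.norm_mk_lt q (lt_min hpos one_pos)
    have hd1 : ‖d‖ < 2 * ‖q‖ := by linarith [min_le_left ‖q‖ 1]
    have hd2 : ‖d‖ ≤ 2 * M + 1 := by linarith [min_le_right ‖q‖ 1]
    have hvan : d - (u - v) ∈ X.vanishing s h δ := (Submodule.Quotient.eq _).mp hd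
    have hu' : ∀ t ∈ Icc (0 : ℝ) δ, (v + d).coeff t = u.coeff t := by
      intro t ht
      funext n
      have h1 : (d - (u - v)).coeff t n = 0 := hvan t ht n
      rw [X.coeff_sub h, X.coeff_sub h] at h1
      rw [X.coeff_add h]
      linear_combination h1
    set u' := v + d with hu'def
    have hq' : q = Submodule.Quotient.mk (Complex.I • (D u' u' u' - D v v v)) := by
      rw [hq, Submodule.Quotient.eq]
      intro t ht n
      rw [X.coeff_sub h, X.coeff_sub h, X.coeff_smul h, X.coeff_sub h, heq t ht n,
        (hDf u').unique (hDf u) hu' ht n]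
      ring
    have h2 : ‖q‖ ≤ ‖D u' u' u' - D v v v‖ := by
      rw [hq']
      refine (Submodule.Quotient.norm_mk_le _ _).trans (le_of_eq ?_)
      rw [norm_smul, Complex.norm_I, one_mul]
    have h3 : ‖u'‖ ≤ 3 * M + 1 := (norm_add_le _ _).trans (by linarith)
    have h4 := norm_trilinear_sub_le D hκ hDn h3 (show ‖v‖ ≤ 3 * M + 1 by linarith)
    have h5 : u' - v = d := by rw [hu'def, add_sub_cancel_left]
    rw [h5] at h4
    have h6 := mul_le_mul_of_nonneg_right hsmall (norm_nonneg d)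
    linarith
  have hmem : u - v ∈ X.vanishing s h δ := (Submodule.Quotient.mk_eq_zero _).mp hq0
  intro t ht n
  have h1 : (u - v).coeff t n = 0 := hmem t ht n
  rw [X.coeff_sub h] at h1
  exact sub_eq_zero.mp h1

theorem continuous_propagator_cubic {s b : ℝ} {p : ℝ≥0∞} (h : Admissible b p) (u : X s b p)
    (N : ℕ) (c : ℝ) (n : Freq) :
    Continuous fun t' : ℝ => propagator (c - t') (cubic N (u.coeff t')) n := by
  unfold propagator cubic
  refine Continuous.mul (by fun_prop) ?_
  refine continuous_finsetSum _ fun n₁ _ => continuous_finsetSum _ fun n₂ _ =>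
    continuous_finsetSum _ fun n₃ _ => ?_
  split_ifs
  · exact ((X.continuous_coeff h u n₁).mul
      (Complex.continuous_conj.comp (X.continuous_coeff h u n₂))).mul (X.continuous_coeff h u n₃)
  · exact continuous_const

/-- Restarting at time $a$ without a semigroup property for the limit: at each truncation the
integrals over $[0,a]$ agree and cancel, and only then $N\to\infty$. -/
theorem duhamel_sub_of_isSolution {s b T a δ : ℝ} {p : ℝ≥0∞} (h : Admissible b p)
    {f : Freq → ℂ} {w₁ w₂ W₁ W₂ V₁ V₂ : X s b p} (hw₁ : IsSolution T f w₁.coeff)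
    (hw₂ : IsSolution T f w₂.coeff) (ha : 0 ≤ a) (haδ : a + δ ≤ T)
    (heq : ∀ t ∈ Icc (0 : ℝ) a, w₁.coeff t = w₂.coeff t)
    (hW₁ : ∀ t n, W₁.coeff t n = w₁.coeff (t + a) n)
    (hW₂ : ∀ t n, W₂.coeff t n = w₂.coeff (t + a) n)
    (hV₁ : IsDuhamel δ W₁.coeff W₁.coeff W₁.coeff V₁.coeff)
    (hV₂ : IsDuhamel δ W₂.coeff W₂.coeff W₂.coeff V₂.coeff) {t : ℝ} (ht : t ∈ Icc (0 : ℝ) δ)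
    (n : Freq) :
    W₁.coeff t n - W₂.coeff t n = Complex.I * (V₁.coeff t n - V₂.coeff t n) := by
  have hta : t + a ∈ Icc (0 : ℝ) T := ⟨add_nonneg ht.1 ha, by linarith [ht.2]⟩
  have hsplit : ∀ {w W : X s b p}, (∀ t n, W.coeff t n = w.coeff (t + a) n) → ∀ N : ℕ,
      ∫ t' in (0 : ℝ)..(t + a), propagator (t + a - t') (cubic N (w.coeff t')) n =
        (∫ t' in (0 : ℝ)..a, propagator (t + a - t') (cubic N (w.coeff t')) n) +
        ∫ t' in (0 : ℝ)..t, propagator (t - t') (cubic N (W.coeff t')) n := by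
    intro w W hW N
    have hc := continuous_propagator_cubic h w N (t + a) n
    rw [← intervalIntegral.integral_add_adjacent_intervals (hc.intervalIntegrable 0 a)
      (hc.intervalIntegrable a (t + a))]
    congr 1
    have h1 := intervalIntegral.integral_comp_add_right (a := 0) (b := t)
      (fun t' => propagator (t + a - t') (cubic N (w.coeff t')) n) a
    rw [zero_add] at h1
    rw [← h1]
    refine intervalIntegral.integral_congr fun t' _ => ?_
    have h2 : W.coeff t' = w.coeff (t' + a) := funext (hW t')
    simp only [h2, add_sub_add_right_eq_sub]
  have hA := (hw₁ (t + a) hta n).sub (hw₂ (t + a) hta n)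
  have hB := ((hV₁ t ht n).sub (hV₂ t ht n)).const_mul Complex.I
  rw [hW₁, hW₂]
  refine tendsto_nhds_unique hA (hB.congr fun N => ?_)
  have hP : ∫ t' in (0 : ℝ)..a, propagator (t + a - t') (cubic N (w₁.coeff t')) n =
      ∫ t' in (0 : ℝ)..a, propagator (t + a - t') (cubic N (w₂.coeff t')) n := by
    refine intervalIntegral.integral_congr fun t' ht' => ?_
    rw [uIcc_of_le ha] at ht'
    simp only [heq t' ht']
  rw [hsplit hW₁, hsplit hW₂, hP]
  simp only [cubic₃_self]
  ring

/-- Time translation preserves the $X^{s,b}_p$ norm, so one step length $\delta$ serves for all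
steps and induction reaches $T$. -/
theorem coeff_eq_of_isSolution {s b : ℝ} {p : ℝ≥0∞} [Fact (1 ≤ p)] (h : Admissible b p)
    (hb1 : b < 1) (hs : 1 - 1 / p.toReal < s) {T : ℝ} (hT : 0 < T) {f : Freq → ℂ}
    {w₁ w₂ : X s b p} (hw₁ : IsSolution T f w₁.coeff) (hw₂ : IsSolution T f w₂.coeff) :
    ∀ t ∈ Icc (0 : ℝ) T, w₁.coeff t = w₂.coeff t := by
  obtain ⟨C, hC, hD⟩ := exists_duhamel_operator h hb1 hs
  set M := max ‖w₁‖ ‖w₂‖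
  obtain ⟨K, hK, hδ1, hsmall⟩ := exists_short_time hb1 C (3 * (3 * M + 1) ^ 2) T
  have hK' : (0 : ℝ) < K := by exact_mod_cast hK
  set δ := T / K with hδdef
  have hδ : 0 < δ := by positivity
  obtain ⟨D, hDn, hDf⟩ := hD δ hδ hδ1
  have hKδ : K * δ = T := mul_div_cancel₀ T hK'.ne'
  have hind : ∀ k : ℕ, k ≤ K → ∀ t ∈ Icc (0 : ℝ) (k * δ), w₁.coeff t = w₂.coeff t := by
    intro k
    induction k with
    | zero =>
      intro _ t ht
      have ht0 : t = 0 := le_antisymm (by simpa using ht.2) ht.1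
      subst ht0
      funext n
      refine tendsto_nhds_unique (hw₁ 0 ⟨le_rfl, hT.le⟩ n) ((hw₂ 0 ⟨le_rfl, hT.le⟩ n).congr ?_)
      intro N
      simp
    | succ k ih =>
      intro hk t ht
      have ih' := ih (by omega)
      have ha : 0 ≤ k * δ := by positivity
      rcases le_total t (k * δ) with h1 | h1
      · exact ih' t ⟨ht.1, h1⟩
      obtain ⟨W₁, hW₁n, hW₁⟩ := X.exists_shift (k * δ) w₁
      obtain ⟨W₂, hW₂n, hW₂⟩ := X.exists_shift (k * δ) w₂
      have hle : k * δ + δ ≤ T := by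
        have : ((k + 1 : ℕ) : ℝ) ≤ K := by exact_mod_cast hk
        rw [← hKδ]
        push_cast at this
        nlinarith
      have h2 := coeff_eq_of_isDuhamel h (κ := C * δ ^ (1 - b)) (by positivity) hDn
        (fun u => hDf u u u) (hW₁n.le.trans (le_max_left _ _)) (hW₂n.le.trans (le_max_right _ _))
        (le_trans (le_of_eq (by ring)) hsmall) (fun t ht n => duhamel_sub_of_isSolution h hw₁ hw₂
          ha hle ih' hW₁ hW₂ (hDf W₁ W₁ W₁) (hDf W₂ W₂ W₂) ht n)
      funext n
      have h3 := h2 (t - k * δ) ⟨by linarith, by have := ht.2; push_cast at this; linarith⟩ n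
      rwa [hW₁, hW₂, sub_add_cancel] at h3
  intro t ht
  exact hind K le_rfl t (by rwa [hKδ])

theorem solution_unique {s b : ℝ} {p : ℝ≥0∞} [Fact (1 ≤ p)] (h : Admissible b p)
    (hb1 : b < 1) (hs : 1 - 1 / p.toReal < s) {T : ℝ} (hT : 0 < T) (f : FL s p)
    (u v : C(Icc (0 : ℝ) T, FL s p)) (hu : IsSolution T f.coeff (toPath hT.le u))
    (hv : IsSolution T f.coeff (toPath hT.le v)) (hu' : ∃ w : XLoc s h T, w.Represents u)
    (hv' : ∃ w : XLoc s h T, w.Represents v) : u = v := by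
  obtain ⟨-, w₁, -, hw₁⟩ := hu'
  obtain ⟨-, w₂, -, hw₂⟩ := hv'
  have h1 : ∀ t ∈ Icc (0 : ℝ) T, toPath hT.le u t = w₁.coeff t := fun t ht => by
    rw [toPath_apply hT.le u ht]
    exact funext fun n => (hw₁ ⟨t, ht⟩ n).symm
  have h2 : ∀ t ∈ Icc (0 : ℝ) T, toPath hT.le v t = w₂.coeff t := fun t ht => by
    rw [toPath_apply hT.le v ht]
    exact funext fun n => (hw₂ ⟨t, ht⟩ n).symm
  have h3 := coeff_eq_of_isSolution h hb1 hs hT (hu.congr h1) (hv.congr h2)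
  refine ContinuousMap.ext fun t => FL.ext fun n => ?_
  rw [← hw₁, ← hw₂, h3 t t.2]

/-! ### Fourier coefficients on the circle -/

instance : Fact ((0 : ℝ) < 1) := ⟨one_pos⟩

/-- The algebra of continuous functions on the circle. -/
abbrev CircleFun : Type := C(AddCircle (1 : ℝ), ℂ)

theorem CircleFun.integrable (F : CircleFun) : Integrable F (AddCircle.haarAddCircle (T := 1)) :=
  F.continuous.integrable_of_hasCompactSupport (HasCompactSupport.of_compactSpace F)

/-- The `k`-th Fourier coefficient, as a continuous functional. -/
def fourierFunctional (k : ℤ) : CircleFun →L[ℂ] ℂ :=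
  LinearMap.mkContinuous
    { toFun := fun F => fourierCoeff F k
      map_add' := fun F G => congrFun (fourierCoeff.add F.integrable G.integrable) k
      map_smul' := fun c F => fourierCoeff.const_smul F c k } 1 fun F => by
    change ‖∫ x : AddCircle (1 : ℝ), fourier (-k) x • F x ∂AddCircle.haarAddCircle‖ ≤ _
    refine (norm_integral_le_of_norm_le_const (C := ‖F‖) (Eventually.of_forall fun x => ?_)).trans
      (le_of_eq ?_)
    · rw [norm_smul, fourier_apply, Circle.norm_coe, one_mul]
      exact F.norm_coe_le_norm x
    · simp

theorem fourierFunctional_apply (k : ℤ) (F : CircleFun) :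
    fourierFunctional k F = fourierCoeff F k := rfl

theorem fourierFunctional_fourier_mul (k j : ℤ) (F : CircleFun) :
    fourierFunctional k (fourier j * F) = fourierFunctional (k - j) F := by
  simp only [fourierFunctional_apply, fourierCoeff, ContinuousMap.mul_apply, smul_eq_mul]
  refine integral_congr_ae (Eventually.of_forall fun x => ?_)
  simp only
  rw [← mul_assoc, ← fourier_add]
  congr 3
  ring

theorem fourierFunctional_one (k : ℤ) : fourierFunctional k 1 = if k = 0 then 1 else 0 := by
  simp only [fourierFunctional_apply, fourierCoeff, ContinuousMap.one_apply, smul_eq_mul, mul_one]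
  split_ifs with h
  · subst h
    simp
  · exact integral_eq_zero_of_add_right_eq_neg (μ := AddCircle.haarAddCircle)
      (fourier_add_half_inv_index (neg_ne_zero.mpr h) one_pos)

theorem star_fourier (j : ℤ) : star (fourier j : CircleFun) = fourier (-j) := by
  ext x
  rw [fourier_neg]
  rfl

theorem fourier_mul_fourier (i j : ℤ) :
    (fourier i * fourier j : CircleFun) = fourier (i + j) := by
  ext x
  rw [fourier_add]
  rfl

theorem fourierFunctional_fourier (k j : ℤ) :
    fourierFunctional k (fourier j) = if k = j then 1 else 0 := by
  have h := fourierFunctional_fourier_mul k j 1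
  rw [mul_one, fourierFunctional_one] at h
  simpa [sub_eq_zero] using h

/-- The Fourier coefficients of `F` are at most `B e^{-|k|}`. -/
def ExpDecay (B : ℝ) (F : CircleFun) : Prop :=
  ∀ k : ℤ, ‖fourierFunctional k F‖ ≤ B * Real.exp (-|(k : ℝ)|)

theorem expDecay_one : ExpDecay 1 1 := by
  intro k
  rw [fourierFunctional_one]
  split_ifs with h
  · simp [h]
  · rw [norm_zero]; positivity

/-- Multiplication by $e^{imx}$ shifts the coefficients, at the cost of a factor $e^{|m|}$. -/
theorem ExpDecay.sum_fourier_mul {B : ℝ} {F : CircleFun} (h : ExpDecay B F) {ι : Type*}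
    (S : Finset ι) (c : ι → ℂ) (m : ι → ℤ) :
    ExpDecay ((∑ i ∈ S, ‖c i‖ * Real.exp |(m i : ℝ)|) * B)
      ((∑ i ∈ S, c i • fourier (m i)) * F) := by
  intro k
  have hB : 0 ≤ B := by
    have := (norm_nonneg _).trans (h 0)
    simpa using this
  rw [Finset.sum_mul, map_sum, Finset.sum_mul, Finset.sum_mul]
  refine (norm_sum_le _ _).trans (Finset.sum_le_sum fun i _ => ?_)
  rw [smul_mul_assoc, map_smul, smul_eq_mul, norm_mul, fourierFunctional_fourier_mul]
  have h1 := h (k - m i)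
  have h2 : Real.exp (-|((k - m i : ℤ) : ℝ)|) ≤ Real.exp |(m i : ℝ)| * Real.exp (-|(k : ℝ)|) := by
    rw [← Real.exp_add]
    refine Real.exp_le_exp.mpr ?_
    push_cast
    have := abs_sub_abs_le_abs_sub (k : ℝ) (m i)
    linarith
  calc ‖c i‖ * ‖fourierFunctional (k - m i) F‖
      ≤ ‖c i‖ * (B * (Real.exp |(m i : ℝ)| * Real.exp (-|(k : ℝ)|))) := by
        gcongr
        exact h1.trans (mul_le_mul_of_nonneg_left h2 hB)
    _ = _ := by ring

/-- The trigonometric polynomial with coefficients `c j`, `j ∈ S`. -/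
def trigPoly (S : Finset ℤ) (c : ℤ → ℂ) : CircleFun := ∑ j ∈ S, c j • fourier j

theorem star_trigPoly (S : Finset ℤ) (c : ℤ → ℂ) :
    star (trigPoly S c) = ∑ j ∈ S, star (c j) • fourier (-j) := by
  rw [trigPoly, star_sum]
  refine Finset.sum_congr rfl fun j _ => ?_
  rw [star_smul, star_fourier]

theorem fourierFunctional_trigPoly (S : Finset ℤ) (c : ℤ → ℂ) (k : ℤ) :
    fourierFunctional k (trigPoly S c) = if k ∈ S then c k else 0 := by
  rw [trigPoly, map_sum]
  simp [fourierFunctional_fourier]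

/-- The norm `∑ |c j| e^{|j|}`. -/
def trigNorm (S : Finset ℤ) (c : ℤ → ℂ) : ℝ := ∑ j ∈ S, ‖c j‖ * Real.exp |(j : ℝ)|

theorem ExpDecay.trigPoly_mul {B : ℝ} {F : CircleFun} (h : ExpDecay B F) (S : Finset ℤ)
    (c : ℤ → ℂ) : ExpDecay (trigNorm S c * B) (trigPoly S c * F) :=
  h.sum_fourier_mul S c id

theorem ExpDecay.star_trigPoly_mul {B : ℝ} {F : CircleFun} (h : ExpDecay B F) (S : Finset ℤ)
    (c : ℤ → ℂ) : ExpDecay (trigNorm S c * B) (star (trigPoly S c) * F) := by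
  have h1 := h.sum_fourier_mul S (fun j => star (c j)) (fun j => -j)
  rw [star_trigPoly]
  convert h1 using 3
  refine Finset.sum_congr rfl fun j _ => ?_
  rw [norm_star, Int.cast_neg, abs_neg]

theorem expDecay_pow (S : Finset ℤ) (c : ℤ → ℂ) (m : ℕ) :
    ExpDecay (trigNorm S c * (trigNorm S c ^ 2) ^ m)
      (trigPoly S c * (trigPoly S c * star (trigPoly S c)) ^ m) := by
  induction m with
  | zero => simpa using expDecay_one.trigPoly_mul S c
  | succ m ih =>
    have h := (ih.star_trigPoly_mul S c).trigPoly_mul S c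
    convert h using 1
    · ring
    · ring

/-- Each term of the exponential series has coefficients decaying at the same exponential rate, and
the constants sum to an exponential; hence smoothness of the explicit solution. -/
theorem expDecay_exp (S : Finset ℤ) (c : ℤ → ℂ) (z : ℂ) :
    ExpDecay (trigNorm S c * Real.exp (‖z‖ * trigNorm S c ^ 2))
      (trigPoly S c * NormedSpace.exp (z • (trigPoly S c * star (trigPoly S c)))) := by
  intro k
  set g := trigPoly S c
  set G := trigNorm S c
  have h1 := ((NormedSpace.exp_series_hasSum_exp' (𝕂 := ℂ) (z • (g * star g))).mul_left g).mapL
    (fourierFunctional k)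
  have h2 : HasSum (fun m : ℕ => G * ((‖z‖ * G ^ 2) ^ m / m.factorial) * Real.exp (-|(k : ℝ)|))
      (G * Real.exp (‖z‖ * G ^ 2) * Real.exp (-|(k : ℝ)|)) := by
    have h3 := NormedSpace.expSeries_div_hasSum_exp (𝔸 := ℝ) (‖z‖ * G ^ 2)
    rw [← Real.exp_eq_exp_ℝ] at h3
    exact (h3.mul_left G).mul_right _
  refine h1.norm_le_of_bounded h2 fun m => ?_
  have h4 := expDecay_pow S c m k
  rw [smul_pow, mul_smul_comm, mul_smul_comm, map_smul, map_smul, smul_eq_mul, smul_eq_mul,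
    norm_mul, norm_mul, norm_pow, norm_inv, Complex.norm_natCast]
  calc _ ≤ ((m.factorial : ℝ))⁻¹ * (‖z‖ ^ m * (G * (G ^ 2) ^ m * Real.exp (-|(k : ℝ)|))) := by
        gcongr
    _ = _ := by rw [mul_pow]; ring

theorem summable_exp_neg_abs : Summable fun k : ℤ => Real.exp (-|(k : ℝ)|) := by
  refine summable_int_iff_summable_nat_and_neg.mpr ⟨?_, ?_⟩ <;>
  · simp only [Int.cast_neg, abs_neg, Int.cast_natCast, Nat.abs_cast]
    exact Real.summable_exp_neg_nat

theorem ExpDecay.summable {B : ℝ} {F : CircleFun} (h : ExpDecay B F) :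
    Summable fun k => ‖fourierFunctional k F‖ :=
  (summable_exp_neg_abs.mul_left B).of_nonneg_of_le (fun _ => norm_nonneg _) h

/-- The Fourier coefficients of `|F|² F`. -/
theorem hasSum_fourierFunctional_cubic {F : CircleFun}
    (h : Summable fun k => ‖fourierFunctional k F‖) (k : ℤ) :
    HasSum (fun ν : ℤ × ℤ × ℤ => if ν.1 - ν.2.1 + ν.2.2 = k then
      fourierFunctional ν.1 F * (starRingEnd ℂ) (fourierFunctional ν.2.1 F) *
        fourierFunctional ν.2.2 F else 0) (fourierFunctional k (F * (star F * F))) := by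
  have h1 : HasSum (fun i => fourierFunctional i F • (fourier i : CircleFun)) F :=
    hasSum_fourier_series_of_summable h.of_norm
  have h2 : HasSum (fun i => star (fourierFunctional i F • (fourier i : CircleFun))) (star F) :=
    h1.star
  have hn1 : Summable fun i => ‖fourierFunctional i F • (fourier i : CircleFun)‖ := by
    simpa only [norm_smul, fourier_norm, mul_one] using h
  have hn2 : Summable fun i => ‖star (fourierFunctional i F • (fourier i : CircleFun))‖ := by
    simpa only [norm_star] using hn1
  have hn3 := hn2.mul_norm hn1
  have h3 := h2.mul h1 hn3.of_norm
  have h4 := (h1.mul h3 (hn1.mul_norm hn3).of_norm).mapL (fourierFunctional k)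
  convert h4 using 2 with ν
  rw [star_smul, star_fourier, smul_mul_smul_comm, smul_mul_smul_comm, map_smul,
    fourier_mul_fourier, fourier_mul_fourier, fourierFunctional_fourier, smul_eq_mul]
  by_cases hν : ν.1 - ν.2.1 + ν.2.2 = k
  · rw [if_pos hν, if_pos (by omega), mul_one, mul_assoc]
    rfl
  · rw [if_neg hν, if_neg (by omega), mul_zero]

/-! ### Solutions with diagonal data -/

/-- The function `g e^{it|g|²}` for a trigonometric polynomial `g`. -/
def evol (S : Finset ℤ) (c : ℤ → ℂ) (t : ℝ) : CircleFun :=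
  trigPoly S c * NormedSpace.exp
    ((Complex.I * t) • (trigPoly S c * star (trigPoly S c)))

/-- The solution with data `∑ c_k e^{ik(x₁ + x₂)}`, on the Fourier side. -/
def diagSol (S : Finset ℤ) (c : ℤ → ℂ) (t : ℝ) (n : Freq) : ℂ :=
  if n.1 = n.2 then fourierFunctional n.1 (evol S c t) else 0

/-- The exponent is purely imaginary, so the modulus of $ge^{it|g|^2}$ is that of $g$. -/
theorem evol_cubic (S : Finset ℤ) (c : ℤ → ℂ) (t : ℝ) :
    evol S c t * (star (evol S c t) * evol S c t) =
      (trigPoly S c * star (trigPoly S c)) * evol S c t := by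
  unfold evol
  set g := trigPoly S c
  set X : CircleFun := (Complex.I * t) • (g * star g) with hX
  have h1 : star X = -X := by
    have h0 : star (g * star g) = g * star g := by rw [star_mul, star_star]
    rw [hX, star_smul, h0]
    simp
  have h2 : NormedSpace.exp X * NormedSpace.exp (-X) = 1 := by
    rw [← NormedSpace.exp_add_of_commute (Commute.refl X).neg_right, add_neg_cancel,
      NormedSpace.exp_zero]
  rw [star_mul, NormedSpace.star_exp, h1]
  calc _ = (NormedSpace.exp X * NormedSpace.exp (-X)) * ((g * star g) * (g * NormedSpace.exp X)) := by
        ring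
    _ = _ := by rw [h2, one_mul]

/-- As $|u|^2$ is conserved, the ODE is linear with constant coefficient $i|g|^2$ in the Banach
algebra of continuous functions. -/
theorem hasDerivAt_evol (S : Finset ℤ) (c : ℤ → ℂ) (t : ℝ) :
    HasDerivAt (evol S c) (Complex.I • (evol S c t * (star (evol S c t) * evol S c t))) t := by
  set h := trigPoly S c * star (trigPoly S c) with hh
  have h1 : ∀ r : ℝ, (Complex.I * r) • h = r • (Complex.I • h) := fun r => by
    rw [mul_comm, mul_smul]
    exact Complex.coe_smul r _
  have h2 := (hasDerivAt_exp_smul_const (𝕂 := ℝ) (Complex.I • h) t).const_mul (trigPoly S c)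
  have h3 : evol S c = fun r : ℝ => trigPoly S c * NormedSpace.exp (r • (Complex.I • h)) := by
    funext r
    rw [evol, h1]
  rw [evol_cubic, h3]
  refine h2.congr_deriv ?_
  simp only
  rw [mul_smul_comm, mul_smul_comm, ← hh]
  congr 1
  ring

theorem hasDerivAt_diagSol (S : Finset ℤ) (c : ℤ → ℂ) (t : ℝ) (k : ℤ) :
    HasDerivAt (fun t => fourierFunctional k (evol S c t))
      (Complex.I * fourierFunctional k (evol S c t * (star (evol S c t) * evol S c t))) t := by
  have h := ((fourierFunctional k).restrictScalars ℝ).hasFDerivAt.comp_hasDerivAt t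
    (hasDerivAt_evol S c t)
  refine h.congr_deriv ?_
  rw [ContinuousLinearMap.coe_restrictScalars', map_smul, smul_eq_mul]

theorem continuous_diagSol (S : Finset ℤ) (c : ℤ → ℂ) (n : Freq) :
    Continuous fun t => diagSol S c t n := by
  unfold diagSol
  split_ifs
  · exact continuous_iff_continuousAt.mpr fun t => (hasDerivAt_diagSol S c t n.1).continuousAt
  · exact continuous_const

/-- The weight `e^{-|k|}` on the diagonal. -/
def diagWeight (n : Freq) : ℝ := if n.1 = n.2 then Real.exp (-|(n.1 : ℝ)|) else 0

theorem diagWeight_nonneg (n : Freq) : 0 ≤ diagWeight n := by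
  unfold diagWeight
  split_ifs <;> positivity

theorem diag_injective : Function.Injective fun k : ℤ => ((k, k) : Freq) := fun _ _ h =>
  congrArg Prod.fst h

theorem notMem_range_diag {n : Freq} (h : n ∉ Set.range fun k : ℤ => ((k, k) : Freq)) :
    n.1 ≠ n.2 := fun h1 => h ⟨n.1, Prod.ext rfl h1⟩

theorem summable_diagWeight : Summable diagWeight := by
  refine (diag_injective.summable_iff fun n hn => ?_).mp ?_
  · rw [diagWeight, if_neg (notMem_range_diag hn)]
  · refine summable_exp_neg_abs.congr fun k => ?_
    simp [diagWeight]

theorem summable_bracket_diagWeight (σ : ℝ) {P : ℝ} (hP : 0 < P) :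
    Summable fun n => (bracket n ^ σ * diagWeight n) ^ P := by
  refine (diag_injective.summable_iff fun n hn => ?_).mp ?_
  · rw [diagWeight, if_neg (notMem_range_diag hn), mul_zero, Real.zero_rpow hP.ne']
  obtain ⟨K, hK⟩ := exists_nat_ge (σ * P)
  have h1 : Summable fun m : ℕ => 3 ^ K * Real.exp P *
      (((m + 1 : ℕ) : ℝ) ^ K * Real.exp (-P * (m + 1 : ℕ))) :=
    ((summable_nat_add_iff 1).mpr (Real.summable_pow_mul_exp_neg_nat_mul K hP)).mul_left _
  have hle : ∀ k : ℤ, (bracket (k, k) ^ σ * diagWeight (k, k)) ^ P ≤ 3 ^ K * Real.exp P *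
      (((k.natAbs + 1 : ℕ) : ℝ) ^ K * Real.exp (-P * (k.natAbs + 1 : ℕ))) := by
    intro k
    have hb0 := bracket_pos (k, k)
    have hb1 := one_le_bracket (k, k)
    have hkabs : ((k.natAbs : ℕ) : ℝ) = |(k : ℝ)| := by
      rw [Nat.cast_natAbs, Int.cast_abs]
    have hb2 : bracket (k, k) ≤ 3 * (|(k : ℝ)| + 1) := by
      refine (sq_le_sq₀ hb0.le (by positivity)).mp ?_
      rw [bracket_sq]
      nlinarith [sq_abs (k : ℝ), abs_nonneg (k : ℝ)]
    have hw : diagWeight (k, k) = Real.exp (-|(k : ℝ)|) := by simp [diagWeight]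
    rw [hw, Real.mul_rpow (by positivity) (by positivity), ← Real.rpow_mul hb0.le, ← Real.exp_mul]
    have h2 : bracket (k, k) ^ (σ * P) ≤ (3 * (|(k : ℝ)| + 1)) ^ K := by
      refine (Real.rpow_le_rpow_of_exponent_le hb1 hK).trans ?_
      rw [Real.rpow_natCast]
      gcongr
    have h3 : Real.exp (-P * (k.natAbs + 1 : ℕ)) = Real.exp (-|(k : ℝ)| * P) * Real.exp (-P) := by
      rw [← Real.exp_add]
      congr 1
      push_cast
      rw [hkabs]
      ring
    have h4 : Real.exp P * Real.exp (-P) = 1 := by rw [← Real.exp_add, add_neg_cancel, Real.exp_zero]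
    rw [h3]
    push_cast
    rw [hkabs]
    calc _ ≤ (3 * (|(k : ℝ)| + 1)) ^ K * Real.exp (-|(k : ℝ)| * P) := by gcongr
      _ = 3 ^ K * (|(k : ℝ)| + 1) ^ K * Real.exp (-|(k : ℝ)| * P) * (Real.exp P * Real.exp (-P)) := by
        rw [h4, mul_one, mul_pow]
      _ = _ := by ring
  refine Summable.of_nonneg_of_le (fun k => ?_) hle (summable_int_iff_summable_nat_and_neg.mpr ⟨?_, ?_⟩)
  · exact Real.rpow_nonneg (mul_nonneg (Real.rpow_nonneg (bracket_pos _).le _)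
      (diagWeight_nonneg _)) _
  · simpa using h1
  · simpa using h1

theorem norm_diagSol_le (S : Finset ℤ) (c : ℤ → ℂ) {T t : ℝ} (ht : t ∈ Icc (0 : ℝ) T) (n : Freq) :
    ‖diagSol S c t n‖ ≤ trigNorm S c * Real.exp (T * trigNorm S c ^ 2) * diagWeight n := by
  unfold diagSol diagWeight
  split_ifs with h
  · refine (expDecay_exp S c (Complex.I * t) n.1).trans ?_
    have h1 : ‖Complex.I * t‖ = t := by
      rw [norm_mul, Complex.norm_I, one_mul, Complex.norm_real, Real.norm_of_nonneg ht.1]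
    have h2 : 0 ≤ trigNorm S c := Finset.sum_nonneg fun j _ => by positivity
    rw [h1]
    have := ht.2
    gcongr
  · simp

/-- The exponential decay is uniform on $[0,T]$ and beats every power $\langle n\rangle^\sigma$. -/
theorem isSmoothPath_diagSol {p : ℝ≥0∞} [Fact (1 ≤ p)] (hp : 0 < p.toReal) (S : Finset ℤ)
    (c : ℤ → ℂ) (T : ℝ) : IsSmoothPath p T (diagSol S c) := by
  intro σ
  set C := trigNorm S c * Real.exp (T * trigNorm S c ^ 2)
  have hC : 0 ≤ C := mul_nonneg (Finset.sum_nonneg fun j _ => by positivity) (by positivity)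
  have hbd : ∀ t ∈ Icc (0 : ℝ) T, ∀ n, bracket n ^ σ * ‖diagSol S c t n‖ ≤
      C * (bracket n ^ σ * diagWeight n) := by
    intro t ht n
    have := bracket_pos n
    have h1 := norm_diagSol_le S c ht n
    calc _ ≤ bracket n ^ σ * (C * diagWeight n) := by gcongr
      _ = _ := by ring
  have hsum : ∀ A : ℝ, 0 ≤ A → Summable fun n => (A * (bracket n ^ σ * diagWeight n)) ^ p.toReal := by
    intro A hA
    have h0 : ∀ n, 0 ≤ bracket n ^ σ * diagWeight n := fun n => by
      have := bracket_pos n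
      have := diagWeight_nonneg n
      positivity
    simp_rw [Real.mul_rpow hA (h0 _)]
    exact (summable_bracket_diagWeight σ hp).mul_left _
  have hex : ∀ t : Icc (0 : ℝ) T, ∃ f : FL σ p, f.coeff = diagSol S c t := fun t =>
    FL.exists_of_bound hp (hsum C hC) (hbd t t.2)
  choose U hU using hex
  refine ⟨⟨U, continuous_iff_continuousAt.mpr fun t => ?_⟩, hU⟩
  refine FL.tendsto_of_dominated hp (hsum (2 * C) (by positivity)) (fun t' n => ?_) fun n => ?_
  · rw [hU, hU]
    have hb := bracket_pos n
    have h1 := hbd t t.2 n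
    have h2 := hbd t' t'.2 n
    have h3 := mul_le_mul_of_nonneg_left (norm_sub_le (diagSol S c t' n) (diagSol S c t n))
      (by positivity : 0 ≤ bracket n ^ σ)
    linarith
  · simp_rw [hU]
    exact ((continuous_diagSol S c n).comp continuous_subtype_val).tendsto t

theorem cubic_eq_sum (N : ℕ) (a : Freq → ℂ) (n : Freq) :
    cubic N a n = ∑ ν ∈ tripleBall N,
      if Interacts n ν then a ν.1 * (starRingEnd ℂ) (a ν.2.1) * a ν.2.2 else 0 :=
  cubic₃_eq_sum N a a a n

/-- A bound uniform in the truncation, used to pass to the limit under the time integral. -/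
theorem norm_cubic_le {a : Freq → ℂ} {w : Freq → ℝ} (hw : Summable w) (h : ∀ n, ‖a n‖ ≤ w n)
    (N : ℕ) (n : Freq) : ‖cubic N a n‖ ≤ (∑' n, w n) ^ 3 := by
  have hw0 : ∀ n, 0 ≤ w n := fun n => (norm_nonneg _).trans (h n)
  have h1 : ∀ ν : Freq × Freq × Freq,
      ‖if Interacts n ν then a ν.1 * (starRingEnd ℂ) (a ν.2.1) * a ν.2.2 else 0‖ ≤
        w ν.1 * (w ν.2.1 * w ν.2.2) := by
    intro ν
    have e1 := hw0 ν.1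
    have e2 := hw0 ν.2.1
    have e3 := hw0 ν.2.2
    split_ifs
    · rw [norm_mul, norm_mul, RCLike.norm_conj, mul_assoc]
      have := h ν.1
      have := h ν.2.1
      have := h ν.2.2
      gcongr
    · rw [norm_zero]; positivity
  rw [cubic_eq_sum]
  refine (norm_sum_le _ _).trans ((Finset.sum_le_sum fun ν _ => h1 ν).trans ?_)
  rw [tripleBall, Finset.sum_product]
  simp_rw [Finset.sum_product, ← Finset.mul_sum]
  rw [← Finset.sum_mul, ← Finset.sum_mul]
  have h2 : ∑ n ∈ freqBall N, w n ≤ ∑' n, w n := hw.sum_le_tsum _ fun n _ => hw0 n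
  have h3 : 0 ≤ ∑ n ∈ freqBall N, w n := Finset.sum_nonneg fun n _ => hw0 n
  calc _ = (∑ n ∈ freqBall N, w n) ^ 3 := by ring
    _ ≤ _ := by gcongr

theorem tendsto_tripleBall : Tendsto tripleBall atTop atTop := by
  refine tendsto_atTop_finset_of_monotone (fun N M h => ?_) fun ν => ?_
  · exact Finset.product_subset_product (freqBall_mono h)
      (Finset.product_subset_product (freqBall_mono h) (freqBall_mono h))
  · obtain ⟨N₁, h1⟩ := exists_mem_freqBall ν.1
    obtain ⟨N₂, h2⟩ := exists_mem_freqBall ν.2.1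
    obtain ⟨N₃, h3⟩ := exists_mem_freqBall ν.2.2
    refine ⟨N₁ + N₂ + N₃, ?_⟩
    simp only [tripleBall, Finset.mem_product]
    exact ⟨freqBall_mono (by omega) h1, freqBall_mono (by omega) h2, freqBall_mono (by omega) h3⟩

theorem tendsto_cubic_diagSol (S : Finset ℤ) (c : ℤ → ℂ) (t : ℝ) (k : ℤ) :
    Tendsto (fun N => cubic N (diagSol S c t) (k, k)) atTop
      (𝓝 (fourierFunctional k (evol S c t * (star (evol S c t) * evol S c t)))) := by
  have h1 := hasSum_fourierFunctional_cubic (expDecay_exp S c (Complex.I * t)).summable k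
  have hinj : Function.Injective fun ν : ℤ × ℤ × ℤ =>
      (((ν.1, ν.1), (ν.2.1, ν.2.1), (ν.2.2, ν.2.2)) : Freq × Freq × Freq) := by
    rintro ⟨a, b, c⟩ ⟨a', b', c'⟩ h
    simp only [Prod.mk.injEq, and_self] at h
    simp [h]
  have h2 : HasSum (fun ν : Freq × Freq × Freq => if Interacts (k, k) ν then
      diagSol S c t ν.1 * (starRingEnd ℂ) (diagSol S c t ν.2.1) * diagSol S c t ν.2.2 else 0)
      (fourierFunctional k (evol S c t * (star (evol S c t) * evol S c t))) := by
    refine (hinj.hasSum_iff fun ν hν => ?_).mp ?_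
    · by_cases e1 : ν.1.1 = ν.1.2
      · by_cases e2 : ν.2.1.1 = ν.2.1.2
        · by_cases e3 : ν.2.2.1 = ν.2.2.2
          · exact absurd ⟨(ν.1.1, ν.2.1.1, ν.2.2.1),
              Prod.ext (Prod.ext rfl e1) (Prod.ext (Prod.ext rfl e2) (Prod.ext rfl e3))⟩ hν
          · rw [diagSol, diagSol, diagSol, if_neg e3, mul_zero, ite_self]
        · rw [diagSol, diagSol, if_neg e2, map_zero, mul_zero, zero_mul, ite_self]
      · rw [diagSol, if_neg e1, zero_mul, zero_mul, ite_self]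
    · refine (congrArg (fun f => HasSum f _) (funext fun ν => ?_)).mp h1
      simp only [Function.comp_apply, diagSol, if_true]
      refine if_congr ?_ rfl rfl
      simp [Interacts, Prod.ext_iff]
  exact (h2.comp tendsto_tripleBall).congr fun N => (cubic_eq_sum N _ _).symm

theorem cubic_diagSol_eq_zero (S : Finset ℤ) (c : ℤ → ℂ) (t : ℝ) (N : ℕ) {n : Freq}
    (hn : n.1 ≠ n.2) : cubic N (diagSol S c t) n = 0 := by
  rw [cubic_eq_sum]
  refine Finset.sum_eq_zero fun ν _ => ?_
  by_cases hν : Interacts n ν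
  · rw [if_pos hν]
    by_cases e1 : ν.1.1 = ν.1.2
    · by_cases e2 : ν.2.1.1 = ν.2.1.2
      · by_cases e3 : ν.2.2.1 = ν.2.2.2
        · refine absurd ?_ hn
          rw [← hν]
          simp [e1, e2, e3]
        · rw [diagSol, diagSol, diagSol, if_neg e3, mul_zero]
      · rw [diagSol, diagSol, if_neg e2, map_zero, mul_zero, zero_mul]
    · rw [diagSol, if_neg e1, zero_mul, zero_mul]
  · rw [if_neg hν]

theorem continuous_cubic_diagSol (S : Finset ℤ) (c : ℤ → ℂ) (N : ℕ) (n : Freq) :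
    Continuous fun t => cubic N (diagSol S c t) n := by
  unfold cubic
  refine continuous_finsetSum _ fun n₁ _ => continuous_finsetSum _ fun n₂ _ =>
    continuous_finsetSum _ fun n₃ _ => ?_
  split_ifs
  · exact ((continuous_diagSol S c n₁).mul
      (Complex.continuous_conj.comp (continuous_diagSol S c n₂))).mul (continuous_diagSol S c n₃)
  · exact continuous_const

/-- On the diagonal the propagator is the identity and Duhamel's formula is the fundamental theorem
of calculus for the ODE. Off the diagonal everything vanishes, as the diagonal is closed under
$n_1-n_2+n_3$. -/
theorem isSolution_diagSol (S : Finset ℤ) (c : ℤ → ℂ) (T : ℝ) :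
    IsSolution T (diagSol S c 0) (diagSol S c) := by
  intro t ht n
  by_cases hn : n.1 = n.2
  · obtain ⟨k, rfl⟩ : ∃ k : ℤ, n = (k, k) := ⟨n.1, Prod.ext rfl hn.symm⟩
    have hprop : ∀ (r : ℝ) (a : Freq → ℂ), propagator r a (k, k) = a (k, k) := fun r a => by
      simp [propagator, hypSq]
    simp_rw [hprop]
    have hd : ∀ r, diagSol S c r (k, k) = fourierFunctional k (evol S c r) := fun r => by
      simp [diagSol]
    have hlim : Tendsto (fun N : ℕ => ∫ t' in (0 : ℝ)..t, cubic N (diagSol S c t') (k, k)) atTop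
        (𝓝 (∫ t' in (0 : ℝ)..t,
          fourierFunctional k (evol S c t' * (star (evol S c t') * evol S c t')))) := by
      refine intervalIntegral.tendsto_integral_filter_of_dominated_convergence
        (fun _ => (∑' n, trigNorm S c * Real.exp (T * trigNorm S c ^ 2) * diagWeight n) ^ 3)
        (Eventually.of_forall fun N => (continuous_cubic_diagSol S c N _).aestronglyMeasurable)
        (Eventually.of_forall fun N => Eventually.of_forall fun t' ht' => ?_)
        intervalIntegrable_const (Eventually.of_forall fun t' ht' => ?_)
      · rw [uIoc_of_le ht.1] at ht'
        exact norm_cubic_le (summable_diagWeight.mul_left _)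
          (norm_diagSol_le S c ⟨ht'.1.le, ht'.2.trans ht.2⟩) N _
      · rw [uIoc_of_le ht.1] at ht'
        exact tendsto_cubic_diagSol S c t' k
    have hcont : Continuous (evol S c) :=
      continuous_iff_continuousAt.mpr fun r => (hasDerivAt_evol S c r).continuousAt
    have hFTC := intervalIntegral.integral_eq_sub_of_hasDerivAt (a := 0) (b := t)
      (fun r _ => hasDerivAt_diagSol S c r k) (Continuous.intervalIntegrable (by
        have := (fourierFunctional k).continuous
        fun_prop) _ _)
    rw [intervalIntegral.integral_const_mul] at hFTC
    have h1 := (hlim.const_mul Complex.I).const_add (diagSol S c 0 (k, k))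
    rw [hFTC, hd, add_sub_cancel] at h1
    rw [hd, hd]
    exact h1
  · have h1 : diagSol S c t n = 0 := if_neg hn
    have h2 : diagSol S c 0 n = 0 := if_neg hn
    simp_rw [propagator, cubic_diagSol_eq_zero S c _ _ hn, h1, h2]
    simp

/-! ### Third derivatives along lines -/

section ThirdDerivative

variable {E F : Type*} [NormedAddCommGroup E] [NormedSpace ℝ E] [NormedAddCommGroup F]
  [NormedSpace ℝ F]

/-- `v` is the third derivative of `φ` at `0`. -/
def HasThirdDerivAt (φ : ℝ → F) (v : F) : Prop :=
  ∃ φ₁ φ₂ : ℝ → F, (∀ᶠ ε in 𝓝 0, HasDerivAt φ (φ₁ ε) ε) ∧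
    (∀ᶠ ε in 𝓝 0, HasDerivAt φ₁ (φ₂ ε) ε) ∧ HasDerivAt φ₂ v 0

/-- Derivatives of equal germs are equal germs; applied twice, this makes the third derivative
depend on the germ alone. -/
theorem eventuallyEq_of_hasDerivAt {φ ψ φ' ψ' : ℝ → F} (h : φ =ᶠ[𝓝 0] ψ)
    (hφ : ∀ᶠ ε in 𝓝 0, HasDerivAt φ (φ' ε) ε) (hψ : ∀ᶠ ε in 𝓝 0, HasDerivAt ψ (ψ' ε) ε) :
    φ' =ᶠ[𝓝 0] ψ' := by
  filter_upwards [h.eventually_nhds, hφ, hψ] with ε h1 h2 h3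
  exact (h2.congr_of_eventuallyEq (EventuallyEq.symm h1)).unique h3

theorem HasThirdDerivAt.unique {φ ψ : ℝ → F} {v w : F} (hφ : HasThirdDerivAt φ v)
    (hψ : HasThirdDerivAt ψ w) (h : φ =ᶠ[𝓝 0] ψ) : v = w := by
  obtain ⟨φ₁, φ₂, h1, h2, h3⟩ := hφ
  obtain ⟨ψ₁, ψ₂, k1, k2, k3⟩ := hψ
  have e1 := eventuallyEq_of_hasDerivAt h h1 k1
  have e2 := eventuallyEq_of_hasDerivAt e1 h2 k2
  exact (h3.congr_of_eventuallyEq e2.symm).unique k3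

theorem HasThirdDerivAt.map {G : Type*} [NormedAddCommGroup G] [NormedSpace ℝ G] {φ : ℝ → F}
    {v : F} (h : HasThirdDerivAt φ v) (L : F →L[ℝ] G) :
    HasThirdDerivAt (fun ε => L (φ ε)) (L v) := by
  obtain ⟨φ₁, φ₂, h1, h2, h3⟩ := h
  refine ⟨fun ε => L (φ₁ ε), fun ε => L (φ₂ ε), ?_, ?_, ?_⟩
  · filter_upwards [h1] with ε h
    exact L.hasFDerivAt.comp_hasDerivAt ε h
  · filter_upwards [h2] with ε h
    exact L.hasFDerivAt.comp_hasDerivAt ε h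
  · exact L.hasFDerivAt.comp_hasDerivAt 0 h3

-- The chain rule along $\varepsilon\mapsto\varepsilon f$, three times. The constant is the norm of
-- the third Fréchet derivative at $0$ and so is uniform in the direction.
set_option maxSynthPendingDepth 3 in
theorem hasThirdDerivAt_line {Φ : E → F} (h : ContDiffAt ℝ 3 Φ 0) :
    ∃ C : ℝ, 0 ≤ C ∧ ∀ f : E, ∃ v : F, ‖v‖ ≤ C * ‖f‖ ^ 3 ∧
      HasThirdDerivAt (fun ε : ℝ => Φ (ε • f)) v := by
  have hA : ContDiffAt ℝ 2 (fderiv ℝ Φ) 0 := h.fderiv_right (by norm_num)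
  have hB : ContDiffAt ℝ 1 (fderiv ℝ (fderiv ℝ Φ)) 0 := hA.fderiv_right (by norm_num)
  have hΦe := h.eventually (by simp)
  have hAe := hA.eventually (by simp)
  refine ⟨‖fderiv ℝ (fderiv ℝ (fderiv ℝ Φ)) 0‖, norm_nonneg _, fun f => ?_⟩
  have hline : ∀ ε : ℝ, HasDerivAt (fun ε : ℝ => ε • f) f ε := fun ε => by
    simpa using (hasDerivAt_id ε).smul_const f
  have htend : Tendsto (fun ε : ℝ => ε • f) (𝓝 0) (𝓝 0) := by
    have := (hline 0).continuousAt.tendsto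
    simpa using this
  refine ⟨fderiv ℝ (fderiv ℝ (fderiv ℝ Φ)) 0 f f f, ?_, fun ε => fderiv ℝ Φ (ε • f) f,
    fun ε => fderiv ℝ (fderiv ℝ Φ) (ε • f) f f, ?_, ?_, ?_⟩
  · set D := fderiv ℝ (fderiv ℝ (fderiv ℝ Φ)) 0
    have h1 := (D f f).le_opNorm f
    have h2 := (D f).le_opNorm f
    have h3 := D.le_opNorm f
    calc ‖D f f f‖ ≤ ‖D f f‖ * ‖f‖ := h1
      _ ≤ ‖D f‖ * ‖f‖ * ‖f‖ := by gcongr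
      _ ≤ ‖D‖ * ‖f‖ * ‖f‖ * ‖f‖ := by gcongr
      _ = _ := by ring
  · filter_upwards [htend.eventually hΦe] with ε hε
    exact (hε.differentiableAt (by norm_num)).hasFDerivAt.comp_hasDerivAt ε (hline ε)
  · filter_upwards [htend.eventually hAe] with ε hε
    have h1 := (hε.differentiableAt (by norm_num)).hasFDerivAt.comp_hasDerivAt ε (hline ε)
    exact (ContinuousLinearMap.apply ℝ F f).hasFDerivAt.comp_hasDerivAt ε h1
  · have h0 : HasFDerivAt (fderiv ℝ (fderiv ℝ Φ)) (fderiv ℝ (fderiv ℝ (fderiv ℝ Φ)) 0)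
        ((0 : ℝ) • f) := by
      rw [zero_smul]
      exact (hB.differentiableAt (by norm_num)).hasFDerivAt
    have h1 := h0.comp_hasDerivAt 0 (hline 0)
    have h2 := (ContinuousLinearMap.apply ℝ _ f).hasFDerivAt.comp_hasDerivAt (0 : ℝ) h1
    exact (ContinuousLinearMap.apply ℝ F f).hasFDerivAt.comp_hasDerivAt (0 : ℝ) h2

end ThirdDerivative

/-- The expansion is $\varepsilon g+\varepsilon^3gY+O(\varepsilon^5)$, and $6=3!$. -/
theorem hasThirdDerivAt_exp {A : Type*} [NormedCommRing A] [NormedAlgebra ℝ A] [CompleteSpace A]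
    [NormedAlgebra ℚ A] (g Y : A) :
    HasThirdDerivAt (fun ε : ℝ => ε • (g * NormedSpace.exp (ε ^ 2 • Y))) ((6 : ℝ) • (g * Y)) := by
  have he : ∀ ε : ℝ, HasDerivAt (fun ε : ℝ => NormedSpace.exp (ε ^ 2 • Y))
      ((2 * ε) • (NormedSpace.exp (ε ^ 2 • Y) * Y)) ε := by
    intro ε
    have h1 := (hasDerivAt_exp_smul_const (𝕂 := ℝ) Y (ε ^ 2)).scomp ε (hasDerivAt_pow 2 ε)
    refine h1.congr_deriv ?_
    simp
  refine ⟨fun ε => g * NormedSpace.exp (ε ^ 2 • Y) +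
      (2 * ε ^ 2) • (g * Y * NormedSpace.exp (ε ^ 2 • Y)),
    fun ε => (6 * ε) • (g * Y * NormedSpace.exp (ε ^ 2 • Y)) +
      (4 * ε ^ 3) • (g * Y * Y * NormedSpace.exp (ε ^ 2 • Y)), ?_, ?_, ?_⟩
  · refine Eventually.of_forall fun ε => ?_
    have h1 := (hasDerivAt_id ε).smul ((he ε).const_mul g)
    refine h1.congr_deriv ?_
    simp only [id, mul_smul_comm, smul_smul, one_smul]
    rw [add_comm]
    congr 1
    congr 1
    · ring
    · ring
  · refine Eventually.of_forall fun ε => ?_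
    have h1 : HasDerivAt (fun ε : ℝ => 2 * ε ^ 2) (2 * (2 * ε)) ε := by
      simpa using (hasDerivAt_pow 2 ε).const_mul 2
    have h2 := ((he ε).const_mul g).add (h1.smul ((he ε).const_mul (g * Y)))
    refine h2.congr_deriv ?_
    simp only [mul_smul_comm, smul_smul]
    rw [show g * (NormedSpace.exp (ε ^ 2 • Y) * Y) = g * Y * NormedSpace.exp (ε ^ 2 • Y) by ring,
      show g * Y * (NormedSpace.exp (ε ^ 2 • Y) * Y) =
        g * Y * Y * NormedSpace.exp (ε ^ 2 • Y) by ring]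
    module
  · have h1 : HasDerivAt (fun ε : ℝ => 6 * ε) 6 0 := by
      simpa using (hasDerivAt_id (0 : ℝ)).const_mul 6
    have h2 : HasDerivAt (fun ε : ℝ => 4 * ε ^ 3) (4 * (3 * 0 ^ 2)) 0 := by
      simpa using (hasDerivAt_pow 3 (0 : ℝ)).const_mul 4
    have h3 := (h1.smul ((he 0).const_mul (g * Y))).add
      (h2.smul ((he 0).const_mul (g * Y * Y)))
    refine h3.congr_deriv ?_
    simp

/-! ### The third derivative of the solution map -/

theorem trigPoly_smul (S : Finset ℤ) (c : ℤ → ℂ) (ε : ℝ) :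
    trigPoly S (fun j => ε * c j) = ε • trigPoly S c := by
  rw [trigPoly, trigPoly, Finset.smul_sum]
  refine Finset.sum_congr rfl fun j _ => ?_
  rw [mul_smul]
  exact Complex.coe_smul ε _

theorem evol_smul (S : Finset ℤ) (c : ℤ → ℂ) (ε t : ℝ) :
    evol S (fun j => ε * c j) t = ε • (trigPoly S c * NormedSpace.exp
      (ε ^ 2 • ((Complex.I * t) • (trigPoly S c * star (trigPoly S c))))) := by
  rw [evol, trigPoly_smul, smul_mul_assoc]
  congr 3
  rw [star_smul, smul_mul_smul_comm, smul_comm, star_trivial, sq]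

theorem diagSol_zero (S : Finset ℤ) (c : ℤ → ℂ) (n : Freq) :
    diagSol S c 0 n = if n.1 = n.2 ∧ n.1 ∈ S then c n.1 else 0 := by
  rw [diagSol, evol]
  simp only [Complex.ofReal_zero, mul_zero, zero_smul, NormedSpace.exp_zero, mul_one,
    fourierFunctional_trigPoly]
  by_cases h1 : n.1 = n.2 <;> by_cases h2 : n.1 ∈ S <;> simp [h1, h2]

theorem isDiagonalPolynomial_diagSol (S : Finset ℤ) (c : ℤ → ℂ) :
    IsDiagonalPolynomial (diagSol S c 0) := by
  have h : ∀ n, diagSol S c 0 n ≠ 0 → n.1 = n.2 ∧ n.1 ∈ S := fun n hn => by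
    rw [diagSol_zero] at hn
    exact of_not_not fun h => hn (if_neg h)
  refine ⟨((S ×ˢ S).finite_toSet).subset fun n hn => ?_, fun n hn => (h n hn).1⟩
  have h1 := h n hn
  simp only [Finset.coe_product, mem_prod, Finset.mem_coe]
  exact ⟨h1.2, h1.1 ▸ h1.2⟩

/-- The `n`-th Fourier coefficient, as a continuous functional. -/
def FL.coeffCLM {s : ℝ} {p : ℝ≥0∞} [Fact (1 ≤ p)] (hp : p ≠ 0) (n : Freq) : FL s p →L[ℂ] ℂ :=
  LinearMap.mkContinuous
    { toFun := fun f => f.coeff n, map_add' := fun _ _ => rfl, map_smul' := fun _ _ => rfl }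
    (bracket n ^ s)⁻¹ fun f => by
      have h1 : 0 < bracket n ^ s := Real.rpow_pos_of_pos (bracket_pos n) s
      rw [inv_mul_eq_div, le_div_iff₀ h1, mul_comm]
      exact FL.norm_coeff_le hp f n

/-- If the solution map at time `t` is `C³` at `0`, its third derivative in the direction of a
diagonal trigonometric polynomial `g` is `6it|g|²g`. -/
theorem exists_third_derivative {p : ℝ≥0∞} [Fact (1 ≤ p)] (hp : 1 < p) (hpt : p ≠ ⊤) {s t : ℝ}
    {Φ : FL s p → FL s p}
    (hΦ : ∀ᶠ f in 𝓝 (0 : FL s p), IsDiagonalPolynomial f.coeff →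
      ∀ u : ℝ → Freq → ℂ, IsSmoothPath p t u → IsSolution t f.coeff u → (Φ f).coeff = u t)
    (hC : ContDiffAt ℝ 3 Φ 0) :
    ∃ C : ℝ, 0 ≤ C ∧ ∀ (S : Finset ℤ) (c : ℤ → ℂ) (f : FL s p), f.coeff = diagSol S c 0 →
      ∃ v : FL s p, ‖v‖ ≤ C * ‖f‖ ^ 3 ∧ ∀ k : ℤ, v.coeff (k, k) = 6 * (Complex.I * t *
        fourierFunctional k (trigPoly S c * (star (trigPoly S c) * trigPoly S c))) := by
  have hp0 : p ≠ 0 := (zero_lt_one.trans hp).ne'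
  have hpr := ENNReal.toReal_pos hp0 hpt
  obtain ⟨C, hC0, hC⟩ := hasThirdDerivAt_line hC
  refine ⟨C, hC0, fun S c f hf => ?_⟩
  obtain ⟨v, hv, hv3⟩ := hC f
  refine ⟨v, hv, fun k => ?_⟩
  have h1 := hv3.map ((FL.coeffCLM (s := s) hp0 (k, k)).restrictScalars ℝ)
  have h2 := (hasThirdDerivAt_exp (trigPoly S c)
    ((Complex.I * t) • (trigPoly S c * star (trigPoly S c)))).map
      ((fourierFunctional k).restrictScalars ℝ)
  have htend : Tendsto (fun ε : ℝ => ε • f) (𝓝 0) (𝓝 0) := by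
    have : Continuous fun ε : ℝ => ε • f := by fun_prop
    simpa using this.tendsto 0
  -- For small $\varepsilon$ the map $\Phi$ must return the explicit solution with data $\varepsilon
  -- f$, so the two curves of $k$-th coefficients have the same germ.
  have h3 := h1.unique h2 (by
    filter_upwards [htend.eventually hΦ] with ε hε
    have h4 : (ε • f).coeff = diagSol S (fun j => ε * c j) 0 := by
      funext n
      change (ε : ℂ) * f.coeff n = _
      rw [hf, diagSol_zero, diagSol_zero]
      split_ifs <;> simp
    rw [h4] at hε
    have h5 := hε (isDiagonalPolynomial_diagSol _ _) _ (isSmoothPath_diagSol hpr S _ t)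
      (isSolution_diagSol S _ t)
    change (Φ (ε • f)).coeff (k, k) = _
    rw [h5, diagSol, if_pos rfl, evol_smul]
    rfl)
  have h6 : (6 : ℝ) • (trigPoly S c * ((Complex.I * t) • (trigPoly S c * star (trigPoly S c)))) =
      (6 * (Complex.I * t)) • (trigPoly S c * (star (trigPoly S c) * trigPoly S c)) := by
    rw [mul_smul_comm, mul_smul 6 (Complex.I * (t : ℂ)), mul_comm (star (trigPoly S c))]
    have h7 := Complex.coe_smul (6 : ℝ)
      ((Complex.I * t) • (trigPoly S c * (trigPoly S c * star (trigPoly S c))))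
    rw [Complex.ofReal_ofNat] at h7
    exact h7.symm
  refine h3.trans ?_
  rw [h6, ContinuousLinearMap.coe_restrictScalars', map_smul, smul_eq_mul, mul_assoc]

/-! ### Growth of the cubic term on arithmetic progressions -/

/-- The frequencies `2M ≤ k ≤ 4M`. -/
def freqBlock (M : ℕ) : Finset ℤ := Finset.Icc (2 * (M : ℤ)) (4 * M)

/-- All coefficients are $1$, so no cancellation occurs and the cubic coefficient counts
representations. -/
theorem fourierFunctional_cubic_trigPoly (S : Finset ℤ) (k : ℤ) :
    fourierFunctional k (trigPoly S 1 * (star (trigPoly S 1) * trigPoly S 1)) =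
      (((S ×ˢ S ×ˢ S).filter fun ν => ν.1 - ν.2.1 + ν.2.2 = k).card : ℂ) := by
  have hsum : Summable fun k => ‖fourierFunctional k (trigPoly S 1)‖ := by
    refine summable_of_ne_finset_zero (s := S) fun k hk => ?_
    rw [fourierFunctional_trigPoly, if_neg hk, norm_zero]
  refine (hasSum_fourierFunctional_cubic hsum k).unique ?_
  have h1 : ((((S ×ˢ S ×ˢ S).filter fun ν => ν.1 - ν.2.1 + ν.2.2 = k).card : ℕ) : ℂ) =
      ∑ ν ∈ S ×ˢ S ×ˢ S, if ν.1 - ν.2.1 + ν.2.2 = k then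
        fourierFunctional ν.1 (trigPoly S 1) *
          (starRingEnd ℂ) (fourierFunctional ν.2.1 (trigPoly S 1)) *
          fourierFunctional ν.2.2 (trigPoly S 1) else 0 := by
    rw [← Finset.sum_boole]
    refine Finset.sum_congr rfl fun ν hν => ?_
    simp only [Finset.mem_product] at hν
    simp only [fourierFunctional_trigPoly, if_pos hν.1, if_pos hν.2.1, if_pos hν.2.2,
      Pi.one_apply, map_one, mul_one]
  rw [h1]
  refine hasSum_sum_of_ne_finset_zero fun ν hν => ?_
  split_ifs
  · simp only [Finset.mem_product, not_and_or] at hν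
    simp only [fourierFunctional_trigPoly]
    rcases hν with h | h | h
    · rw [if_neg h, zero_mul, zero_mul]
    · rw [if_neg h, map_zero, mul_zero, zero_mul]
    · rw [if_neg h, mul_zero]
  · rfl

theorem le_card_cubic (M : ℕ) {k : ℤ} (hk : k ∈ freqBlock M) :
    (M + 1) ^ 2 ≤ ((freqBlock M ×ˢ freqBlock M ×ˢ freqBlock M).filter
      fun ν => ν.1 - ν.2.1 + ν.2.2 = k).card := by
  have h1 : (M + 1) ^ 2 = (Finset.range (M + 1) ×ˢ Finset.range (M + 1)).card := by
    rw [Finset.card_product, Finset.card_range, sq]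
  rw [h1]
  rw [freqBlock, Finset.mem_Icc] at hk
  -- With $h=\lfloor(k-2M)/2\rfloor\le M$, the shifts of $2M+h$ and $k-h$ by $x_1,x_2\in[0,M]$ stay
  -- in the block, and so does the middle frequency $2M+x_1+x_2$.
  refine Finset.card_le_card_of_injOn (fun x => (2 * (M : ℤ) + (k - 2 * M) / 2 + x.1,
    2 * (M : ℤ) + x.1 + x.2, k - (k - 2 * M) / 2 + x.2)) (fun x hx => ?_) fun x hx y hy hxy => ?_
  · simp only [Finset.coe_product, Finset.coe_range, mem_prod, mem_Iio] at hx
    simp only [freqBlock, Finset.coe_filter, Finset.mem_product, Finset.mem_Icc, Set.mem_ofPred_eq]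
    omega
  · simp only [Prod.mk.injEq] at hxy
    exact Prod.ext (by omega) (by omega)

theorem hasSum_diag {a : Freq → ℝ} (S : Finset ℤ) (h : ∀ n, ¬(n.1 = n.2 ∧ n.1 ∈ S) → a n = 0) :
    HasSum a (∑ k ∈ S, a (k, k)) := by
  refine (diag_injective.hasSum_iff fun n hn => ?_).mp ?_
  · exact h n fun h1 => notMem_range_diag hn h1.1
  · refine hasSum_sum_of_ne_finset_zero fun k hk => ?_
    exact h (k, k) fun h1 => hk h1.2

theorem bracket_rpow_le {M : ℕ} (hM : 1 ≤ M) (r : ℝ) {k : ℤ} (hk : k ∈ freqBlock M) :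
    bracket (k, k) ^ r ≤ 6 ^ |r| * (M : ℝ) ^ r := by
  have hM' : (1 : ℝ) ≤ M := by exact_mod_cast hM
  have hk1 : 2 * (M : ℝ) ≤ k := by exact_mod_cast (Finset.mem_Icc.mp hk).1
  have hk2 : (k : ℝ) ≤ 4 * M := by exact_mod_cast (Finset.mem_Icc.mp hk).2
  have hb := bracket_pos (k, k)
  have hsq := bracket_sq (k, k)
  simp only at hsq
  have h1 : (M : ℝ) ≤ bracket (k, k) := by
    refine (sq_le_sq₀ (by linarith) hb.le).mp ?_
    nlinarith
  have h2 : bracket (k, k) ≤ 6 * M := by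
    refine (sq_le_sq₀ hb.le (by linarith)).mp ?_
    nlinarith
  rcases le_total 0 r with hr | hr
  · rw [abs_of_nonneg hr, ← Real.mul_rpow (by norm_num) (by linarith)]
    exact Real.rpow_le_rpow hb.le h2 hr
  · have h3 : bracket (k, k) ^ r ≤ (M : ℝ) ^ r :=
      Real.rpow_le_rpow_of_nonpos (by linarith) h1 hr
    have h4 : (1 : ℝ) ≤ 6 ^ |r| := Real.one_le_rpow (by norm_num) (abs_nonneg _)
    exact h3.trans (le_mul_of_one_le_left (by positivity) h4)

/-- The block has $2M+1$ frequencies, each of weight comparable to $M^s$. -/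
theorem norm_block_le {p : ℝ≥0∞} [Fact (1 ≤ p)] (hp : 0 < p.toReal) {s : ℝ} {M : ℕ} (hM : 1 ≤ M)
    {f : FL s p} (hf : f.coeff = diagSol (freqBlock M) 1 0) :
    ‖f‖ ≤ (3 * 6 ^ |s * p.toReal|) ^ p.toReal⁻¹ * (M : ℝ) ^ (s + 1 / p.toReal) := by
  set P := p.toReal
  have hM' : (1 : ℝ) ≤ M := by exact_mod_cast hM
  have h1 := FL.hasSum_norm hp f
  have h2 : HasSum (fun n => (bracket n ^ s * ‖f.coeff n‖) ^ P)
      (∑ k ∈ freqBlock M, (bracket (k, k) ^ s * ‖f.coeff (k, k)‖) ^ P) := by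
    refine hasSum_diag (a := fun n => (bracket n ^ s * ‖f.coeff n‖) ^ P) _ fun n hn => ?_
    rw [hf, diagSol_zero, if_neg hn, norm_zero, mul_zero, Real.zero_rpow hp.ne']
  have h3 : ‖f‖ ^ P ≤ 3 * 6 ^ |s * P| * ((M : ℝ) ^ (s + 1 / P)) ^ P := by
    rw [h1.unique h2]
    have h4 : ∀ k ∈ freqBlock M, (bracket (k, k) ^ s * ‖f.coeff (k, k)‖) ^ P ≤
        6 ^ |s * P| * (M : ℝ) ^ (s * P) := by
      intro k hk
      have hb := bracket_pos (k, k)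
      rw [hf, diagSol_zero, if_pos ⟨rfl, hk⟩, Pi.one_apply, norm_one, mul_one,
        ← Real.rpow_mul hb.le]
      exact bracket_rpow_le hM _ hk
    refine (Finset.sum_le_card_nsmul _ _ _ h4).trans ?_
    have h5 : ((freqBlock M).card : ℝ) ≤ 3 * M := by
      have : (freqBlock M).card = 2 * M + 1 := by
        rw [freqBlock, Int.card_Icc]; omega
      rw [this]; push_cast; linarith
    have h6 : ((M : ℝ) ^ (s + 1 / P)) ^ P = (M : ℝ) ^ (s * P) * M := by
      rw [← Real.rpow_mul (by linarith), add_mul, one_div, inv_mul_cancel₀ hp.ne',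
        Real.rpow_add (by linarith), Real.rpow_one]
    rw [h6, nsmul_eq_mul]
    calc _ ≤ 3 * (M : ℝ) * (6 ^ |s * P| * (M : ℝ) ^ (s * P)) := by gcongr
      _ = _ := by ring
  have h7 := Real.rpow_le_rpow (by positivity) h3 (inv_pos.mpr hp).le
  rw [Real.mul_rpow (by positivity) (by positivity), Real.rpow_rpow_inv (norm_nonneg _) hp.ne',
    Real.rpow_rpow_inv (by positivity) hp.ne'] at h7
  exact h7

theorem norm_block_pos {p : ℝ≥0∞} [Fact (1 ≤ p)] {s : ℝ} (M : ℕ) {f : FL s p}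
    (hf : f.coeff = diagSol (freqBlock M) 1 0) : 0 < ‖f‖ := by
  refine norm_pos_iff.mpr fun h => ?_
  have h1 : f.coeff (2 * M, 2 * M) = 0 := by rw [h]; rfl
  rw [hf, diagSol_zero, if_pos ⟨rfl, Finset.mem_Icc.mpr ⟨le_rfl, by omega⟩⟩] at h1
  exact one_ne_zero h1

/-- Output and data are compared frequency by frequency on the same block, so the weights cancel and
no lower bound for $\|f\|$ is needed. -/
theorem mul_norm_block_le {p : ℝ≥0∞} [Fact (1 ≤ p)] (hp : 0 < p.toReal) {s A : ℝ} (hA : 0 ≤ A)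
    {S : Finset ℤ} {f v : FL s p} (hf : f.coeff = diagSol S 1 0)
    (hv : ∀ k ∈ S, A ≤ ‖v.coeff (k, k)‖) : A * ‖f‖ ≤ ‖v‖ := by
  refine (Real.rpow_le_rpow_iff (by positivity) (norm_nonneg _) hp).mp ?_
  rw [Real.mul_rpow hA (norm_nonneg _)]
  refine hasSum_le (fun n => ?_) ((FL.hasSum_norm hp f).mul_left _) (FL.hasSum_norm hp v)
  have hb := bracket_pos n
  rw [← Real.mul_rpow hA (by positivity)]
  refine Real.rpow_le_rpow (by positivity) ?_ hp.le
  rw [hf, diagSol_zero]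
  split_ifs with h
  · rw [Pi.one_apply, norm_one, mul_one, mul_comm]
    have h1 := hv n.1 h.2
    have h2 : ((n.1, n.1) : Freq) = n := Prod.ext rfl h.1
    rw [h2] at h1
    gcongr
  · rw [norm_zero, mul_zero, mul_zero]
    positivity

/-- Below the critical regularity, the solution map is not `C³`. -/
theorem not_contDiffAt {p : ℝ≥0∞} [Fact (1 ≤ p)] (hp : 1 < p) (hpt : p ≠ ⊤) {s t : ℝ}
    (hs : s < 1 - 1 / p.toReal) (ht : 0 < t) {Φ : FL s p → FL s p}
    (hΦ : ∀ᶠ f in 𝓝 (0 : FL s p), IsDiagonalPolynomial f.coeff →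
      ∀ u : ℝ → Freq → ℂ, IsSmoothPath p t u → IsSolution t f.coeff u → (Φ f).coeff = u t) :
    ¬ ContDiffAt ℝ 3 Φ 0 := by
  intro hC
  have hp0 : p ≠ 0 := (zero_lt_one.trans hp).ne'
  have hpr := ENNReal.toReal_pos hp0 hpt
  obtain ⟨C, hC0, hC⟩ := exists_third_derivative hp hpt hΦ hC
  -- The distance to the critical regularity. After division by $\|f\|$ the inequality
  -- $M^2\lesssim\|f\|^2$ fails by the factor $M^{2\theta}$.
  set θ := 1 - (s + 1 / p.toReal)
  have hθ : 0 < 2 * θ := by simp only [θ]; linarith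
  set B : ℝ := (3 * 6 ^ |s * p.toReal| : ℝ) ^ p.toReal⁻¹
  have hbd : ∀ M : ℕ, 1 ≤ M → 6 * t * (M : ℝ) ^ (2 * θ) ≤ C * B ^ 2 := by
    intro M hM
    have hM' : (1 : ℝ) ≤ M := by exact_mod_cast hM
    -- The trivial time interval is used only to see that the block data lie in $\mathcal FL^{s,p}$.
    obtain ⟨U, hU⟩ := isSmoothPath_diagSol hpr (freqBlock M) 1 0 s
    obtain ⟨f, hf⟩ : ∃ f : FL s p, f.coeff = diagSol (freqBlock M) 1 0 := ⟨U ⟨0, by simp⟩, hU _⟩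
    obtain ⟨v, hv, hvk⟩ := hC (freqBlock M) 1 f hf
    have hf0 := norm_block_pos M hf
    have h1 : ∀ k ∈ freqBlock M, 6 * t * (M : ℝ) ^ 2 ≤ ‖v.coeff (k, k)‖ := by
      intro k hk
      have h2 := (Nat.cast_le (α := ℝ)).mpr (le_card_cubic M hk)
      push_cast at h2
      rw [hvk, fourierFunctional_cubic_trigPoly, norm_mul, norm_mul, norm_mul, Complex.norm_I,
        Complex.norm_real, Real.norm_of_nonneg ht.le, Complex.norm_natCast, Complex.norm_ofNat,
        one_mul, mul_assoc]
      gcongr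
      nlinarith
    have h3 := (mul_norm_block_le hpr (by positivity) hf h1).trans hv
    have h4 : 6 * t * (M : ℝ) ^ 2 ≤ C * ‖f‖ ^ 2 := by
      refine le_of_mul_le_mul_right ?_ hf0
      calc _ ≤ C * ‖f‖ ^ 3 := h3
        _ = _ := by ring
    have h5 := norm_block_le hpr hM hf
    have h6 : C * ‖f‖ ^ 2 ≤ C * (B * (M : ℝ) ^ (s + 1 / p.toReal)) ^ 2 := by gcongr
    have hr : 0 < (M : ℝ) ^ (s + 1 / p.toReal) := Real.rpow_pos_of_pos (by linarith) _
    have h7 : (M : ℝ) ^ 2 = (M : ℝ) ^ (2 * θ) * ((M : ℝ) ^ (s + 1 / p.toReal)) ^ 2 := by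
      rw [← Real.rpow_two, ← Real.rpow_two, ← Real.rpow_mul (by linarith),
        ← Real.rpow_add (by linarith)]
      congr 1
      simp only [θ]
      ring
    rw [h7] at h4
    refine le_of_mul_le_mul_right ?_ (pow_pos hr 2)
    calc _ = 6 * t * ((M : ℝ) ^ (2 * θ) * ((M : ℝ) ^ (s + 1 / p.toReal)) ^ 2) := by ring
      _ ≤ _ := h4.trans h6
      _ = _ := by ring
  have hlim : Tendsto (fun M : ℕ => 6 * t * (M : ℝ) ^ (2 * θ)) atTop atTop :=
    ((tendsto_rpow_atTop hθ).comp tendsto_natCast_atTop_atTop).const_mul_atTop (by positivity)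
  obtain ⟨M, hM1, hM2⟩ := ((eventually_ge_atTop 1).and
    (hlim.eventually_gt_atTop (C * B ^ 2))).exists
  exact absurd (hbd M hM1) (not_le.mpr hM2)

end HNLS

end

/-- Let `1 < p < ∞`. (i) For `s > 1 - 1/p`, the cubic HNLS on `𝕋²` is semilinearly locally
well-posed in `FL^{s,p}(𝕋²)`: for some `b > 1 - 1/p`, data in a ball have solutions in
`C([0, T]; FL^{s,p}) ∩ X^{s,b}_p(T)`, where `T > 0` depends only on the radius of the ball, these
depend smoothly on the data with values in both spaces, and solutions in this class are unique.
(ii) For `s < 1 - 1/p` and every `t > 0`, a map `Φ` on `FL^{s,p}(𝕋²)` that sends data near `0` to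
the smooth solution at time `t`, even if this is required only for trigonometric polynomials with
frequencies on the diagonal, is not `C³` at `0`. -/
theorem theorem1p1 (p : ℝ≥0∞) [Fact (1 ≤ p)] (hp : 1 < p) (hp' : p < ⊤) (s : ℝ) :
    (1 - 1 / p.toReal < s →
      ∃ (b : ℝ) (hb : HNLS.Admissible b p),
        (∀ R : ℝ, 0 < R →
          ∃ (T : ℝ) (hT : 0 < T) (Φ : HNLS.FL s p → C(Icc (0 : ℝ) T, HNLS.FL s p))
            (Ψ : HNLS.FL s p → HNLS.XLoc s hb T),
            (∀ f : HNLS.FL s p, ‖f‖ < R →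
              HNLS.IsSolution T f.coeff (HNLS.toPath hT.le (Φ f)) ∧
              HNLS.XLoc.Represents (Ψ f) (Φ f)) ∧
            ContDiffOn ℝ ((⊤ : ℕ∞) : WithTop ℕ∞) Φ (Metric.ball 0 R) ∧
            ContDiffOn ℝ ((⊤ : ℕ∞) : WithTop ℕ∞) Ψ (Metric.ball 0 R)) ∧
        (∀ (T : ℝ) (hT : 0 < T) (f : HNLS.FL s p) (u v : C(Icc (0 : ℝ) T, HNLS.FL s p)),
          HNLS.IsSolution T f.coeff (HNLS.toPath hT.le u) →
          HNLS.IsSolution T f.coeff (HNLS.toPath hT.le v) →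
          (∃ w : HNLS.XLoc s hb T, w.Represents u) →
          (∃ w : HNLS.XLoc s hb T, w.Represents v) →
          u = v)) ∧
    (s < 1 - 1 / p.toReal →
      ∀ t : ℝ, 0 < t → ∀ Φ : HNLS.FL s p → HNLS.FL s p,
        (∀ᶠ f in 𝓝 (0 : HNLS.FL s p), HNLS.IsDiagonalPolynomial f.coeff →
          ∀ u : ℝ → HNLS.Freq → ℂ, HNLS.IsSmoothPath p t u → HNLS.IsSolution t f.coeff u →
            (Φ f).coeff = u t) →
        ¬ ContDiffAt ℝ 3 Φ 0) := by
  constructor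
  · intro hs
    have hp1 : 1 < p.toReal := by simpa using ENNReal.toReal_strict_mono hp'.ne hp
    have hinv : 0 < 1 / p.toReal := by positivity
    -- The midpoint of $(1-\frac1p,1)$: the lower bound gives the embedding into continuous
    -- functions, the upper bound the gain $T^{1-b}$.
    have hb : HNLS.Admissible (1 - 1 / p.toReal / 2) p := ⟨hp, hp'.ne, by linarith⟩
    have hb1 : 1 - 1 / p.toReal / 2 < 1 := by linarith
    exact ⟨_, hb, fun R hR => HNLS.exists_local_solution hb hb1 hs R hR,
      fun T hT f u v hu hv => HNLS.solution_unique hb hb1 hs hT f u v hu hv⟩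
  · intro hs t ht Φ hΦ
    exact HNLS.not_contDiffAt hp hp'.ne hs ht hΦ
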